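/- Let $N\ge 1$ and $0<T_A\le T_B<\infty$. On the state space $\Omega_N=[0,\infty)^N$ consider the integrable heat-conduction model with parameter $s=1/2$, whose generator acts on bounded $C^1$ functions $f:\Omega_N\to\mathbb R$ by $$\begin{aligned}L_Nf(z)={}&\sum_{\substack{1\le x,y\le N\\|x-y|=1}}\int_0^{z_x}\frac{d\alpha}{\alpha}\,[f(z-\alpha\delta_x+\alpha\delta_y)-f(z)]\\&+\int_0^{z_1}\frac{d\alpha}{\alpha}\,[f(z-\alpha\delta_1)-f(z)]+\int_0^\infty\frac{d\alpha}{\alpha}\,e^{-\alpha/T_A}[f(z+\alpha\delta_1)-f(z)]\\&+\int_0^{z_N}\frac{d\alpha}{\alpha}\,[f(z-\alpha\delta_N)-f(z)]+\int_0^\infty\frac{d\alpha}{\alpha}\,e^{-\alpha/T_B}[f(z+\alpha\delta_N)-f(z)],\end{aligned}$$ where $\delta_x$ is the $x$-th unit vector. A probability measure $\nu$ on $\Omega_N$ is called invariant if $\int L_Nf\,d\nu=0$ for every bounded $C^1$ function $f$ on $\Omega_N$ for which $L_Nf$ is $\nu$-integrable. Let $\mathcal E_m(z)=\frac1m e^{-z/m}\mathbf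 1_{\{z\ge0\}}$ be the exponential density of mean $m$, and let $O_N=\{m\in\mathbb R^N: T_A\le m_1\le\dots\le m_N\le T_B\}$, with Lebesgue volume $|O_N|$. Then there is exactly one invariant probability measure. It has the density $$\mu(z)=\frac1{|O_N|}\int_{O_N}\prod_{x=1}^N\mathcal E_{m_x}(z_x)\,dm\quad\text{if }T_A<T_B,\qquad \mu(z)=\prod_{x=1}^N\mathcal E_{T}(z_x)\quad\text{if }T_A=T_B=T.$$ Moreover $\mu$ (which is $0$ outside $\Omega_N$) satisfies the stationarity equation at every $z\in(0,\infty)^N$, all integrals being absolutely convergent: $$\begin{aligned}0={}&\sum_{(x,T)\in\{(1,T_A),(N,T_B)\}}\Big\{\int_0^{z_x}\frac{d\alpha}{\alpha}e^{-\alpha/T}[\mu(z-\alpha\delta_x)-\mu(z)]-\mu(z)\int_{z_x}^\infty\frac{d\alpha}{\alpha}e^{-\alpha/T}\\&\qquad\qquad+\int_0^{z_x}\frac{d\alpha}{\alpha}[\mu(z+\alpha\delta_x)-\mu(z)]+\int_{z_x}^\infty\frac{d\alpha}{\alpha}\mu(z+\alpha\delta_x)\Big\}\\&+\sum_{\substack{1\le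 x,y\le N\\|x-y|=1}}\Big\{\int_0^{z_x}\frac{d\alpha}{\alpha}[\mu(z+\alpha\delta_x-\alpha\delta_y)-\mu(z)]+\int_{z_x}^\infty\frac{d\alpha}{\alpha}\mu(z+\alpha\delta_x-\alpha\delta_y)\Big\},\end{aligned}$$ where for $N=1$ the first sum has two terms, one for each bath. -/

import Mathlib

open MeasureTheory Set

noncomputable section

namespace HeatConduction

/-! The chain has `N = n + 1 ≥ 1` sites, indexed by `Fin (n + 1)`; site `0` touches the left bath
and site `Fin.last n` the right bath (they coincide when `N = 1`). A configuration is a vector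
`z : Fin (n + 1) → ℝ` with `0 ≤ z`. The vector `α δ_x` is `Pi.single x α`. -/

/-- Sites `x`, `y` of the chain are nearest neighbours. -/
def Adjacent {n : ℕ} (x y : Fin (n + 1)) : Prop := |((x : ℕ) : ℤ) - ((y : ℕ) : ℤ)| = 1

instance {n : ℕ} (x y : Fin (n + 1)) : Decidable (Adjacent x y) :=
  inferInstanceAs (Decidable (_ = _))

/-- Bulk generator: energy `α ∈ (0, z_x)` moves from `x` to a nearest neighbour `y` with intensity
`dα/α`; the sum is over ordered pairs. -/
def bulkGenerator (n : ℕ) (f : (Fin (n + 1) → ℝ) → ℝ) (z : Fin (n + 1) → ℝ) : ℝ :=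
  ∑ p : Fin (n + 1) × Fin (n + 1) with Adjacent p.1 p.2,
    ∫ α in (0 : ℝ)..z p.1, (f (z - Pi.single p.1 α + Pi.single p.2 α) - f z) / α

/-- Interaction of site `x` with a heat bath at temperature `T`: energy `α ∈ (0, z_x)` leaves with
intensity `dα/α`, and energy `α > 0` enters with intensity `e^{-α/T} dα/α`. -/
def bathGenerator {n : ℕ} (T : ℝ) (x : Fin (n + 1)) (f : (Fin (n + 1) → ℝ) → ℝ)
    (z : Fin (n + 1) → ℝ) : ℝ :=
  (∫ α in (0 : ℝ)..z x, (f (z - Pi.single x α) - f z) / α) +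
    ∫ α in Ioi (0 : ℝ), Real.exp (-α / T) / α * (f (z + Pi.single x α) - f z)

/-- The generator `L_N`, `N = n + 1`. -/
def generator (n : ℕ) (TA TB : ℝ) (f : (Fin (n + 1) → ℝ) → ℝ) (z : Fin (n + 1) → ℝ) : ℝ :=
  bulkGenerator n f z + (bathGenerator TA 0 f z + bathGenerator TB (Fin.last n) f z)

/-- The functions on which the generator acts: bounded and `C¹` on the (closed) state space
`[0, ∞)^N`. All integrals in `generator n TA TB f z` converge absolutely for such `f`, for
`TA, TB > 0` and `0 ≤ z`. -/
structure IsTestFunction {n : ℕ} (f : (Fin (n + 1) → ℝ) → ℝ) : Prop where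
  contDiffOn : ContDiffOn ℝ 1 f {z | 0 ≤ z}
  bounded : ∃ C : ℝ, ∀ z, 0 ≤ z → |f z| ≤ C

/-- `ν` is an invariant probability measure, on the state space `[0, ∞)^N`, of the dynamics with
generator `L`: `∫ L f dν = 0` for every bounded `C¹` function `f` for which this integral
exists. (`L f` is bounded on the state space, so that the integral exists, whenever `f` has
compact support.) -/
structure IsInvariantMeasure (n : ℕ) (TA TB : ℝ) (ν : Measure (Fin (n + 1) → ℝ)) : Prop where
  isProbabilityMeasure : IsProbabilityMeasure ν
  ae_nonneg : ∀ᵐ z ∂ν, 0 ≤ z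
  integral_generator_eq_zero : ∀ f : (Fin (n + 1) → ℝ) → ℝ, IsTestFunction f →
    Integrable (generator n TA TB f) ν → ∫ z, generator n TA TB f z ∂ν = 0

/-! The stationarity equation for a density `μ` that vanishes off `[0, ∞)^N`, at a point `z` with
positive coordinates. -/

/-- Balance at `z` of the energy that enters at `x` from a bath at temperature `T`. -/
def entranceBalance {n : ℕ} (T : ℝ) (x : Fin (n + 1)) (μ : (Fin (n + 1) → ℝ) → ℝ)
    (z : Fin (n + 1) → ℝ) : ℝ :=
  (∫ α in (0 : ℝ)..z x, Real.exp (-α / T) / α * (μ (z - Pi.single x α) - μ z)) -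
    μ z * ∫ α in Ioi (z x), Real.exp (-α / T) / α

/-- The integrals in `entranceBalance` converge absolutely. -/
def EntranceConverges {n : ℕ} (T : ℝ) (x : Fin (n + 1)) (μ : (Fin (n + 1) → ℝ) → ℝ)
    (z : Fin (n + 1) → ℝ) : Prop :=
  IntervalIntegrable (fun α => Real.exp (-α / T) / α * (μ (z - Pi.single x α) - μ z))
      volume 0 (z x) ∧
    IntegrableOn (fun α => Real.exp (-α / T) / α) (Ioi (z x))

/-- Balance at `z` of the energy that leaves `x` to a bath. -/
def exitBalance {n : ℕ} (x : Fin (n + 1)) (μ : (Fin (n + 1) → ℝ) → ℝ)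
    (z : Fin (n + 1) → ℝ) : ℝ :=
  (∫ α in (0 : ℝ)..z x, (μ (z + Pi.single x α) - μ z) / α) +
    ∫ α in Ioi (z x), μ (z + Pi.single x α) / α

/-- The integrals in `exitBalance` converge absolutely. -/
def ExitConverges {n : ℕ} (x : Fin (n + 1)) (μ : (Fin (n + 1) → ℝ) → ℝ)
    (z : Fin (n + 1) → ℝ) : Prop :=
  IntervalIntegrable (fun α => (μ (z + Pi.single x α) - μ z) / α) volume 0 (z x) ∧
    IntegrableOn (fun α => μ (z + Pi.single x α) / α) (Ioi (z x))

/-- Balance at `z` of the energy that moves from `x` to `y`. -/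
def transferBalance {n : ℕ} (x y : Fin (n + 1)) (μ : (Fin (n + 1) → ℝ) → ℝ)
    (z : Fin (n + 1) → ℝ) : ℝ :=
  (∫ α in (0 : ℝ)..z x, (μ (z + Pi.single x α - Pi.single y α) - μ z) / α) +
    ∫ α in Ioi (z x), μ (z + Pi.single x α - Pi.single y α) / α

/-- The integrals in `transferBalance` converge absolutely. -/
def TransferConverges {n : ℕ} (x y : Fin (n + 1)) (μ : (Fin (n + 1) → ℝ) → ℝ)
    (z : Fin (n + 1) → ℝ) : Prop :=
  IntervalIntegrable (fun α => (μ (z + Pi.single x α - Pi.single y α) - μ z) / α)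
      volume 0 (z x) ∧
    IntegrableOn (fun α => μ (z + Pi.single x α - Pi.single y α) / α) (Ioi (z x))

/-- The density `μ` solves the stationarity equation at every configuration with positive
energies, all integrals in it being absolutely convergent. -/
structure IsStationaryDensity (n : ℕ) (TA TB : ℝ) (μ : (Fin (n + 1) → ℝ) → ℝ) : Prop where
  eq_zero_of_not_nonneg : ∀ z, ¬ 0 ≤ z → μ z = 0
  converges : ∀ z : Fin (n + 1) → ℝ, (∀ x, 0 < z x) →
    EntranceConverges TA 0 μ z ∧ ExitConverges 0 μ z ∧
    EntranceConverges TB (Fin.last n) μ z ∧ ExitConverges (Fin.last n) μ z ∧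
    ∀ x y, Adjacent x y → TransferConverges x y μ z
  balance : ∀ z : Fin (n + 1) → ℝ, (∀ x, 0 < z x) →
    entranceBalance TA 0 μ z + exitBalance 0 μ z +
      entranceBalance TB (Fin.last n) μ z + exitBalance (Fin.last n) μ z +
      ∑ p : Fin (n + 1) × Fin (n + 1) with Adjacent p.1 p.2, transferBalance p.1 p.2 μ z = 0

/-- Density of the exponential distribution of mean `m > 0`. -/
def expDensity (m z : ℝ) : ℝ := if 0 ≤ z then 1 / m * Real.exp (-z / m) else 0

/-- Inhomogeneous product of exponential densities, with means `m_x`. -/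
def prodExpDensity {n : ℕ} (m z : Fin (n + 1) → ℝ) : ℝ := ∏ x, expDensity (m x) (z x)

/-- The ordered simplex `TA ≤ m_1 ≤ ⋯ ≤ m_N ≤ TB`. -/
def orderedSimplex (n : ℕ) (TA TB : ℝ) : Set (Fin (n + 1) → ℝ) :=
  {m | TA ≤ m 0 ∧ Monotone m ∧ m (Fin.last n) ≤ TB}

/-- The uniform mixture over the ordered simplex of products of exponential densities. -/
def mixtureDensity (n : ℕ) (TA TB : ℝ) (z : Fin (n + 1) → ℝ) : ℝ :=
  1 / (volume (orderedSimplex n TA TB)).toReal *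
    ∫ m in orderedSimplex n TA TB, prodExpDensity m z

/-- `μ` is the density of the invariant measure: it solves the stationarity equation, and the
measure with density `μ` is an invariant probability measure and the only one. -/
def IsDensityOfTheInvariantMeasure (n : ℕ) (TA TB : ℝ) (μ : (Fin (n + 1) → ℝ) → ℝ) : Prop :=
  IsStationaryDensity n TA TB μ ∧
    ∀ ν : Measure (Fin (n + 1) → ℝ), IsInvariantMeasure n TA TB ν ↔
      ν = volume.withDensity (fun z => ENNReal.ofReal (μ z))

end HeatConduction

end

/-! Every transition is a jump `z ↦ z - α v` with intensity `exp (-τ α) dα / α`, for finitely many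
directions `v`. Generator and stationarity equation are sums of one integral per direction, and
direction by direction the balance operator is the adjoint of the generator
(`IsTame.integral_mul_integral_jumpKernel`: Fubini, then translation invariance of Lebesgue measure
at fixed `α`).

Existence rests on an explicit computation for a product of exponentials with means `m`. The balance
of a transfer `x → y` equals the change produced when `m y` jumps to a point `t` between `m y` and
`m x` with intensity `dt / |t - m y|`, plus a logarithmic term that the reverse transfer cancels
(`integral_balanceKernel_transfer`). Entrance and exit at a bath together make the mean jump towards
the bath temperature (`integral_balanceKernel_bath`). The adjoint thus acts on products as a jump
process of the means (`sum_balance_prodExpDensity`). From a point of the ordered simplex, the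
coordinate `x` moves exactly within the fibre of the simplex, and `1 / |t - m x|` is symmetric in
`t` and `m x`. The uniform law is therefore reversible (`integral_exchange_eq_zero`), which gives
the stationarity equation for the mixture. A cutoff passes from Lipschitz functions to all
admissible test functions (`IsTame.integral_mul_sum_jumpKernel`).

Uniqueness uses duality. Applied to `exp (-l · z)`, the generator becomes moves of the coordinates
of `l` towards neighbouring coordinates, or towards `0` at the ends, together with killing
(`generator_laplaceKernel`). The difference of the Laplace transforms of two invariant measures
solves the resulting equation and vanishes at `l = 0`. A maximum principle
(`nonpos_of_moveGenerator`) forces it to be zero, and the Laplace transform determines the measure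
(`ext_of_laplaceTransform`). -/

namespace HeatConduction

/-! ### Jumps in an orthant and pointwise bounds on their kernels. -/

section Jumps

variable {ι : Type*} [Fintype ι]

/-- The exponential envelope `exp (-β ∑ z_i)`. -/
noncomputable def decay (β : ℝ) (z : ι → ℝ) : ℝ := Real.exp (-(β * ∑ i, z i))

/-- Jumps `z ↦ z - α v` with intensity `exp (-τ α) dα / α`: a transfer from `x` to `y` has
`v = δ_x - δ_y`, `τ = 0`, an exit at `x` has `v = δ_x`, `τ = 0` and an entrance at `x` from a bath
at temperature `T` has `v = -δ_x`, `τ = 1 / T`. -/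
structure IsJump (β τ : ℝ) (v : ι → ℝ) : Prop where
  coord : ∀ i, v i = -1 ∨ v i = 0 ∨ v i = 1
  ne_zero : ∃ i, v i ≠ 0
  nonneg : 0 ≤ τ
  tilt : 0 ≤ τ + β * ∑ i, v i
  loss : β ≤ τ ∨ ∃ i, v i = 1
  gain : β ≤ τ + β * ∑ i, v i ∨ ∃ i, v i = -1

/-- Exponentially decaying functions on the orthant, with a Lipschitz bound of the same decay. -/
structure IsTame (β C : ℝ) (μ : (ι → ℝ) → ℝ) : Prop where
  measurable : Measurable μ
  eq_zero : ∀ z, ¬ 0 ≤ z → μ z = 0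
  abs_le : ∀ z, 0 ≤ z → |μ z| ≤ C * decay β z
  abs_sub_le : ∀ z z', 0 ≤ z → 0 ≤ z' →
    |μ z - μ z'| ≤ C * (∑ i, |z i - z' i|) * (decay β z + decay β z')

open Classical in
/-- Integrand of the generator of a jump. -/
noncomputable def jumpKernel (τ : ℝ) (v : ι → ℝ) (f : (ι → ℝ) → ℝ) (z : ι → ℝ) (α : ℝ) : ℝ :=
  if 0 ≤ z - α • v then Real.exp (-(τ * α)) / α * (f (z - α • v) - f z) else 0

open Classical in
/-- Integrand of the adjoint of the generator of a jump. -/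
noncomputable def balanceKernel (τ : ℝ) (v : ι → ℝ) (μ : (ι → ℝ) → ℝ) (z : ι → ℝ) (α : ℝ) : ℝ :=
  Real.exp (-(τ * α)) / α * (μ (z + α • v) - if 0 ≤ z - α • v then μ z else 0)

lemma decay_pos (β : ℝ) (z : ι → ℝ) : 0 < decay β z := Real.exp_pos _

lemma measurable_decay (β : ℝ) : Measurable (decay β : (ι → ℝ) → ℝ) := by
  unfold decay; fun_prop

lemma decay_add (β : ℝ) (z v : ι → ℝ) (α : ℝ) :
    decay β (z + α • v) = decay β z * Real.exp (-(β * (∑ i, v i) * α)) := by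
  simp only [decay, ← Real.exp_add, Pi.add_apply, Pi.smul_apply, smul_eq_mul,
    Finset.sum_add_distrib, ← Finset.mul_sum]
  congr 1; ring

section Bounds

variable {β τ C : ℝ} {v : ι → ℝ} {μ : (ι → ℝ) → ℝ} {z : ι → ℝ} {α : ℝ}

lemma IsJump.exp_le_one (hv : IsJump β τ v) (hα : 0 ≤ α) : Real.exp (-(τ * α)) ≤ 1 :=
  Real.exp_le_one_iff.2 (by have := mul_nonneg hv.nonneg hα; linarith)

lemma IsJump.exp_mul_decay_add (z : ι → ℝ) :
    Real.exp (-(τ * α)) * decay β (z + α • v) =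
      decay β z * Real.exp (-((τ + β * ∑ i, v i) * α)) := by
  rw [decay_add, mul_left_comm, ← Real.exp_add]; congr 2; ring

lemma IsJump.exp_mul_decay_add_le (hv : IsJump β τ v) (hα : 0 ≤ α) (z : ι → ℝ) :
    Real.exp (-(τ * α)) * decay β (z + α • v) ≤ decay β z := by
  rw [IsJump.exp_mul_decay_add]
  refine mul_le_of_le_one_right (decay_pos _ _).le (Real.exp_le_one_iff.2 ?_)
  have := mul_nonneg hv.tilt hα
  linarith

lemma IsJump.exp_mul_decay_le (hv : IsJump β τ v) (hα : 0 ≤ α) (z : ι → ℝ) :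
    Real.exp (-(τ * α)) * decay β z ≤ decay β (z - α • v) := by
  have := hv.exp_mul_decay_add_le hα (z - α • v)
  rwa [sub_add_cancel] at this

lemma IsJump.abs_le_one (hv : IsJump β τ v) (i : ι) : |v i| ≤ 1 := by
  rcases hv.coord i with h | h | h <;> simp [h]

lemma le_sum_of_nonneg (hz : 0 ≤ z) (i : ι) : z i ≤ ∑ j, z j :=
  Finset.single_le_sum (f := z) (fun j _ => hz j) (Finset.mem_univ i)

lemma IsJump.le_sum (hv : IsJump β τ v) (hz : 0 ≤ z) (hp : 0 ≤ z + α • v) (hm : 0 ≤ z - α • v) :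
    α ≤ ∑ i, z i := by
  obtain ⟨i, hi⟩ := hv.ne_zero
  refine le_trans ?_ (le_sum_of_nonneg hz i)
  have h1 := hp i
  have h2 := hm i
  simp only [Pi.zero_apply, Pi.add_apply, Pi.sub_apply, Pi.smul_apply, smul_eq_mul] at h1 h2
  rcases hv.coord i with h | h | h
  · rw [h] at h1; linarith
  · exact absurd h hi
  · rw [h] at h2; linarith

/-- Large jumps are rare for one of two reasons: the bath supplies an exponential factor, or some
coordinate loses `α` and cannot lose more than it has. The sum on the right covers both cases. -/
lemma IsJump.exp_le_of_sub_nonneg (hv : IsJump β τ v) (hz : 0 ≤ z) (hα : 0 < α)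
    (hm : 0 ≤ z - α • v) :
    Real.exp (-(τ * α)) ≤ Real.exp (-(β * α)) + (Ioc 0 (∑ i, z i)).indicator 1 α := by
  have hi0 : 0 ≤ (Ioc 0 (∑ i, z i)).indicator (1 : ℝ → ℝ) α :=
    indicator_nonneg (fun _ _ => zero_le_one) _
  rcases hv.loss with h | ⟨i, h⟩
  · have : Real.exp (-(τ * α)) ≤ Real.exp (-(β * α)) :=
      Real.exp_le_exp.2 (by have := mul_le_mul_of_nonneg_right h hα.le; linarith)
    linarith
  · have h2 := hm i
    simp only [Pi.zero_apply, Pi.sub_apply, Pi.smul_apply, smul_eq_mul, h] at h2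
    rw [indicator_of_mem (show α ∈ Ioc 0 (∑ i, z i) from ⟨hα, by linarith [le_sum_of_nonneg hz i]⟩)]
    have := hv.exp_le_one hα.le
    have := Real.exp_pos (-(β * α))
    simp only [Pi.one_apply]; linarith

lemma IsJump.exp_le_of_add_nonneg (hv : IsJump β τ v) (hz : 0 ≤ z) (hα : 0 < α)
    (hp : 0 ≤ z + α • v) :
    Real.exp (-((τ + β * ∑ i, v i) * α)) ≤
      Real.exp (-(β * α)) + (Ioc 0 (∑ i, z i)).indicator 1 α := by
  have hi0 : 0 ≤ (Ioc 0 (∑ i, z i)).indicator (1 : ℝ → ℝ) α :=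
    indicator_nonneg (fun _ _ => zero_le_one) _
  rcases hv.gain with h | ⟨i, h⟩
  · have : Real.exp (-((τ + β * ∑ i, v i) * α)) ≤ Real.exp (-(β * α)) :=
      Real.exp_le_exp.2 (by have := mul_le_mul_of_nonneg_right h hα.le; linarith)
    linarith
  · have h2 := hp i
    simp only [Pi.zero_apply, Pi.add_apply, Pi.smul_apply, smul_eq_mul, h] at h2
    rw [indicator_of_mem (show α ∈ Ioc 0 (∑ i, z i) from ⟨hα, by linarith [le_sum_of_nonneg hz i]⟩)]
    have : Real.exp (-((τ + β * ∑ i, v i) * α)) ≤ 1 :=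
      Real.exp_le_one_iff.2 (by have := mul_nonneg hv.tilt hα.le; linarith)
    have := Real.exp_pos (-(β * α))
    simp only [Pi.one_apply]; linarith

lemma IsTame.const_nonneg (hμ : IsTame β C μ) : 0 ≤ C := by
  have := (abs_nonneg _).trans (hμ.abs_le 0 le_rfl)
  exact nonneg_of_mul_nonneg_left this (decay_pos _ _)

lemma IsJump.sum_abs_smul_le (hv : IsJump β τ v) (hα : 0 ≤ α) :
    ∑ i, |α * v i| ≤ α * Fintype.card ι := by
  calc ∑ i, |α * v i| ≤ ∑ _i : ι, α := Finset.sum_le_sum fun i _ => by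
        rw [abs_mul, abs_of_nonneg hα]
        exact mul_le_of_le_one_right hα (hv.abs_le_one i)
    _ = α * Fintype.card ι := by simp [mul_comm]

/-- When both configurations stay in the orthant, the Lipschitz bound gains a factor `α` against the
singularity `1 / α`, and `IsJump.tilt` keeps the weighted decay at `z + α v` below the decay at `z`.
-/
lemma IsTame.abs_balanceKernel_le_of_nonneg (hμ : IsTame β C μ) (hv : IsJump β τ v) (hz : 0 ≤ z)
    (hα : 0 < α) (hp : 0 ≤ z + α • v) (hm : 0 ≤ z - α • v) :
    |balanceKernel τ v μ z α| ≤ C * (2 * Fintype.card ι * decay β z) := by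
  have hC := hμ.const_nonneg
  have h1 := hμ.abs_sub_le _ _ hp hz
  have h2 : ∑ i, |(z + α • v) i - z i| ≤ α * Fintype.card ι := by
    simpa using hv.sum_abs_smul_le hα.le
  have hw := Real.exp_pos (-(τ * α))
  have h3 := hv.exp_mul_decay_add_le hα.le z
  have h4 : Real.exp (-(τ * α)) * decay β z ≤ decay β z :=
    mul_le_of_le_one_left (decay_pos _ _).le (hv.exp_le_one hα.le)
  rw [balanceKernel, if_pos hm, abs_mul, abs_of_pos (div_pos hw hα)]
  have hd : 0 ≤ decay β (z + α • v) + decay β z :=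
    add_nonneg (decay_pos _ _).le (decay_pos _ _).le
  calc Real.exp (-(τ * α)) / α * |μ (z + α • v) - μ z|
      ≤ Real.exp (-(τ * α)) / α *
          (C * (α * Fintype.card ι) * (decay β (z + α • v) + decay β z)) := by
        gcongr
        exact h1.trans (by gcongr)
    _ = C * Fintype.card ι * (Real.exp (-(τ * α)) * decay β (z + α • v) +
          Real.exp (-(τ * α)) * decay β z) := by
        field_simp
    _ ≤ C * Fintype.card ι * (decay β z + decay β z) := by gcongr
    _ = _ := by ring

/-- Dominating function for the part of the balance kernel in which one of the two jumps leaves the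
orthant, in terms of the configuration after the other jump. -/
noncomputable def edgeBound (β : ℝ) (q : ι → ℝ) (α : ℝ) : ℝ :=
  ∑ i, (Ici (0 : ι → ℝ)).indicator (fun q => decay β q * (2 / q i)) q *
    (Ioc 0 (q i)).indicator 1 α

lemma edgeBound_nonneg (β : ℝ) (q : ι → ℝ) (α : ℝ) : 0 ≤ edgeBound β q α := by
  refine Finset.sum_nonneg fun i _ => mul_nonneg ?_ (indicator_nonneg (fun _ _ => zero_le_one) _)
  exact indicator_nonneg (fun (q : ι → ℝ) (hq : 0 ≤ q) => mul_nonneg (decay_pos _ _).le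
    (div_nonneg zero_le_two (hq i))) _

lemma le_edgeBound {q : ι → ℝ} (hq : 0 ≤ q) (hα : 0 < α) (i : ι) (h1 : α ≤ q i)
    (h2 : q i ≤ 2 * α) : decay β q / α ≤ edgeBound β q α := by
  have hpos : ∀ j ∈ Finset.univ, 0 ≤ (Ici (0 : ι → ℝ)).indicator
      (fun q => decay β q * (2 / q j)) q * (Ioc 0 (q j)).indicator 1 α := by
    intro j _
    refine mul_nonneg ?_ (indicator_nonneg (fun _ _ => zero_le_one) _)
    exact indicator_nonneg (fun (q : ι → ℝ) (hq : 0 ≤ q) => mul_nonneg (decay_pos _ _).le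
      (div_nonneg zero_le_two (hq j))) _
  refine le_trans ?_ (Finset.single_le_sum hpos (Finset.mem_univ i))
  rw [indicator_of_mem (by exact hq),
    indicator_of_mem (show α ∈ Ioc 0 (q i) from ⟨hα, h1⟩), Pi.one_apply,
    mul_one, div_eq_mul_one_div]
  have hqi : 0 < q i := hα.trans_le h1
  refine mul_le_mul_of_nonneg_left ?_ (decay_pos _ _).le
  rw [div_le_div_iff₀ hα hqi]
  linarith

/-- A coordinate that becomes negative has `v i = 1` and `z i < α`, so the opposite jump brings it
to `z i + α`. -/
lemma IsJump.exists_edge (hv : IsJump β τ v) (hz : 0 ≤ z)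
    (hα : 0 < α) (hm : ¬ 0 ≤ z - α • v) :
    ∃ i, α ≤ (z + α • v) i ∧ (z + α • v) i ≤ 2 * α := by
  rw [Pi.le_def] at hm
  push Not at hm
  obtain ⟨i, hi⟩ := hm
  have hzi := hz i
  refine ⟨i, ?_⟩
  simp only [Pi.zero_apply, Pi.add_apply, Pi.sub_apply, Pi.smul_apply, smul_eq_mul] at *
  rcases hv.coord i with h | h | h <;> rw [h] at hi ⊢ <;> constructor <;> linarith

lemma IsJump.exists_edge' (hv : IsJump β τ v) (hz : 0 ≤ z)
    (hα : 0 < α) (hp : ¬ 0 ≤ z + α • v) :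
    ∃ i, α ≤ (z - α • v) i ∧ (z - α • v) i ≤ 2 * α := by
  rw [Pi.le_def] at hp
  push Not at hp
  obtain ⟨i, hi⟩ := hp
  have hzi := hz i
  refine ⟨i, ?_⟩
  simp only [Pi.zero_apply, Pi.add_apply, Pi.sub_apply, Pi.smul_apply, smul_eq_mul] at *
  rcases hv.coord i with h | h | h <;> rw [h] at hi ⊢ <;> constructor <;> linarith

/-- Near the faces of the orthant the difference in the kernel loses one of its terms, and `1 / α`
is no longer compensated. The surviving term is charged to a configuration with a coordinate
comparable to `α`. This form is integrable jointly in `z` and `α`, although it blows up pointwise as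
`z` approaches a face. -/
lemma IsTame.abs_balanceKernel_le (hμ : IsTame β C μ) (hv : IsJump β τ v) (hz : 0 ≤ z)
    (hα : 0 < α) :
    |balanceKernel τ v μ z α| ≤ C * (2 * Fintype.card ι *
      ((Ici (0 : ι → ℝ)).indicator (decay β) z * (Ioc 0 (∑ i, z i)).indicator 1 α) +
      edgeBound β (z + α • v) α + edgeBound β (z - α • v) α) := by
  have hC := hμ.const_nonneg
  have hw := Real.exp_pos (-(τ * α))
  have e1 := edgeBound_nonneg β (z + α • v) α
  have e2 := edgeBound_nonneg β (z - α • v) α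
  have e3 : 0 ≤ (Ici (0 : ι → ℝ)).indicator (decay β) z *
      (Ioc 0 (∑ i, z i)).indicator (1 : ℝ → ℝ) α :=
    mul_nonneg (indicator_nonneg (fun _ _ => (decay_pos _ _).le) _)
      (indicator_nonneg (fun _ _ => zero_le_one) _)
  by_cases hp : 0 ≤ z + α • v <;> by_cases hm : 0 ≤ z - α • v
  · refine (hμ.abs_balanceKernel_le_of_nonneg hv hz hα hp hm).trans ?_
    rw [indicator_of_mem (by exact hz),
      indicator_of_mem (show α ∈ Ioc 0 (∑ i, z i) from ⟨hα, hv.le_sum hz hp hm⟩),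
      Pi.one_apply, mul_one]
    gcongr
    linarith
  · obtain ⟨i, h1, h2⟩ := hv.exists_edge hz hα hm
    have h3 := le_edgeBound (β := β) hp hα i h1 h2
    rw [balanceKernel, if_neg hm, sub_zero, abs_mul, abs_of_pos (div_pos hw hα)]
    calc Real.exp (-(τ * α)) / α * |μ (z + α • v)|
        ≤ 1 / α * (C * decay β (z + α • v)) := by
          gcongr
          · exact hv.exp_le_one hα.le
          · exact hμ.abs_le _ hp
      _ = C * (decay β (z + α • v) / α) := by ring
      _ ≤ _ := by
          gcongr
          have : 0 ≤ 2 * (Fintype.card ι : ℝ) := by positivity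
          nlinarith [mul_nonneg this e3]
  -- Only the loss term `μ z` survives; its weighted decay at `z` is dominated by the decay at `z -
  -- α • v`, where the edge bound applies.
  · obtain ⟨i, h1, h2⟩ := hv.exists_edge' hz hα hp
    have h3 := le_edgeBound (β := β) hm hα i h1 h2
    rw [balanceKernel, if_pos hm, hμ.eq_zero _ hp, zero_sub, abs_mul, abs_neg,
      abs_of_pos (div_pos hw hα)]
    calc Real.exp (-(τ * α)) / α * |μ z|
        ≤ Real.exp (-(τ * α)) / α * (C * decay β z) := by
          gcongr
          exact hμ.abs_le _ hz
      _ = C * (Real.exp (-(τ * α)) * decay β z / α) := by ring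
      _ ≤ C * (decay β (z - α • v) / α) := by
          gcongr
          exact hv.exp_mul_decay_le hα.le z
      _ ≤ _ := by
          gcongr
          have : 0 ≤ 2 * (Fintype.card ι : ℝ) := by positivity
          nlinarith [mul_nonneg this e3]
  · rw [balanceKernel, if_neg hm, hμ.eq_zero _ hp, sub_zero, mul_zero, abs_zero]
    positivity

/-- Bound on the balance kernel at a configuration with coordinates at least `r > 0`. -/
noncomputable def balanceBound (β r : ℝ) (z : ι → ℝ) (α : ℝ) : ℝ :=
  decay β z * (2 * Fintype.card ι * (Ioc 0 (∑ i, z i)).indicator 1 α +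
    2 / r * (Real.exp (-(β * α)) + (Ioc 0 (∑ i, z i)).indicator 1 α))

lemma integrableOn_balanceBound (hβ : 0 < β) (r : ℝ) (z : ι → ℝ) :
    IntegrableOn (balanceBound β r z) (Ioi 0) := by
  have h1 : IntegrableOn ((Ioc 0 (∑ i, z i)).indicator (1 : ℝ → ℝ)) (Ioi 0) := by
    refine Integrable.integrableOn ?_
    rw [integrable_indicator_iff measurableSet_Ioc]
    exact integrableOn_const (by simp)
  have h2 : IntegrableOn (fun α => Real.exp (-(β * α))) (Ioi 0) := by
    simpa using integrableOn_exp_mul_Ioi (neg_lt_zero.2 hβ) 0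
  exact (((h1.const_mul _).add ((h2.add h1).const_mul _)).const_mul _)

/-- Away from the faces, jumps with `α ≤ r` stay in the orthant in both directions, and larger ones
satisfy `1 / α ≤ 1 / r`. The bound depends on `μ` only through `C`, so it also serves as a
dominating function uniform over the simplex of means. -/
lemma IsTame.abs_balanceKernel_le_balanceBound (hμ : IsTame β C μ) (hv : IsJump β τ v) {r : ℝ}
    (hr : 0 < r) (hz : ∀ i, r ≤ z i) (hα : 0 < α) :
    |balanceKernel τ v μ z α| ≤ C * balanceBound β r z α := by
  have hC := hμ.const_nonneg
  have hz0 : 0 ≤ z := fun i => hr.le.trans (hz i)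
  have hw := Real.exp_pos (-(τ * α))
  have hd := decay_pos β z
  have hi0 : 0 ≤ (Ioc 0 (∑ i, z i)).indicator (1 : ℝ → ℝ) α :=
    indicator_nonneg (fun _ _ => zero_le_one) _
  have he := Real.exp_pos (-(β * α))
  rcases le_or_gt α r with h | h
  · have hp : 0 ≤ z + α • v := by
      intro i
      have := hz i
      simp only [Pi.zero_apply, Pi.add_apply, Pi.smul_apply, smul_eq_mul]
      rcases hv.coord i with h | h | h <;> rw [h] <;> linarith
    have hm : 0 ≤ z - α • v := by
      intro i
      have := hz i
      simp only [Pi.zero_apply, Pi.sub_apply, Pi.smul_apply, smul_eq_mul]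
      rcases hv.coord i with h | h | h <;> rw [h] <;> linarith
    refine (hμ.abs_balanceKernel_le_of_nonneg hv hz0 hα hp hm).trans ?_
    rw [balanceBound, indicator_of_mem (show α ∈ Ioc 0 (∑ i, z i) from ⟨hα, hv.le_sum hz0 hp hm⟩),
      Pi.one_apply, mul_one, mul_comm (2 * (Fintype.card ι : ℝ))]
    gcongr
    have : 0 ≤ 2 / r * (Real.exp (-(β * α)) + 1) := by positivity
    linarith
  · have h1 : Real.exp (-(τ * α)) * |μ (z + α • v)| ≤
        C * decay β z * (Real.exp (-(β * α)) + (Ioc 0 (∑ i, z i)).indicator 1 α) := by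
      by_cases hp : 0 ≤ z + α • v
      · calc Real.exp (-(τ * α)) * |μ (z + α • v)|
            ≤ Real.exp (-(τ * α)) * (C * decay β (z + α • v)) := by
              gcongr; exact hμ.abs_le _ hp
          _ = C * (Real.exp (-(τ * α)) * decay β (z + α • v)) := by ring
          _ = C * decay β z * Real.exp (-((τ + β * ∑ i, v i) * α)) := by
              rw [IsJump.exp_mul_decay_add]; ring
          _ ≤ _ := by
              gcongr; exact hv.exp_le_of_add_nonneg hz0 hα hp
      · rw [hμ.eq_zero _ hp, abs_zero, mul_zero]; positivity
    have h2 : Real.exp (-(τ * α)) * |open Classical in if 0 ≤ z - α • v then μ z else 0| ≤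
        C * decay β z * (Real.exp (-(β * α)) + (Ioc 0 (∑ i, z i)).indicator 1 α) := by
      split_ifs with hm
      · rw [mul_comm]
        exact mul_le_mul (hμ.abs_le _ hz0) (hv.exp_le_of_sub_nonneg hz0 hα hm) hw.le (by positivity)
      · rw [abs_zero, mul_zero]; positivity
    rw [balanceKernel, abs_mul, abs_of_pos (div_pos hw hα)]
    have h3 := abs_sub (μ (z + α • v)) (open Classical in if 0 ≤ z - α • v then μ z else 0)
    calc _ ≤ Real.exp (-(τ * α)) / α * (|μ (z + α • v)| +
            |open Classical in if 0 ≤ z - α • v then μ z else 0|) := by gcongr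
      _ = 1 / α * (Real.exp (-(τ * α)) * |μ (z + α • v)| +
            Real.exp (-(τ * α)) * |open Classical in if 0 ≤ z - α • v then μ z else 0|) := by ring
      _ ≤ 1 / r * (C * decay β z * (Real.exp (-(β * α)) + (Ioc 0 (∑ i, z i)).indicator 1 α) +
            C * decay β z * (Real.exp (-(β * α)) + (Ioc 0 (∑ i, z i)).indicator 1 α)) := by
          gcongr
      _ = C * (decay β z * (2 / r * (Real.exp (-(β * α)) +
            (Ioc 0 (∑ i, z i)).indicator 1 α))) := by ring
      _ ≤ _ := by
          rw [balanceBound]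
          gcongr
          have : 0 ≤ 2 * Fintype.card ι * (Ioc 0 (∑ i, z i)).indicator (1 : ℝ → ℝ) α := by
            positivity
          linarith

end Bounds

section Measurability

variable {τ : ℝ} {v : ι → ℝ} {f μ : (ι → ℝ) → ℝ}

lemma measurable_jumpKernel (hf : Measurable f) :
    Measurable (fun p : (ι → ℝ) × ℝ => jumpKernel τ v f p.1 p.2) := by
  unfold jumpKernel
  refine Measurable.ite (measurableSet_le measurable_const (by fun_prop)) ?_ measurable_const
  exact Measurable.mul (by fun_prop) ((hf.comp (by fun_prop)).sub (hf.comp measurable_fst))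

lemma measurable_balanceKernel (hμ : Measurable μ) :
    Measurable (fun p : (ι → ℝ) × ℝ => balanceKernel τ v μ p.1 p.2) := by
  unfold balanceKernel
  refine Measurable.mul (by fun_prop) ((hμ.comp (by fun_prop)).sub ?_)
  exact Measurable.ite (measurableSet_le measurable_const (by fun_prop)) (hμ.comp measurable_fst)
    measurable_const

lemma IsTame.integrableOn_balanceKernel {β C : ℝ} {z : ι → ℝ} (hμ : IsTame β C μ)
    (hv : IsJump β τ v) (hβ : 0 < β) (hz : ∀ i, 0 < z i) :
    IntegrableOn (balanceKernel τ v μ z) (Ioi 0) := by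
  obtain ⟨i, -⟩ := hv.ne_zero
  have : Nonempty ι := ⟨i⟩
  obtain ⟨j, hj⟩ := Finite.exists_min z
  refine ((integrableOn_balanceBound hβ (z j) z).const_mul C).mono'
    ((measurable_balanceKernel hμ.measurable).comp measurable_prodMk_left).aestronglyMeasurable ?_
  filter_upwards [self_mem_ae_restrict measurableSet_Ioi] with α hα
  exact hμ.abs_balanceKernel_le_balanceBound hv (hz j) hj hα

end Measurability

end Jumps

/-! ### Joint integrability in configuration and jump size, and adjointness. -/

lemma integrable_mul_indicator_Ioc {E : Type*} [MeasurableSpace E] {ρ : Measure E} [SFinite ρ]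
    {g s : E → ℝ} (hg : Measurable g) (hs : Measurable s)
    (h : Integrable (fun z => g z * max (s z) 0) ρ) :
    Integrable (fun p : E × ℝ => g p.1 * (Ioc 0 (s p.1)).indicator 1 p.2)
      (ρ.prod (volume.restrict (Ioi 0))) := by
  have hset : MeasurableSet {p : E × ℝ | p.2 ∈ Ioc 0 (s p.1)} :=
    (measurableSet_lt measurable_const measurable_snd).inter
      (measurableSet_le measurable_snd (hs.comp measurable_fst))
  have hm : Measurable (fun p : E × ℝ => g p.1 * (Ioc 0 (s p.1)).indicator 1 p.2) :=
    (hg.comp measurable_fst).mul (measurable_const.indicator hset)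
  have hi : ∀ x, Integrable ((Ioc 0 (s x)).indicator (1 : ℝ → ℝ)) (volume.restrict (Ioi 0)) := by
    intro x
    refine Integrable.integrableOn ?_
    rw [integrable_indicator_iff measurableSet_Ioc]
    exact integrableOn_const (by simp)
  rw [integrable_prod_iff hm.aestronglyMeasurable]
  refine ⟨.of_forall fun x => (hi x).const_mul (g x), ?_⟩
  -- Integrating the indicator in `α` leaves the length `max (s x) 0` of the interval.
  convert h.norm using 2 with x
  simp_rw [norm_mul]
  rw [integral_const_mul]
  congr 1
  have : ∀ α, ‖(Ioc 0 (s x)).indicator (1 : ℝ → ℝ) α‖ = (Ioc 0 (s x)).indicator 1 α := fun α =>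
    Real.norm_of_nonneg (indicator_nonneg (fun _ _ => zero_le_one) _)
  simp_rw [this]
  rw [integral_indicator measurableSet_Ioc, Measure.restrict_restrict measurableSet_Ioc,
    inter_eq_left.2 (Ioc_subset_Ioi_self)]
  simp only [Pi.one_apply, integral_const, smul_eq_mul, mul_one]
  rw [Measure.real, Measure.restrict_apply_univ, Real.volume_Ioc, sub_zero, ENNReal.toReal_ofReal',
    Real.norm_of_nonneg (le_max_right _ _)]

lemma ae_snd_pos {E : Type*} [MeasurableSpace E] {ρ : Measure E} [SFinite ρ] :
    ∀ᵐ p ∂ρ.prod (volume.restrict (Ioi (0 : ℝ))), 0 < p.2 := by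
  have h0 : ∀ᵐ α ∂volume.restrict (Ioi (0 : ℝ)), 0 < α := self_mem_ae_restrict measurableSet_Ioi
  exact Measure.quasiMeasurePreserving_snd.ae h0

section Jumps

variable {ι : Type*} [Fintype ι]

/-- For each fixed `α` the shift is a translation, so the shear preserves the norms of the slices.
It transports the edge bounds from the shifted configurations back to `z`. -/
lemma integrable_prod_shift {ν : Measure ℝ} [SFinite ν] {Q : (ι → ℝ) × ℝ → ℝ} (hQ : Measurable Q)
    (h : Integrable Q (volume.prod ν)) (v : ι → ℝ) (c : ℝ) :
    Integrable (fun p : (ι → ℝ) × ℝ => Q (p.1 + (c * p.2) • v, p.2)) (volume.prod ν) := by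
  have hm : Measurable fun p : (ι → ℝ) × ℝ => Q (p.1 + (c * p.2) • v, p.2) :=
    hQ.comp (by fun_prop)
  rw [integrable_prod_iff' hm.aestronglyMeasurable]
  rw [integrable_prod_iff' hQ.aestronglyMeasurable] at h
  refine ⟨h.1.mono fun α hα => hα.comp_add_right ((c * α) • v), ?_⟩
  convert h.2 using 2 with α
  exact integral_add_right_eq_self (fun z => ‖Q (z, α)‖) ((c * α) • v)

lemma indicator_decay_eq (β : ℝ) (z : ι → ℝ) :
    (Ici (0 : ι → ℝ)).indicator (decay β) z =
      ∏ i, (Ici (0 : ℝ)).indicator (fun t => Real.exp (-(β * t))) (z i) := by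
  by_cases h : 0 ≤ z
  · rw [indicator_of_mem (by exact h), decay, Finset.mul_sum, ← Finset.sum_neg_distrib,
      Real.exp_sum]
    exact Finset.prod_congr rfl fun i _ =>
      (indicator_of_mem (show z i ∈ Ici 0 from h i) (fun t => Real.exp (-(β * t)))).symm
  · rw [indicator_of_notMem (by exact h)]
    rw [Pi.le_def] at h
    push Not at h
    obtain ⟨i, hi⟩ := h
    exact (Finset.prod_eq_zero (Finset.mem_univ i)
      (indicator_of_notMem (show z i ∉ Ici 0 from not_le.2 hi) _)).symm

lemma integrable_decay {β : ℝ} (hβ : 0 < β) :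
    Integrable ((Ici (0 : ι → ℝ)).indicator (decay β)) := by
  simp_rw [funext (indicator_decay_eq (ι := ι) β)]
  refine Integrable.fintype_prod fun i => ?_
  rw [integrable_indicator_iff measurableSet_Ici, integrableOn_Ici_iff_integrableOn_Ioi]
  simpa using integrableOn_exp_mul_Ioi (neg_lt_zero.2 hβ) 0

lemma measurable_indicator_decay (β : ℝ) :
    Measurable ((Ici (0 : ι → ℝ)).indicator (decay β)) :=
  (measurable_decay β).indicator measurableSet_Ici

lemma sum_mul_decay_le {β : ℝ} (hβ : 0 < β) (z : ι → ℝ) :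
    (∑ i, z i) * decay β z ≤ 2 / β * decay (β / 2) z := by
  have h1 : decay β z = decay (β / 2) z * decay (β / 2) z := by
    rw [decay, decay, ← Real.exp_add]; congr 1; ring
  have h2 : β / 2 * (∑ i, z i) * decay (β / 2) z ≤ 1 := by
    rw [decay, Real.exp_neg, ← div_eq_mul_inv, div_le_one (Real.exp_pos _)]
    linarith [Real.add_one_le_exp (β / 2 * ∑ i, z i)]
  rw [h1]
  have h3 := decay_pos (β / 2) z
  calc (∑ i, z i) * (decay (β / 2) z * decay (β / 2) z)
      = 2 / β * (β / 2 * (∑ i, z i) * decay (β / 2) z) * decay (β / 2) z := by field_simp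
    _ ≤ 2 / β * 1 * decay (β / 2) z := by gcongr
    _ = _ := by ring

lemma integrable_decay_mul_sum {β : ℝ} (hβ : 0 < β) :
    Integrable (fun z : ι → ℝ => (Ici (0 : ι → ℝ)).indicator (decay β) z * max (∑ i, z i) 0) := by
  refine ((integrable_decay (ι := ι) (half_pos hβ)).const_mul (2 / β)).mono'
    ((measurable_indicator_decay β).mul (by fun_prop)).aestronglyMeasurable (.of_forall fun z => ?_)
  by_cases h : 0 ≤ z
  · have hs : 0 ≤ ∑ i, z i := Finset.sum_nonneg fun i _ => h i
    rw [indicator_of_mem (by exact h), indicator_of_mem (by exact h), max_eq_left hs,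
      Real.norm_of_nonneg (mul_nonneg (decay_pos _ _).le hs), mul_comm]
    exact sum_mul_decay_le hβ z
  · rw [indicator_of_notMem (by exact h), indicator_of_notMem (by exact h)]
    simp

lemma measurable_edgeBound (β : ℝ) :
    Measurable (fun p : (ι → ℝ) × ℝ => edgeBound β p.1 p.2) := by
  unfold edgeBound
  refine Finset.measurable_sum _ fun i _ => Measurable.mul ?_ ?_
  · refine Measurable.comp (g := (Ici (0 : ι → ℝ)).indicator (fun q => decay β q * (2 / q i)))
      ?_ measurable_fst
    exact ((measurable_decay β).mul (by fun_prop)).indicator measurableSet_Ici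
  · have hset : MeasurableSet {p : (ι → ℝ) × ℝ | p.2 ∈ Ioc 0 (p.1 i)} :=
      (measurableSet_lt measurable_const measurable_snd).inter
        (measurableSet_le measurable_snd (by fun_prop))
    exact measurable_const.indicator hset

/-- The factor `2 / q i` is exactly compensated by the length `q i` of the range of `α`, which
leaves `2 * decay β q`. -/
lemma integrable_edgeBound {β : ℝ} (hβ : 0 < β) :
    Integrable (fun p : (ι → ℝ) × ℝ => edgeBound β p.1 p.2)
      (volume.prod (volume.restrict (Ioi 0))) := by
  unfold edgeBound
  refine integrable_finsetSum _ fun i _ => ?_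
  have hm : Measurable ((Ici (0 : ι → ℝ)).indicator (fun q => decay β q * (2 / q i))) :=
    ((measurable_decay β).mul (by fun_prop)).indicator measurableSet_Ici
  refine integrable_mul_indicator_Ioc (s := fun q : ι → ℝ => q i) hm (by fun_prop) ?_
  refine ((integrable_decay (ι := ι) hβ).const_mul 2).mono'
    (hm.mul (by fun_prop)).aestronglyMeasurable (.of_forall fun z => ?_)
  by_cases h : 0 ≤ z
  · have hd := decay_pos β z
    have hi : 0 ≤ z i := h i
    rw [indicator_of_mem (by exact h), indicator_of_mem (by exact h), max_eq_left hi]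
    rcases hi.eq_or_lt with h0 | h0
    · rw [← h0]; simp; positivity
    · rw [Real.norm_of_nonneg (by positivity)]
      apply le_of_eq; field_simp
  · rw [indicator_of_notMem (by exact h), indicator_of_notMem (by exact h)]
    simp

lemma integrable_decay_mul_indicator {β : ℝ} (hβ : 0 < β) :
    Integrable (fun p : (ι → ℝ) × ℝ => (Ici (0 : ι → ℝ)).indicator (decay β) p.1 *
      (Ioc 0 (∑ i, p.1 i)).indicator 1 p.2) (volume.prod (volume.restrict (Ioi 0))) :=
  integrable_mul_indicator_Ioc (s := fun z : ι → ℝ => ∑ i, z i) (measurable_indicator_decay β)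
    (by fun_prop) (integrable_decay_mul_sum hβ)

variable {β τ C M K : ℝ} {v : ι → ℝ} {μ F : (ι → ℝ) → ℝ}

lemma IsTame.norm_le_indicator (hμ : IsTame β C μ) (z : ι → ℝ) :
    ‖μ z‖ ≤ C * (Ici (0 : ι → ℝ)).indicator (decay β) z := by
  by_cases h : 0 ≤ z
  · rw [indicator_of_mem (by exact h)]; exact hμ.abs_le z h
  · rw [indicator_of_notMem (by exact h), hμ.eq_zero z h]; simp

lemma IsTame.integrable (hμ : IsTame β C μ) (hβ : 0 < β) : Integrable μ :=
  ((integrable_decay hβ).const_mul C).mono' hμ.measurable.aestronglyMeasurable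
    (.of_forall hμ.norm_le_indicator)

lemma IsTame.integrable_mul_balanceKernel (hμ : IsTame β C μ) (hβ : 0 < β) (hv : IsJump β τ v)
    (hF : Measurable F) (hF0 : ∀ z, ¬ 0 ≤ z → F z = 0) (hFM : ∀ z, |F z| ≤ M) :
    Integrable (fun p : (ι → ℝ) × ℝ => F p.1 * balanceKernel τ v μ p.1 p.2)
      (volume.prod (volume.restrict (Ioi 0))) := by
  have hC := hμ.const_nonneg
  have h1 := integrable_decay_mul_indicator (ι := ι) hβ
  have h2 := integrable_prod_shift (measurable_edgeBound (ι := ι) β) (integrable_edgeBound hβ) v 1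
  have h3 := integrable_prod_shift (measurable_edgeBound (ι := ι) β) (integrable_edgeBound hβ) v
    (-1)
  refine (((((h1.const_mul (2 * Fintype.card ι)).add h2).add h3).const_mul C).const_mul M).mono'
    ((hF.comp measurable_fst).mul (measurable_balanceKernel hμ.measurable)).aestronglyMeasurable ?_
  filter_upwards [ae_snd_pos] with p hp
  have hM : 0 ≤ M := (abs_nonneg _).trans (hFM 0)
  by_cases hz : 0 ≤ p.1
  · rw [norm_mul]
    refine mul_le_mul (hFM _) ?_ (norm_nonneg _) hM
    have := hμ.abs_balanceKernel_le hv hz hp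
    simpa [← sub_eq_add_neg] using this
  · rw [hF0 _ hz, zero_mul, norm_zero]
    have e1 := edgeBound_nonneg β (p.1 + (1 * p.2) • v) p.2
    have e2 := edgeBound_nonneg β (p.1 + (-1 * p.2) • v) p.2
    have e3 : 0 ≤ (Ici (0 : ι → ℝ)).indicator (decay β) p.1 *
        (Ioc 0 (∑ i, p.1 i)).indicator (1 : ℝ → ℝ) p.2 :=
      mul_nonneg (indicator_nonneg (fun _ _ => (decay_pos _ _).le) _)
        (indicator_nonneg (fun _ _ => zero_le_one) _)
    simp only [Pi.add_apply]
    positivity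

/-- The Lipschitz hypothesis is required only between `z` and its target, so the lemma serves both
globally Lipschitz functions and functions that are Lipschitz at one point. -/
lemma IsJump.abs_jumpKernel_le (hv : IsJump β τ v) {z : ι → ℝ} {α : ℝ} (hz : 0 ≤ z) (hα : 0 < α)
    (hK : 0 ≤ K)
    (hF : 0 ≤ z - α • v → |F (z - α • v) - F z| ≤ K * ∑ i, |(z - α • v) i - z i|) :
    |jumpKernel τ v F z α| ≤
      K * Fintype.card ι * (Real.exp (-(β * α)) + (Ioc 0 (∑ i, z i)).indicator 1 α) := by
  have hi0 : 0 ≤ (Ioc 0 (∑ i, z i)).indicator (1 : ℝ → ℝ) α :=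
    indicator_nonneg (fun _ _ => zero_le_one) _
  rw [jumpKernel]
  split_ifs with hm
  · have hw := Real.exp_pos (-(τ * α))
    have h2 : ∑ i, |(z - α • v) i - z i| ≤ α * Fintype.card ι := by
      simpa using hv.sum_abs_smul_le hα.le
    rw [abs_mul, abs_of_pos (div_pos hw hα)]
    calc _ ≤ Real.exp (-(τ * α)) / α * (K * (α * Fintype.card ι)) := by
          gcongr; exact (hF hm).trans (by gcongr)
      _ = K * Fintype.card ι * Real.exp (-(τ * α)) := by field_simp
      _ ≤ _ := by gcongr; exact hv.exp_le_of_sub_nonneg hz hα hm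
  · rw [abs_zero]; positivity

lemma IsTame.integrable_mul_jumpKernel (hμ : IsTame β C μ) (hβ : 0 < β) (hv : IsJump β τ v)
    (hF : Measurable F) (hK : 0 ≤ K)
    (hFK : ∀ z z', 0 ≤ z → 0 ≤ z' → |F z - F z'| ≤ K * ∑ i, |z i - z' i|) :
    Integrable (fun p : (ι → ℝ) × ℝ => μ p.1 * jumpKernel τ v F p.1 p.2)
      (volume.prod (volume.restrict (Ioi 0))) := by
  have hC := hμ.const_nonneg
  have h1 := integrable_decay_mul_indicator (ι := ι) hβ
  have h0 : IntegrableOn (fun α => Real.exp (-(β * α))) (Ioi 0) := by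
    simpa using integrableOn_exp_mul_Ioi (neg_lt_zero.2 hβ) 0
  have h2 := (integrable_decay (ι := ι) hβ).mul_prod h0
  refine ((h2.add h1).const_mul (C * (K * Fintype.card ι))).mono'
    ((hμ.measurable.comp measurable_fst).mul (measurable_jumpKernel hF)).aestronglyMeasurable ?_
  filter_upwards [ae_snd_pos] with p hp
  by_cases hz : 0 ≤ p.1
  · have h3 := hμ.abs_le _ hz
    have h4 := hv.abs_jumpKernel_le hz hp hK fun h => hFK _ _ h hz
    rw [norm_mul]
    calc _ ≤ C * decay β p.1 * (K * Fintype.card ι *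
          (Real.exp (-(β * p.2)) + (Ioc 0 (∑ i, p.1 i)).indicator 1 p.2)) := by
          refine mul_le_mul h3 h4 (norm_nonneg _) (mul_nonneg hC (decay_pos _ _).le)
      _ = _ := by
          simp only [Pi.add_apply]
          rw [indicator_of_mem (show p.1 ∈ Ici 0 from hz)]
          ring
  · rw [hμ.eq_zero _ hz, zero_mul, norm_zero]
    simp only [Pi.add_apply]
    rw [indicator_of_notMem (show p.1 ∉ Ici 0 from hz)]
    simp

/-- At fixed `α` the loss terms of the two kernels coincide, because both carry the restriction `0 ≤
z - α • v`. The gain terms differ by the translation `z ↦ z + α • v`, under which Lebesgue measure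
is invariant. -/
lemma integral_mul_jumpKernel (hμ : Integrable μ) (hF : Measurable F)
    (hF0 : ∀ z, ¬ 0 ≤ z → F z = 0) (hFM : ∀ z, |F z| ≤ M) (α : ℝ)
    (h1 : Integrable fun z => μ z * jumpKernel τ v F z α)
    (h2 : Integrable fun z => F z * balanceKernel τ v μ z α) :
    ∫ z, μ z * jumpKernel τ v F z α = ∫ z, F z * balanceKernel τ v μ z α := by
  have hP : Integrable fun z => μ z * F (z - α • v) :=
    hμ.mul_bdd (c := M) (hF.comp (by fun_prop)).aestronglyMeasurable (.of_forall fun z => hFM _)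
  rw [← sub_eq_zero, ← integral_sub h1 h2]
  have key : ∀ z, μ z * jumpKernel τ v F z α - F z * balanceKernel τ v μ z α =
      Real.exp (-(τ * α)) / α *
        (μ z * F (z - α • v) - μ (z + α • v) * F (z + α • v - α • v)) := by
    intro z
    rw [jumpKernel, balanceKernel, add_sub_cancel_right]
    split_ifs with h
    · ring
    · rw [hF0 _ h]; ring
  simp_rw [key]
  rw [integral_const_mul, integral_sub hP (hP.comp_add_right (α • v)),
    integral_add_right_eq_self (fun z => μ z * F (z - α • v)), sub_self, mul_zero]

/-- The balance operator is adjoint to the generator of the jump. -/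
theorem IsTame.integral_mul_integral_jumpKernel (hμ : IsTame β C μ) (hβ : 0 < β)
    (hv : IsJump β τ v) (hF : Measurable F) (hF0 : ∀ z, ¬ 0 ≤ z → F z = 0) (hFM : ∀ z, |F z| ≤ M)
    (hK : 0 ≤ K) (hFK : ∀ z z', 0 ≤ z → 0 ≤ z' → |F z - F z'| ≤ K * ∑ i, |z i - z' i|) :
    Integrable (fun z => μ z * ∫ α in Ioi 0, jumpKernel τ v F z α) ∧
    Integrable (fun z => F z * ∫ α in Ioi 0, balanceKernel τ v μ z α) ∧
    ∫ z, μ z * ∫ α in Ioi 0, jumpKernel τ v F z α =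
      ∫ z, F z * ∫ α in Ioi 0, balanceKernel τ v μ z α := by
  have h1 := hμ.integrable_mul_jumpKernel hβ hv hF hK hFK
  have h2 := hμ.integrable_mul_balanceKernel hβ hv hF hF0 hFM
  simp_rw [← integral_const_mul]
  refine ⟨h1.integral_prod_left, h2.integral_prod_left, ?_⟩
  refine (integral_integral_swap h1).trans (Eq.trans ?_ (integral_integral_swap h2).symm)
  refine integral_congr_ae ?_
  filter_upwards [h1.prod_left_ae, h2.prod_left_ae] with α ha hb
  exact integral_mul_jumpKernel (hμ.integrable hβ) hF hF0 hFM α ha hb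

end Jumps

/-! ### Exponential integrals and Frullani integrals. -/

section Calculus

/-- The continuous extension of `(exp (-t) - 1) / t`. -/
noncomputable def expSlope : ℝ → ℝ := dslope (fun t => Real.exp (-t)) 0

/-- The entire exponential integral `∫_0^t (exp (-s) - 1) / s ds`. -/
noncomputable def expSlopeIntegral (t : ℝ) : ℝ := ∫ s in (0 : ℝ)..t, expSlope s

lemma continuous_expSlope : Continuous expSlope := by
  rw [continuous_iff_continuousAt]
  intro t
  rcases eq_or_ne t 0 with rfl | h
  · exact continuousAt_dslope_same.2 (by fun_prop)
  · exact (continuousAt_dslope_of_ne h).2 (by fun_prop)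

lemma expSlope_of_ne {t : ℝ} (ht : t ≠ 0) : expSlope t = (Real.exp (-t) - 1) / t := by
  rw [expSlope, dslope_of_ne _ ht, slope_def_field]; simp

lemma mul_expSlope_mul (c : ℝ) {α : ℝ} (hα : α ≠ 0) :
    c * expSlope (c * α) = (Real.exp (-(c * α)) - 1) / α := by
  rcases eq_or_ne c 0 with rfl | hc
  · simp
  · rw [expSlope_of_ne (mul_ne_zero hc hα)]; field_simp

lemma hasDerivAt_expSlopeIntegral (t : ℝ) : HasDerivAt expSlopeIntegral (expSlope t) t :=
  intervalIntegral.integral_hasDerivAt_right (continuous_expSlope.intervalIntegrable _ _)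
    (continuous_expSlope.stronglyMeasurableAtFilter _ _) continuous_expSlope.continuousAt

@[simp] lemma expSlopeIntegral_zero : expSlopeIntegral 0 = 0 := by simp [expSlopeIntegral]

lemma integrableOn_exp_sub_one_div (c z : ℝ) :
    IntegrableOn (fun α => (Real.exp (-(c * α)) - 1) / α) (Ioc 0 z) := by
  have h : IntegrableOn (fun α => c * expSlope (c * α)) (Ioc 0 z) := by
    refine (Continuous.integrableOn_Icc (a := 0) (b := z) ?_).mono_set Ioc_subset_Icc_self
    exact continuous_const.mul (continuous_expSlope.comp (by fun_prop))
  exact h.congr_fun (fun α hα => mul_expSlope_mul c hα.1.ne') measurableSet_Ioc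

lemma integral_exp_sub_one_div (c : ℝ) {z : ℝ} (hz : 0 ≤ z) :
    ∫ α in Ioc 0 z, (Real.exp (-(c * α)) - 1) / α = expSlopeIntegral (c * z) := by
  rw [← setIntegral_congr_fun measurableSet_Ioc
    (fun α hα => mul_expSlope_mul c (ne_of_gt (mem_Ioc.1 hα).1)),
    ← intervalIntegral.integral_of_le hz, intervalIntegral.integral_const_mul,
    intervalIntegral.mul_integral_comp_mul_left, mul_zero, expSlopeIntegral]

-- Only the values of `α` between `a` and `b` contribute, with integrand `± 1 / α`. This is the
-- source of the logarithms of the energies in a transfer.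
open Classical in
lemma integral_indicator_sub_indicator_div {a b : ℝ} (ha : 0 < a) (hb : 0 < b) :
    IntegrableOn (fun α : ℝ => ((if α ≤ a then 1 else 0) - (if α ≤ b then 1 else 0)) / α) (Ioi 0) ∧
    ∫ α in Ioi (0 : ℝ), ((if α ≤ a then 1 else 0) - (if α ≤ b then 1 else 0)) / α =
      Real.log a - Real.log b := by
  wlog hab : b ≤ a generalizing a b
  · obtain ⟨h1, h2⟩ := this hb ha (le_of_not_ge hab)
    have : (fun α : ℝ => ((if α ≤ a then (1 : ℝ) else 0) - (if α ≤ b then 1 else 0)) / α) =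
        fun α => -(((if α ≤ b then 1 else 0) - (if α ≤ a then 1 else 0)) / α) := by
      funext α; ring
    rw [this]
    exact ⟨h1.neg, by rw [integral_neg, h2]; ring⟩
  have key : (fun α : ℝ => ((if α ≤ a then (1 : ℝ) else 0) - (if α ≤ b then 1 else 0)) / α) =
      (Ioc b a).indicator (fun α => α⁻¹) := by
    funext α
    simp only [indicator_apply, mem_Ioc]
    rcases le_or_gt α b with h2 | h2
    · simp [h2, h2.trans hab, h2.not_gt]
    · rcases le_or_gt α a with h1 | h1
      · simp [h1, h2, h2.not_ge]
      · simp [h1.not_ge, h2.not_ge]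
  have hi : IntegrableOn (fun α : ℝ => α⁻¹) (Ioc b a) := by
    refine (ContinuousOn.integrableOn_Icc ?_).mono_set Ioc_subset_Icc_self
    exact continuousOn_inv₀.mono fun x hx => (hb.trans_le hx.1).ne'
  have hsub : Ioc b a ⊆ Ioi 0 := fun x hx => hb.trans hx.1
  rw [key]
  refine ⟨(hi.integrable_indicator measurableSet_Ioc).integrableOn, ?_⟩
  rw [setIntegral_indicator measurableSet_Ioc, inter_eq_right.2 hsub,
    ← intervalIntegral.integral_of_le hab, integral_inv_of_pos hb ha,
    Real.log_div ha.ne' hb.ne']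

lemma integrableOn_exp_neg_mul_div {t a : ℝ} (ht : 0 < t) (ha : 0 < a) :
    IntegrableOn (fun α => Real.exp (-(t * α)) / α) (Ioi a) := by
  have h : IntegrableOn (fun α => Real.exp (-t * α)) (Ioi a) :=
    integrableOn_exp_mul_Ioi (neg_lt_zero.2 ht) a
  refine (h.const_mul a⁻¹).mono' ?_ ?_
  · exact Measurable.aestronglyMeasurable (by fun_prop)
  · filter_upwards [self_mem_ae_restrict measurableSet_Ioi] with α hα
    have hα' : a < α := hα
    rw [Real.norm_of_nonneg (div_nonneg (Real.exp_pos _).le (ha.trans hα').le), neg_mul,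
      div_eq_inv_mul]
    gcongr

/-- Frullani's integral for the exponential function. -/
lemma integral_exp_sub_exp_div {a b : ℝ} (ha : 0 < a) (hb : 0 < b) :
    IntegrableOn (fun α => (Real.exp (-(a * α)) - Real.exp (-(b * α))) / α) (Ioi 0) ∧
    ∫ α in Ioi (0 : ℝ), (Real.exp (-(a * α)) - Real.exp (-(b * α))) / α =
      Real.log b - Real.log a := by
  have h1 : IntegrableOn (fun α => (Real.exp (-(a * α)) - Real.exp (-(b * α))) / α) (Ioi 0) := by
    rw [← Ioc_union_Ioi_eq_Ioi zero_le_one]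
    refine IntegrableOn.union ?_ ?_
    · refine ((integrableOn_exp_sub_one_div a 1).sub (integrableOn_exp_sub_one_div b 1)).congr_fun
        (fun α _ => ?_) measurableSet_Ioc
      simp only [Pi.sub_apply]; ring
    · refine ((integrableOn_exp_neg_mul_div ha one_pos).sub
        (integrableOn_exp_neg_mul_div hb one_pos)).congr_fun (fun α _ => ?_) measurableSet_Ioi
      simp only [Pi.sub_apply]; ring
  refine ⟨h1, ?_⟩
  have hc : Continuous fun x : ℝ => Real.exp (-x) := by fun_prop
  have hd : ∀ α, (Real.exp (-(a * α)) - Real.exp (-(b * α))) / α =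
      α⁻¹ • (Real.exp (-(a * α)) - Real.exp (-(b * α))) := fun α => by
    rw [smul_eq_mul, div_eq_inv_mul]
  have := Frullani.integral_Ioi_eq (f := fun x : ℝ => Real.exp (-x)) (L := 1) (R := 0)
    (hc.locallyIntegrable.locallyIntegrableOn _) ha hb
    (by simpa using (hc.tendsto 0).mono_left nhdsWithin_le_nhds)
    (Real.tendsto_exp_neg_atTop_nhds_zero)
    (by simpa only [hd] using h1)
  simp_rw [hd]
  rw [this, sub_zero, smul_eq_mul, mul_one, Real.log_div hb.ne' ha.ne']

/-- The function whose difference quotients in `t` are integrated in the exchange terms. -/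
lemma integral_slope_exp {m T z : ℝ} (hm : 0 < m) (hT : 0 < T) :
    IntervalIntegrable (fun t => (1 / t * Real.exp (-z / t) - 1 / m * Real.exp (-z / m)) / (t - m))
      volume m T ∧
    ∫ t in m..T, (1 / t * Real.exp (-z / t) - 1 / m * Real.exp (-z / m)) / (t - m) =
      1 / m * Real.exp (-z / m) *
        (expSlopeIntegral ((1 / T - 1 / m) * z) + Real.log m - Real.log T) := by
  set e := 1 / m * Real.exp (-z / m) with he
  -- `D` is the derivative in the upper limit of the claimed value and extends the difference
  -- quotient continuously across `t = m`. There the written quotient has the default value `0`, so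
  -- the two are identified only almost everywhere.
  set D : ℝ → ℝ := fun t => e * (expSlope ((1 / t - 1 / m) * z) * (-1 / t ^ 2 * z) - 1 / t) with hD
  have hpos : ∀ t ∈ uIcc m T, 0 < t := fun t ht => (lt_min hm hT).trans_le ht.1
  have hderiv : ∀ t ∈ uIcc m T, HasDerivAt
      (fun t => e * (expSlopeIntegral ((1 / t - 1 / m) * z) + Real.log m - Real.log t))
      (D t) t := by
    intro t ht
    have ht0 := (hpos t ht).ne'
    have h1 : HasDerivAt (fun t : ℝ => (1 / t - 1 / m) * z) (-1 / t ^ 2 * z) t := by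
      have := ((hasDerivAt_inv ht0).sub_const (1 / m)).mul_const z
      simpa [neg_div] using this
    have h2 := (hasDerivAt_expSlopeIntegral ((1 / t - 1 / m) * z)).comp t h1
    have h3 := ((h2.add_const (Real.log m)).sub (Real.hasDerivAt_log ht0)).const_mul e
    simpa [hD] using h3
  have hcont : ContinuousOn D (uIcc m T) := by
    intro t ht
    have ht0 := (hpos t ht).ne'
    have h1 : ContinuousAt (fun t : ℝ => (1 / t - 1 / m) * z) t :=
      ((continuousAt_const.div continuousAt_id ht0).sub continuousAt_const).mul continuousAt_const
    have h2 : ContinuousAt (fun t => expSlope ((1 / t - 1 / m) * z)) t :=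
      ContinuousAt.comp (g := expSlope) continuous_expSlope.continuousAt h1
    have h3 : ContinuousAt (fun t : ℝ => -1 / t ^ 2 * z) t :=
      (continuousAt_const.div (continuousAt_id.pow 2) (pow_ne_zero 2 ht0)).mul continuousAt_const
    exact (continuousAt_const.mul
      ((h2.mul h3).sub (continuousAt_const.div continuousAt_id ht0))).continuousWithinAt
  have hcongr : ∀ t ∈ uIcc m T, t ≠ m →
      D t = (1 / t * Real.exp (-z / t) - e) / (t - m) := by
    intro t ht htm
    have ht0 := (hpos t ht).ne'
    have hm0 := hm.ne'
    have hs : t - m ≠ 0 := sub_ne_zero.2 htm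
    have hx : expSlope ((1 / t - 1 / m) * z) * (-1 / t ^ 2 * z) =
        (Real.exp (-((1 / t - 1 / m) * z)) - 1) * (m / (t * (t - m))) := by
      rcases eq_or_ne z 0 with rfl | hz
      · simp
      · rw [expSlope_of_ne (mul_ne_zero ?_ hz)]
        · have : 1 / t - 1 / m = -(t - m) / (t * m) := by field_simp; ring
          rw [this]; field_simp
        · have : 1 / t - 1 / m = -(t - m) / (t * m) := by field_simp; ring
          rw [this]
          exact div_ne_zero (neg_ne_zero.2 hs) (mul_ne_zero ht0 hm0)
    have hE : Real.exp (-z / t) = Real.exp (-z / m) * Real.exp (-((1 / t - 1 / m) * z)) := by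
      rw [← Real.exp_add]; congr 1; field_simp; ring
    simp only [hD]
    rw [hx, hE, he]
    field_simp
    ring
  have hae : ∀ᵐ t ∂volume, t ∈ uIoc m T →
      D t = (1 / t * Real.exp (-z / t) - e) / (t - m) := by
    have : ∀ᵐ t : ℝ ∂volume, t ≠ m := by simp [ae_iff]
    filter_upwards [this] with t ht htm
    exact hcongr t (uIoc_subset_uIcc htm) ht
  have hDi : IntervalIntegrable D volume m T := hcont.intervalIntegrable
  refine ⟨hDi.congr_ae ((ae_restrict_iff' measurableSet_uIoc).2 hae), ?_⟩
  rw [← intervalIntegral.integral_congr_ae hae,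
    intervalIntegral.integral_eq_sub_of_hasDerivAt hderiv hDi]
  simp

end Calculus

/-! ### Products of exponential densities. -/

section Densities

variable {n : ℕ} {TA TB : ℝ} {m z : Fin (n + 1) → ℝ}

lemma prodExpDensity_eq_zero (m : Fin (n + 1) → ℝ) (hz : ¬ 0 ≤ z) : prodExpDensity m z = 0 := by
  rw [Pi.le_def] at hz
  push Not at hz
  obtain ⟨i, hi⟩ := hz
  exact Finset.prod_eq_zero (Finset.mem_univ i) (if_neg (not_le.2 hi))

lemma prodExpDensity_of_nonneg (m : Fin (n + 1) → ℝ) (hz : 0 ≤ z) :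
    prodExpDensity m z = (∏ x, 1 / m x) * Real.exp (-∑ x, z x / m x) := by
  rw [← Finset.sum_neg_distrib, Real.exp_sum, ← Finset.prod_mul_distrib]
  refine Finset.prod_congr rfl fun x _ => ?_
  rw [expDensity, if_pos (show 0 ≤ z x from hz x), neg_div]

lemma measurable_expDensity : Measurable (fun p : ℝ × ℝ => expDensity p.1 p.2) := by
  unfold expDensity
  exact Measurable.ite (measurableSet_le measurable_const measurable_snd) (by fun_prop)
    measurable_const

lemma measurable_prodExpDensity :
    Measurable (fun p : (Fin (n + 1) → ℝ) × (Fin (n + 1) → ℝ) => prodExpDensity p.1 p.2) := by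
  unfold prodExpDensity
  refine Finset.measurable_prod _ fun x _ => ?_
  exact measurable_expDensity.comp (f := fun p : (Fin (n + 1) → ℝ) × (Fin (n + 1) → ℝ) =>
    (p.1 x, p.2 x)) (by fun_prop)

/-- A mean value estimate with the sum of the endpoint values in place of the maximum: the form of
the Lipschitz condition in `IsTame`. -/
lemma abs_exp_neg_sub_exp_neg_le (s t : ℝ) :
    |Real.exp (-s) - Real.exp (-t)| ≤ |s - t| * (Real.exp (-s) + Real.exp (-t)) := by
  wlog h : s ≤ t generalizing s t
  · rw [abs_sub_comm, abs_sub_comm s t, add_comm]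
    exact this t s (le_of_not_ge h)
  have h1 : Real.exp (-t) ≤ Real.exp (-s) := Real.exp_le_exp.2 (by linarith)
  have h2 : Real.exp (-t) = Real.exp (-s) * Real.exp (s - t) := by
    rw [← Real.exp_add]; congr 1; ring
  have h3 := Real.add_one_le_exp (s - t)
  have hs := Real.exp_pos (-s)
  rw [abs_of_nonneg (by linarith), abs_of_nonpos (by linarith)]
  have ht := Real.exp_pos (-t)
  nlinarith [mul_nonneg (sub_nonneg.2 h) ht.le]

/-- The constant of `isTame_prodExpDensity`. -/
noncomputable def tameConst (n : ℕ) (TA : ℝ) : ℝ := (1 / TA) ^ (n + 1) * (1 + 1 / TA)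

/-- The rate `1 / TB` is the slowest decay among the admissible means. Neither it nor the constant
depends on `m`, so averaging over the means preserves tameness. -/
lemma isTame_prodExpDensity (hA : 0 < TA) (hm : ∀ x, TA ≤ m x ∧ m x ≤ TB) :
    IsTame (1 / TB) (tameConst n TA) (prodExpDensity m) := by
  have hm0 : ∀ x, 0 < m x := fun x => hA.trans_le (hm x).1
  have hB : 0 < TB := (hm0 0).trans_le (hm 0).2
  have hP0 : 0 ≤ ∏ x, 1 / m x := Finset.prod_nonneg fun x _ => (one_div_pos.2 (hm0 x)).le
  have hP : ∏ x, 1 / m x ≤ (1 / TA) ^ (n + 1) := by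
    calc ∏ x, 1 / m x ≤ ∏ _x : Fin (n + 1), 1 / TA :=
          Finset.prod_le_prod (fun x _ => (one_div_pos.2 (hm0 x)).le)
            fun x _ => one_div_le_one_div_of_le hA (hm x).1
      _ = _ := by simp
  have hE : ∀ z : Fin (n + 1) → ℝ, 0 ≤ z → Real.exp (-∑ x, z x / m x) ≤ decay (1 / TB) z := by
    intro z hz
    rw [decay, Finset.mul_sum]
    refine Real.exp_le_exp.2 (neg_le_neg (Finset.sum_le_sum fun x _ => ?_))
    rw [div_eq_inv_mul (z x), ← one_div]
    exact mul_le_mul_of_nonneg_right (one_div_le_one_div_of_le (hm0 x) (hm x).2) (hz x)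
  have hA1 : 0 < 1 / TA := one_div_pos.2 hA
  refine ⟨measurable_prodExpDensity.comp measurable_prodMk_left,
    fun z hz => prodExpDensity_eq_zero m hz, fun z hz => ?_, fun z z' hz hz' => ?_⟩
  · rw [prodExpDensity_of_nonneg m hz, abs_of_nonneg (mul_nonneg hP0 (Real.exp_pos _).le),
      tameConst]
    refine mul_le_mul (hP.trans ?_) (hE z hz) (Real.exp_pos _).le (by positivity)
    exact le_mul_of_one_le_right (by positivity) (by linarith)
  · rw [prodExpDensity_of_nonneg m hz, prodExpDensity_of_nonneg m hz', ← mul_sub, abs_mul,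
      abs_of_nonneg hP0]
    have h1 := abs_exp_neg_sub_exp_neg_le (∑ x, z x / m x) (∑ x, z' x / m x)
    have h2 : |∑ x, z x / m x - ∑ x, z' x / m x| ≤ (1 + 1 / TA) * ∑ x, |z x - z' x| := by
      rw [← Finset.sum_sub_distrib, Finset.mul_sum]
      refine (Finset.abs_sum_le_sum_abs _ _).trans (Finset.sum_le_sum fun x _ => ?_)
      rw [← sub_div, abs_div, abs_of_pos (hm0 x), div_eq_inv_mul, ← one_div]
      refine mul_le_mul_of_nonneg_right ?_ (abs_nonneg _)
      linarith [one_div_le_one_div_of_le hA (hm x).1]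
    have hs : 0 ≤ ∑ x, |z x - z' x| := Finset.sum_nonneg fun _ _ => abs_nonneg _
    calc _ ≤ (1 / TA) ^ (n + 1) * (|∑ x, z x / m x - ∑ x, z' x / m x| *
          (Real.exp (-∑ x, z x / m x) + Real.exp (-∑ x, z' x / m x))) := by gcongr
      _ ≤ (1 / TA) ^ (n + 1) * (((1 + 1 / TA) * ∑ x, |z x - z' x|) *
          (decay (1 / TB) z + decay (1 / TB) z')) := by
          gcongr
          · exact hE z hz
          · exact hE z' hz'
      _ = _ := by rw [tameConst]; ring

lemma prodExpDensity_add (m : Fin (n + 1) → ℝ) (hz : 0 ≤ z) {v : Fin (n + 1) → ℝ} {α : ℝ}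
    (h : 0 ≤ z + α • v) :
    prodExpDensity m (z + α • v) =
      prodExpDensity m z * Real.exp (-((∑ x, v x / m x) * α)) := by
  rw [prodExpDensity_of_nonneg m hz, prodExpDensity_of_nonneg m h, mul_assoc, ← Real.exp_add]
  congr 2
  rw [Finset.sum_mul, ← neg_add, ← Finset.sum_add_distrib]
  congr 1
  refine Finset.sum_congr rfl fun x _ => ?_
  simp only [Pi.add_apply, Pi.smul_apply, smul_eq_mul]
  ring

end Densities

/-! ### The directions of exits, entrances and transfers. -/

section Directions

variable {ι : Type*} [DecidableEq ι] {z : ι → ℝ} {α β : ℝ} {x y : ι}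

lemma nonneg_sub_smul_single (hz : 0 ≤ z) :
    0 ≤ z - α • (Pi.single x 1 : ι → ℝ) ↔ α ≤ z x := by
  refine ⟨fun h => by simpa using h x, fun h i => ?_⟩
  rcases eq_or_ne i x with rfl | hi
  · simpa using h
  · simpa [hi] using hz i

lemma nonneg_add_smul_single (hz : 0 ≤ z) (hα : 0 ≤ α) :
    0 ≤ z + α • (Pi.single x 1 : ι → ℝ) := by
  intro i
  have := hz i
  rcases eq_or_ne i x with rfl | hi
  · simp only [Pi.zero_apply, Pi.add_apply, Pi.smul_apply, Pi.single_eq_same, smul_eq_mul,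
      mul_one] at *
    linarith
  · simpa [hi] using hz i

lemma nonneg_sub_smul_transfer (hxy : x ≠ y) (hz : 0 ≤ z) (hα : 0 ≤ α) :
    0 ≤ z - α • (Pi.single x 1 - Pi.single y 1 : ι → ℝ) ↔ α ≤ z x := by
  rw [smul_sub, sub_sub_eq_add_sub, add_sub_right_comm, ← nonneg_sub_smul_single hz]
  refine ⟨fun h => ?_, fun h => nonneg_add_smul_single h hα⟩
  rw [nonneg_sub_smul_single hz]
  simpa [hxy] using h x

lemma nonneg_add_smul_transfer (hxy : x ≠ y) (hz : 0 ≤ z) (hα : 0 ≤ α) :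
    0 ≤ z + α • (Pi.single x 1 - Pi.single y 1 : ι → ℝ) ↔ α ≤ z y := by
  rw [← nonneg_sub_smul_transfer hxy.symm hz hα, ← neg_sub (Pi.single y 1 : ι → ℝ), smul_neg,
    ← sub_eq_add_neg]

variable [Fintype ι]

lemma isJump_exit (hβ : 0 ≤ β) (x : ι) : IsJump β 0 (Pi.single x 1) where
  coord i := by rcases eq_or_ne i x with rfl | hi <;> simp [*]
  ne_zero := ⟨x, by simp⟩
  nonneg := le_rfl
  tilt := by simpa using hβ
  loss := Or.inr ⟨x, by simp⟩
  gain := Or.inl (by simp)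

lemma isJump_entrance {τ : ℝ} (hβ : 0 ≤ β) (hτ : β ≤ τ) (x : ι) :
    IsJump β τ (-Pi.single x 1) where
  coord i := by rcases eq_or_ne i x with rfl | hi <;> simp [*]
  ne_zero := ⟨x, by simp⟩
  nonneg := hβ.trans hτ
  tilt := by simpa using hτ
  loss := Or.inl hτ
  gain := Or.inr ⟨x, by simp⟩

lemma isJump_transfer (β : ℝ) (hxy : x ≠ y) :
    IsJump β 0 (Pi.single x 1 - Pi.single y 1) where
  coord i := by
    rcases eq_or_ne i x with rfl | hi
    · simp [hxy]
    · rcases eq_or_ne i y with rfl | hi' <;> simp [*]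
  ne_zero := ⟨x, by simp [hxy]⟩
  nonneg := le_rfl
  tilt := by simp
  loss := Or.inr ⟨x, by simp [hxy]⟩
  gain := Or.inr ⟨y, by simp [hxy.symm]⟩

end Directions

/-! ### Balances of a product density as jumps of its means. -/

section Exchange

variable {n : ℕ} {m z : Fin (n + 1) → ℝ} {T : ℝ} {x y : Fin (n + 1)}

/-- Rate of change of the product density when the mean at `x` jumps to a point `t` between `m x`
and `T` with intensity `dt / |t - m x|`. -/
noncomputable def exchange (m z : Fin (n + 1) → ℝ) (x : Fin (n + 1)) (T : ℝ) : ℝ :=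
  ∫ t in m x..T, (prodExpDensity (Function.update m x t) z - prodExpDensity m z) / (t - m x)

lemma prodExpDensity_update (hz : 0 ≤ z) (x : Fin (n + 1)) (t : ℝ) :
    prodExpDensity (Function.update m x t) z =
      (∏ w ∈ Finset.univ.erase x, expDensity (m w) (z w)) * (1 / t * Real.exp (-z x / t)) := by
  rw [prodExpDensity, ← Finset.prod_erase_mul _ _ (Finset.mem_univ x)]
  congr 1
  · refine Finset.prod_congr rfl fun w hw => ?_
    rw [Function.update_of_ne (Finset.ne_of_mem_erase hw)]
  · rw [Function.update_self, expDensity, if_pos (show 0 ≤ z x from hz x)]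

lemma exchange_eq (hm : 0 < m x) (hT : 0 < T) (hz : 0 ≤ z) :
    IntervalIntegrable (fun t => (prodExpDensity (Function.update m x t) z - prodExpDensity m z) /
      (t - m x)) volume (m x) T ∧
    exchange m z x T = prodExpDensity m z *
      (expSlopeIntegral ((1 / T - 1 / m x) * z x) + Real.log (m x) - Real.log T) := by
  have h0 : prodExpDensity m z =
      (∏ w ∈ Finset.univ.erase x, expDensity (m w) (z w)) *
        (1 / m x * Real.exp (-z x / m x)) := by
    rw [← prodExpDensity_update hz, Function.update_eq_self]
  obtain ⟨h1, h2⟩ := integral_slope_exp (z := z x) hm hT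
  have h3 : ∀ t, (prodExpDensity (Function.update m x t) z - prodExpDensity m z) / (t - m x) =
      (∏ w ∈ Finset.univ.erase x, expDensity (m w) (z w)) *
        ((1 / t * Real.exp (-z x / t) - 1 / m x * Real.exp (-z x / m x)) / (t - m x)) := by
    intro t
    rw [prodExpDensity_update hz, h0]; ring
  rw [exchange]
  simp_rw [h3]
  refine ⟨h1.const_mul _, ?_⟩
  rw [intervalIntegral.integral_const_mul, h2, h0]; ring

lemma sum_single_div (x : Fin (n + 1)) :
    ∑ w, (Pi.single x 1 : Fin (n + 1) → ℝ) w / m w = 1 / m x := by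
  rw [Finset.sum_eq_single x] <;> simp +contextual

/-- Along the transfer the product is multiplied by `exp (-c α)` as long as `α ≤ z y`. Subtracting
`1` there produces the exponential integral of `exchange`; the remaining difference of indicators
integrates to `log (z y) - log (z x)`. The logarithms of the means correct for those contained in
`exchange`. -/
lemma integral_balanceKernel_transfer (hm : ∀ x, 0 < m x) (hz : ∀ x, 0 < z x) (hxy : x ≠ y) :
    ∫ α in Ioi 0, balanceKernel 0 (Pi.single x 1 - Pi.single y 1) (prodExpDensity m) z α =
      exchange m z y (m x) + prodExpDensity m z *
        ((Real.log (z y) - Real.log (m y)) - (Real.log (z x) - Real.log (m x))) := by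
  classical
  have hz0 : 0 ≤ z := fun x => (hz x).le
  set c := 1 / m x - 1 / m y with hc
  have hv : ∑ w, (Pi.single x 1 - Pi.single y 1 : Fin (n + 1) → ℝ) w / m w = c := by
    simp_rw [Pi.sub_apply, sub_div, Finset.sum_sub_distrib, sum_single_div, hc]
  have key : ∀ α ∈ Ioi (0 : ℝ),
      balanceKernel 0 (Pi.single x 1 - Pi.single y 1) (prodExpDensity m) z α =
        prodExpDensity m z * ((Ioc 0 (z y)).indicator (fun α => (Real.exp (-(c * α)) - 1) / α) α +
          ((if α ≤ z y then 1 else 0) - (if α ≤ z x then 1 else 0)) / α) := by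
    intro α hα
    have hα0 : 0 < α := hα
    rw [balanceKernel, zero_mul, neg_zero, Real.exp_zero]
    simp only [nonneg_sub_smul_transfer hxy hz0 hα0.le, indicator_apply, mem_Ioc, hα0, true_and]
    by_cases h : α ≤ z y
    · rw [prodExpDensity_add m hz0 ((nonneg_add_smul_transfer hxy hz0 hα0.le).2 h), hv]
      split_ifs <;> ring
    · rw [prodExpDensity_eq_zero m (mt (nonneg_add_smul_transfer hxy hz0 hα0.le).1 h)]
      split_ifs <;> ring
  obtain ⟨h1, h2⟩ := integral_indicator_sub_indicator_div (hz y) (hz x)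
  have h3 : IntegrableOn ((Ioc 0 (z y)).indicator (fun α => (Real.exp (-(c * α)) - 1) / α))
      (Ioi 0) :=
    ((integrableOn_exp_sub_one_div c (z y)).integrable_indicator measurableSet_Ioc).integrableOn
  rw [setIntegral_congr_fun measurableSet_Ioi key, integral_const_mul, integral_add h3 h1, h2,
    setIntegral_indicator measurableSet_Ioc, inter_eq_right.2 Ioc_subset_Ioi_self,
    integral_exp_sub_one_div c (hz y).le, (exchange_eq (hm y) (hm x) hz0).2]
  ring

/-- Added pointwise in `α`, the two kernels split into an exponential integral truncated at `z x`,
with `c = 1 / T - 1 / m x`, and a Frullani integrand with rates `1 / m x` and `1 / T`. The latter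
gives `log (m x) - log T`, so no remainder is left. -/
lemma integral_balanceKernel_bath (hm : ∀ x, 0 < m x) (hz : ∀ x, 0 < z x) (hT : 0 < T)
    (h1 : IntegrableOn (balanceKernel 0 (Pi.single x 1) (prodExpDensity m) z) (Ioi 0))
    (h2 : IntegrableOn (balanceKernel (1 / T) (-Pi.single x 1) (prodExpDensity m) z) (Ioi 0)) :
    (∫ α in Ioi 0, balanceKernel (1 / T) (-Pi.single x 1) (prodExpDensity m) z α) +
      ∫ α in Ioi 0, balanceKernel 0 (Pi.single x 1) (prodExpDensity m) z α =
      exchange m z x T := by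
  classical
  have hz0 : 0 ≤ z := fun x => (hz x).le
  set c := 1 / T - 1 / m x with hc
  have key : ∀ α ∈ Ioi (0 : ℝ),
      balanceKernel (1 / T) (-Pi.single x 1) (prodExpDensity m) z α +
        balanceKernel 0 (Pi.single x 1) (prodExpDensity m) z α =
        prodExpDensity m z * ((Ioc 0 (z x)).indicator (fun α => (Real.exp (-(c * α)) - 1) / α) α +
          (Real.exp (-(1 / m x * α)) - Real.exp (-(1 / T * α))) / α) := by
    intro α hα
    have hα0 : 0 < α := hα
    have hs := nonneg_add_smul_single (x := x) hz0 hα0.le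
    rw [balanceKernel, balanceKernel, zero_mul, neg_zero, Real.exp_zero]
    simp only [nonneg_sub_smul_single hz0, indicator_apply, mem_Ioc, hα0, true_and, smul_neg,
      sub_neg_eq_add, hs, if_true]
    rw [prodExpDensity_add m hz0 hs, sum_single_div]
    by_cases h : α ≤ z x
    · have h' := (nonneg_sub_smul_single hz0).2 h
      have h4 : prodExpDensity m (z + -(α • Pi.single x 1)) =
          prodExpDensity m z * Real.exp (1 / m x * α) := by
        have h'' : 0 ≤ z + α • (-Pi.single x 1 : Fin (n + 1) → ℝ) := by
          rwa [smul_neg, ← sub_eq_add_neg]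
        rw [← smul_neg, prodExpDensity_add m hz0 h'']
        simp_rw [Pi.neg_apply, neg_div, Finset.sum_neg_distrib, sum_single_div, neg_mul, neg_neg]
      have h5 : Real.exp (-(c * α)) = Real.exp (-(1 / T * α)) * Real.exp (1 / m x * α) := by
        rw [← Real.exp_add]; congr 1; rw [hc]; ring
      rw [if_pos h, if_pos h, h4, h5]
      ring
    · have h' := mt (nonneg_sub_smul_single hz0).1 h
      rw [sub_eq_add_neg] at h'
      rw [if_neg h, if_neg h, prodExpDensity_eq_zero m h']
      ring
  obtain ⟨h4, h5⟩ := integral_exp_sub_exp_div (one_div_pos.2 (hm x)) (one_div_pos.2 hT)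
  have h3 : IntegrableOn ((Ioc 0 (z x)).indicator (fun α => (Real.exp (-(c * α)) - 1) / α))
      (Ioi 0) :=
    ((integrableOn_exp_sub_one_div c (z x)).integrable_indicator measurableSet_Ioc).integrableOn
  rw [← integral_add h2 h1, setIntegral_congr_fun measurableSet_Ioi key, integral_const_mul,
    integral_add h3 h4, h5, setIntegral_indicator measurableSet_Ioc,
    inter_eq_right.2 Ioc_subset_Ioi_self, integral_exp_sub_one_div c (hz x).le,
    (exchange_eq (hm x) hT hz0).2, ← hc, one_div, one_div, Real.log_inv, Real.log_inv]
  ring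

end Exchange

/-! ### The generator and the stationarity equation as sums over jumps. -/

section Chain

variable {n : ℕ} {TA TB β C : ℝ} {μ f : (Fin (n + 1) → ℝ) → ℝ} {z : Fin (n + 1) → ℝ}

/-- Index of the jumps of the chain: transfers between neighbours, then entrance and exit at the
left end, then entrance and exit at the right end. -/
abbrev JumpIndex (n : ℕ) : Type :=
  {p : Fin (n + 1) × Fin (n + 1) // Adjacent p.1 p.2} ⊕ Fin 4

/-- Inverse temperature in the intensity of a jump. -/
noncomputable def jumpRate (TA TB : ℝ) : JumpIndex n → ℝ :=
  Sum.elim (fun _ => 0) ![1 / TA, 0, 1 / TB, 0]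

/-- Direction of a jump. -/
noncomputable def jumpDir : JumpIndex n → Fin (n + 1) → ℝ :=
  Sum.elim (fun p => Pi.single p.1.1 1 - Pi.single p.1.2 1)
    ![-Pi.single 0 1, Pi.single 0 1, -Pi.single (Fin.last n) 1, Pi.single (Fin.last n) 1]

lemma Adjacent.ne {x y : Fin (n + 1)} (h : Adjacent x y) : x ≠ y := by
  rintro rfl; simp [Adjacent] at h

lemma isJump_jumpDir (hA : 0 < TA) (hAB : TA ≤ TB) (j : JumpIndex n) :
    IsJump (1 / TB) (jumpRate TA TB j) (jumpDir j) := by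
  have hβ : 0 ≤ 1 / TB := (one_div_pos.2 (hA.trans_le hAB)).le
  rcases j with p | j
  · exact isJump_transfer _ p.2.ne
  · fin_cases j
    · exact isJump_entrance hβ (one_div_le_one_div_of_le hA hAB) 0
    · exact isJump_exit hβ 0
    · exact isJump_entrance hβ le_rfl (Fin.last n)
    · exact isJump_exit hβ (Fin.last n)

lemma sum_jumpIndex (G : ℝ → (Fin (n + 1) → ℝ) → ℝ) :
    ∑ j : JumpIndex n, G (jumpRate TA TB j) (jumpDir j) =
      ∑ p : Fin (n + 1) × Fin (n + 1) with Adjacent p.1 p.2,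
        G 0 (Pi.single p.1 1 - Pi.single p.2 1) +
      ((G (1 / TA) (-Pi.single 0 1) + G 0 (Pi.single 0 1)) +
      (G (1 / TB) (-Pi.single (Fin.last n) 1) + G 0 (Pi.single (Fin.last n) 1))) := by
  rw [Fintype.sum_sum_type, Fin.sum_univ_four]
  congr 1
  · rw [Finset.sum_subtype (p := fun p : Fin (n + 1) × Fin (n + 1) => Adjacent p.1 p.2) _
      (fun p => by simp)]
    rfl
  · simp only [jumpRate, jumpDir, Sum.elim_inr]
    simp [add_assoc]

lemma smul_single_one (x : Fin (n + 1)) (α : ℝ) :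
    α • (Pi.single x 1 : Fin (n + 1) → ℝ) = Pi.single x α := by
  rw [← Pi.single_smul, smul_eq_mul, mul_one]

lemma setIntegral_Ioi_eq_intervalIntegral {k g : ℝ → ℝ} {a : ℝ} (ha : 0 ≤ a)
    (h1 : ∀ α, 0 < α → α ≤ a → k α = g α) (h2 : ∀ α, 0 < α → a < α → k α = 0) :
    ∫ α in Ioi 0, k α = ∫ α in (0 : ℝ)..a, g α := by
  rw [intervalIntegral.integral_of_le ha, ← setIntegral_congr_fun measurableSet_Ioc
    (fun α hα => h1 α hα.1 hα.2)]
  exact (setIntegral_eq_of_subset_of_forall_sdiff_eq_zero measurableSet_Ioi Ioc_subset_Ioi_self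
    fun α hα => h2 α hα.1 (not_le.1 fun h => hα.2 ⟨hα.1, h⟩))

/-- In the orthant, the condition `0 ≤ z - α • v` truncates exits and transfers at `z x` and leaves
entrances untruncated, so all the integrals can be taken over the half-line. -/
lemma generator_eq_sum (hz : 0 ≤ z) :
    generator n TA TB f z =
      ∑ j : JumpIndex n, ∫ α in Ioi 0, jumpKernel (jumpRate TA TB j) (jumpDir j) f z α := by
  have hexit : ∀ x, ∫ α in Ioi 0, jumpKernel 0 (Pi.single x 1) f z α =
      ∫ α in (0 : ℝ)..z x, (f (z - Pi.single x α) - f z) / α := by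
    intro x
    refine setIntegral_Ioi_eq_intervalIntegral (hz x) (fun α hα h => ?_) (fun α hα h => ?_)
    · rw [jumpKernel, if_pos ((nonneg_sub_smul_single hz).2 h), zero_mul, neg_zero, Real.exp_zero,
        smul_single_one]
      ring
    · rw [jumpKernel, if_neg (mt (nonneg_sub_smul_single hz).1 h.not_ge)]
  have hentr : ∀ x T, ∫ α in Ioi 0, jumpKernel (1 / T) (-Pi.single x 1) f z α =
      ∫ α in Ioi (0 : ℝ), Real.exp (-α / T) / α * (f (z + Pi.single x α) - f z) := by
    intro x T
    refine setIntegral_congr_fun measurableSet_Ioi fun α hα => ?_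
    have h := nonneg_add_smul_single (x := x) hz (le_of_lt hα)
    have h' : 0 ≤ z - α • (-Pi.single x 1 : Fin (n + 1) → ℝ) := by rwa [smul_neg, sub_neg_eq_add]
    have he : Real.exp (-(1 / T * α)) = Real.exp (-α / T) := by congr 1; ring
    simp only [jumpKernel]
    rw [if_pos h', smul_neg, sub_neg_eq_add, smul_single_one, he]
  have htrans : ∀ x y, Adjacent x y →
      ∫ α in Ioi 0, jumpKernel 0 (Pi.single x 1 - Pi.single y 1) f z α =
      ∫ α in (0 : ℝ)..z x, (f (z - Pi.single x α + Pi.single y α) - f z) / α := by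
    intro x y hxy
    refine setIntegral_Ioi_eq_intervalIntegral (hz x) (fun α hα h => ?_) (fun α hα h => ?_)
    · rw [jumpKernel, if_pos ((nonneg_sub_smul_transfer hxy.ne hz hα.le).2 h), zero_mul, neg_zero,
        Real.exp_zero, smul_sub, smul_single_one, smul_single_one, sub_sub_eq_add_sub,
        add_sub_right_comm]
      ring
    · rw [jumpKernel, if_neg (mt (nonneg_sub_smul_transfer hxy.ne hz hα.le).1 h.not_ge)]
  rw [sum_jumpIndex (fun τ v => ∫ α in Ioi 0, jumpKernel τ v f z α), generator, bulkGenerator,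
    bathGenerator, bathGenerator, hexit, hexit, hentr, hentr, add_comm (∫ α in Ioi (0 : ℝ), _),
    add_comm (∫ α in Ioi (0 : ℝ), _)]
  congr 1
  exact Finset.sum_congr rfl fun p hp => (htrans _ _ (Finset.mem_filter.1 hp).2).symm

/-- Absolute convergence of one balance kernel on the half-line yields that of both integrals, below
and above `a = z x`, in the stationarity equation. -/
lemma integrable_split {k g h : ℝ → ℝ} {a : ℝ} (ha : 0 ≤ a) (hk : IntegrableOn k (Ioi 0))
    (h1 : ∀ α, 0 < α → α ≤ a → k α = g α) (h2 : ∀ α, a < α → k α = h α) :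
    IntervalIntegrable g volume 0 a ∧ IntegrableOn h (Ioi a) ∧
      ∫ α in Ioi 0, k α = (∫ α in (0 : ℝ)..a, g α) + ∫ α in Ioi a, h α := by
  have k1 := hk.mono_set (show Ioc 0 a ⊆ Ioi 0 from Ioc_subset_Ioi_self)
  have k2 := hk.mono_set (Ioi_subset_Ioi ha)
  refine ⟨?_, ?_, ?_⟩
  · rw [intervalIntegrable_iff_integrableOn_Ioc_of_le ha]
    exact k1.congr_fun (fun α hα => h1 α hα.1 hα.2) measurableSet_Ioc
  · exact k2.congr_fun (fun α hα => h2 α hα) measurableSet_Ioi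
  · rw [← Ioc_union_Ioi_eq_Ioi ha, setIntegral_union (Ioc_disjoint_Ioi le_rfl) measurableSet_Ioi
      k1 k2, intervalIntegral.integral_of_le ha]
    congr 1
    · exact setIntegral_congr_fun measurableSet_Ioc fun α hα => h1 α hα.1 hα.2
    · exact setIntegral_congr_fun measurableSet_Ioi fun α hα => h2 α hα

lemma IsTame.exitBalance_eq (hμ : IsTame β C μ) (hβ : 0 < β) (hz : ∀ x, 0 < z x)
    (x : Fin (n + 1)) :
    ExitConverges x μ z ∧
      ∫ α in Ioi 0, balanceKernel 0 (Pi.single x 1) μ z α = exitBalance x μ z := by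
  have hz0 : 0 ≤ z := fun x => (hz x).le
  obtain ⟨h1, h2, h3⟩ := integrable_split (hz x).le
    (hμ.integrableOn_balanceKernel (isJump_exit hβ.le x) hβ hz)
    (g := fun α => (μ (z + Pi.single x α) - μ z) / α) (h := fun α => μ (z + Pi.single x α) / α)
    (fun α hα h => by
      rw [balanceKernel, if_pos ((nonneg_sub_smul_single hz0).2 h), zero_mul, neg_zero,
        Real.exp_zero, smul_single_one]
      ring)
    (fun α h => by
      rw [balanceKernel, if_neg (mt (nonneg_sub_smul_single hz0).1 h.not_ge), zero_mul, neg_zero,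
        Real.exp_zero, smul_single_one]
      ring)
  exact ⟨⟨h1, h2⟩, h3⟩

lemma IsTame.transferBalance_eq (hμ : IsTame β C μ) (hβ : 0 < β) (hz : ∀ x, 0 < z x)
    {x y : Fin (n + 1)} (hxy : x ≠ y) :
    TransferConverges x y μ z ∧
      ∫ α in Ioi 0, balanceKernel 0 (Pi.single x 1 - Pi.single y 1) μ z α =
        transferBalance x y μ z := by
  have hz0 : 0 ≤ z := fun x => (hz x).le
  have hs : ∀ α : ℝ, z + α • (Pi.single x 1 - Pi.single y 1 : Fin (n + 1) → ℝ) =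
      z + Pi.single x α - Pi.single y α := fun α => by
    rw [smul_sub, smul_single_one, smul_single_one, add_sub_assoc]
  obtain ⟨h1, h2, h3⟩ := integrable_split (hz x).le
    (hμ.integrableOn_balanceKernel (isJump_transfer β hxy) hβ hz)
    (g := fun α => (μ (z + Pi.single x α - Pi.single y α) - μ z) / α)
    (h := fun α => μ (z + Pi.single x α - Pi.single y α) / α)
    (fun α hα h => by
      rw [balanceKernel, if_pos ((nonneg_sub_smul_transfer hxy hz0 hα.le).2 h), zero_mul,
        neg_zero, Real.exp_zero, hs]
      ring)
    (fun α h => by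
      rw [balanceKernel, if_neg (mt (nonneg_sub_smul_transfer hxy hz0
        ((hz x).trans h).le).1 h.not_ge), zero_mul, neg_zero, Real.exp_zero, hs]
      ring)
  exact ⟨⟨h1, h2⟩, h3⟩

lemma IsTame.entranceBalance_eq (hμ : IsTame β C μ) (hβ : 0 < β) (hz : ∀ x, 0 < z x) {T : ℝ}
    (hT : 0 < T) (hβT : β ≤ 1 / T) (x : Fin (n + 1)) :
    EntranceConverges T x μ z ∧
      ∫ α in Ioi 0, balanceKernel (1 / T) (-Pi.single x 1) μ z α = entranceBalance T x μ z := by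
  have hz0 : 0 ≤ z := fun x => (hz x).le
  have hs : ∀ α : ℝ, z + α • (-Pi.single x 1 : Fin (n + 1) → ℝ) = z - Pi.single x α := fun α => by
    rw [smul_neg, smul_single_one, sub_eq_add_neg]
  have hp : ∀ α : ℝ, 0 ≤ α → 0 ≤ z - α • (-Pi.single x 1 : Fin (n + 1) → ℝ) := fun α hα => by
    rw [smul_neg, sub_neg_eq_add]; exact nonneg_add_smul_single hz0 hα
  have he : ∀ α : ℝ, Real.exp (-(1 / T * α)) = Real.exp (-α / T) := fun α => by
    congr 1; ring
  obtain ⟨h1, -, h3⟩ := integrable_split (hz x).le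
    (hμ.integrableOn_balanceKernel (isJump_entrance hβ.le hβT x) hβ hz)
    (g := fun α => Real.exp (-α / T) / α * (μ (z - Pi.single x α) - μ z))
    (h := fun α => -μ z * (Real.exp (-α / T) / α))
    (fun α hα h => by
      rw [balanceKernel, if_pos (hp α hα.le), hs, he])
    (fun α h => by
      have h' : ¬ 0 ≤ z - Pi.single x α := by
        rw [← smul_single_one]; exact mt (nonneg_sub_smul_single hz0).1 h.not_ge
      rw [balanceKernel, if_pos (hp α ((hz x).trans h).le), hs, he, hμ.eq_zero _ h']
      ring)
  refine ⟨⟨h1, ?_⟩, ?_⟩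
  · have := integrableOn_exp_neg_mul_div (one_div_pos.2 hT) (hz x)
    simpa only [he] using this
  · rw [h3, integral_const_mul, entranceBalance]; ring

/-- A tame function whose jump balances add up to zero is a stationary density. -/
theorem IsTame.isStationaryDensity (hA : 0 < TA) (hAB : TA ≤ TB) (hμ : IsTame (1 / TB) C μ)
    (h : ∀ z : Fin (n + 1) → ℝ, (∀ x, 0 < z x) →
      ∑ j : JumpIndex n, ∫ α in Ioi 0, balanceKernel (jumpRate TA TB j) (jumpDir j) μ z α = 0) :
    IsStationaryDensity n TA TB μ := by
  have hB : 0 < TB := hA.trans_le hAB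
  have hβ : 0 < 1 / TB := one_div_pos.2 hB
  have hβA : 1 / TB ≤ 1 / TA := one_div_le_one_div_of_le hA hAB
  refine ⟨hμ.eq_zero, fun z hz => ?_, fun z hz => ?_⟩
  · exact ⟨(hμ.entranceBalance_eq hβ hz hA hβA 0).1, (hμ.exitBalance_eq hβ hz 0).1,
      (hμ.entranceBalance_eq hβ hz hB le_rfl _).1, (hμ.exitBalance_eq hβ hz _).1,
      fun x y hxy => (hμ.transferBalance_eq hβ hz hxy.ne).1⟩
  · have := h z hz
    rw [sum_jumpIndex (fun τ v => ∫ α in Ioi 0, balanceKernel τ v μ z α),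
      (hμ.entranceBalance_eq hβ hz hA hβA 0).2, (hμ.exitBalance_eq hβ hz 0).2,
      (hμ.entranceBalance_eq hβ hz hB le_rfl _).2, (hμ.exitBalance_eq hβ hz _).2,
      Finset.sum_congr rfl fun p hp =>
        (hμ.transferBalance_eq hβ hz (Finset.mem_filter.1 hp).2.ne).2] at this
    linarith

lemma sum_adjacent (F : Fin (n + 1) → Fin (n + 1) → ℝ) :
    ∑ p : Fin (n + 1) × Fin (n + 1) with Adjacent p.1 p.2, F p.1 p.2 =
      ∑ i : Fin n, (F i.castSucc i.succ + F i.succ i.castSucc) := by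
  have hsplit : (Finset.univ.filter fun p : Fin (n + 1) × Fin (n + 1) => Adjacent p.1 p.2) =
      (Finset.univ.filter fun p : Fin (n + 1) × Fin (n + 1) => (p.1 : ℕ) + 1 = p.2) ∪
      (Finset.univ.filter fun p : Fin (n + 1) × Fin (n + 1) => (p.2 : ℕ) + 1 = p.1) := by
    ext p
    rw [Finset.mem_union, Finset.mem_filter, Finset.mem_filter, Finset.mem_filter, Adjacent,
      abs_eq zero_le_one]
    simp only [Finset.mem_univ, true_and]
    omega
  have hdisj : Disjoint
      (Finset.univ.filter fun p : Fin (n + 1) × Fin (n + 1) => (p.1 : ℕ) + 1 = p.2)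
      (Finset.univ.filter fun p : Fin (n + 1) × Fin (n + 1) => (p.2 : ℕ) + 1 = p.1) := by
    rw [Finset.disjoint_filter]
    intro p _ h1 h2
    omega
  rw [hsplit, Finset.sum_union hdisj, Finset.sum_add_distrib]
  congr 1
  · symm
    refine Finset.sum_bij (fun i _ => (i.castSucc, i.succ)) (by simp) (by simp) ?_ (by simp)
    rintro ⟨x, y⟩ h
    simp only [Finset.mem_filter, Finset.mem_univ, true_and] at h
    exact ⟨⟨x, by omega⟩, Finset.mem_univ _, Prod.ext (Fin.ext rfl) (Fin.ext h)⟩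
  · symm
    refine Finset.sum_bij (fun i _ => (i.succ, i.castSucc)) (by simp) (by simp) ?_ (by simp)
    rintro ⟨x, y⟩ h
    simp only [Finset.mem_filter, Finset.mem_univ, true_and] at h
    exact ⟨⟨y, by omega⟩, Finset.mem_univ _, Prod.ext (Fin.ext h) (Fin.ext rfl)⟩

/-- Mean of the right neighbour, which is `TB` for the last site. -/
def rightMean (TB : ℝ) (m : Fin (n + 1) → ℝ) : Fin (n + 1) → ℝ :=
  Fin.snoc (α := fun _ => ℝ) (fun i : Fin n => m i.succ) TB

/-- Mean of the left neighbour, which is `TA` for the first site. -/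
def leftMean (TA : ℝ) (m : Fin (n + 1) → ℝ) : Fin (n + 1) → ℝ :=
  Fin.cons (α := fun _ => ℝ) TA fun i : Fin n => m i.castSucc

/-- The jump balances of a product of exponential densities add up to the exchange terms. -/
theorem sum_balance_prodExpDensity (hA : 0 < TA) (hAB : TA ≤ TB) {m : Fin (n + 1) → ℝ}
    (hm : ∀ x, TA ≤ m x ∧ m x ≤ TB) (hz : ∀ x, 0 < z x) :
    ∑ j : JumpIndex n, ∫ α in Ioi 0,
        balanceKernel (jumpRate TA TB j) (jumpDir j) (prodExpDensity m) z α =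
      ∑ x, (exchange m z x (rightMean TB m x) + exchange m z x (leftMean TA m x)) := by
  have hB : 0 < TB := hA.trans_le hAB
  have hβ : 0 < 1 / TB := one_div_pos.2 hB
  have hβA : 1 / TB ≤ 1 / TA := one_div_le_one_div_of_le hA hAB
  have hm0 : ∀ x, 0 < m x := fun x => hA.trans_le (hm x).1
  have hE := isTame_prodExpDensity hA hm
  rw [sum_jumpIndex (fun τ v => ∫ α in Ioi 0, balanceKernel τ v (prodExpDensity m) z α),
    integral_balanceKernel_bath hm0 hz hA
      (hE.integrableOn_balanceKernel (isJump_exit hβ.le 0) hβ hz)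
      (hE.integrableOn_balanceKernel (isJump_entrance hβ.le hβA 0) hβ hz),
    integral_balanceKernel_bath hm0 hz hB
      (hE.integrableOn_balanceKernel (isJump_exit hβ.le (Fin.last n)) hβ hz)
      (hE.integrableOn_balanceKernel (isJump_entrance hβ.le le_rfl (Fin.last n)) hβ hz),
    Finset.sum_congr rfl fun p hp =>
      integral_balanceKernel_transfer hm0 hz (Finset.mem_filter.1 hp).2.ne,
    sum_adjacent (fun x y => exchange m z y (m x) + prodExpDensity m z *
        ((Real.log (z y) - Real.log (m y)) - (Real.log (z x) - Real.log (m x)))),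
    Finset.sum_add_distrib (f := fun x => exchange m z x (rightMean TB m x)),
    Fin.sum_univ_castSucc (f := fun x => exchange m z x (rightMean TB m x)), Fin.sum_univ_succ
      (f := fun x => exchange m z x (leftMean TA m x))]
  simp only [rightMean, leftMean, Fin.snoc_castSucc, Fin.snoc_last, Fin.cons_zero, Fin.cons_succ]
  -- The logarithmic terms of the two orientations of an edge are opposite. What remains is one
  -- exchange towards each neighbour, the baths acting as the missing neighbours at the ends.
  have : ∀ i : Fin n, (exchange m z i.succ (m i.castSucc) + prodExpDensity m z *
      ((Real.log (z i.succ) - Real.log (m i.succ)) -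
        (Real.log (z i.castSucc) - Real.log (m i.castSucc)))) +
      (exchange m z i.castSucc (m i.succ) + prodExpDensity m z *
      ((Real.log (z i.castSucc) - Real.log (m i.castSucc)) -
        (Real.log (z i.succ) - Real.log (m i.succ)))) =
      exchange m z i.castSucc (m i.succ) + exchange m z i.succ (m i.castSucc) := fun i => by ring
  rw [Finset.sum_congr rfl fun i _ => this i, Finset.sum_add_distrib]
  ring

end Chain

/-! ### Interchange of one mean with an auxiliary variable. -/

section Swap

variable {n : ℕ}

/-- Exchange of the coordinate `x` of a vector with a separate variable. -/
def swapCoord (x : Fin (n + 1)) (p : (Fin (n + 1) → ℝ) × ℝ) : (Fin (n + 1) → ℝ) × ℝ :=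
  (Function.update p.1 x p.2, p.1 x)

/-- With the auxiliary variable adjoined as coordinate `0` of `Fin (n + 2) → ℝ`, the map is the
permutation of coordinates that transposes `0` and `x.succ`. -/
lemma measurePreserving_swapCoord (x : Fin (n + 1)) :
    MeasurePreserving (swapCoord x) (volume.prod volume) (volume.prod volume) := by
  have h1 := volume_preserving_piFinSuccAbove (fun _ : Fin (n + 2) => ℝ) 0
  have h2 := volume_measurePreserving_piCongrLeft (fun _ : Fin (n + 2) => ℝ)
    (Equiv.swap 0 x.succ)
  have h3 : MeasurePreserving (Prod.swap : ℝ × (Fin (n + 1) → ℝ) → (Fin (n + 1) → ℝ) × ℝ)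
      (volume.prod volume) (volume.prod volume) := Measure.measurePreserving_swap
  have h4 : MeasurePreserving (Prod.swap : (Fin (n + 1) → ℝ) × ℝ → ℝ × (Fin (n + 1) → ℝ))
      (volume.prod volume) (volume.prod volume) := Measure.measurePreserving_swap
  have h := (h3.comp h1).comp (h2.comp ((h1.symm _).comp h4))
  convert h using 1
  funext p
  obtain ⟨m, t⟩ := p
  have key : ∀ j, (MeasurableEquiv.piCongrLeft (fun _ : Fin (n + 2) => ℝ) (Equiv.swap 0 x.succ))
      ((MeasurableEquiv.piFinSuccAbove (fun _ : Fin (n + 2) => ℝ) 0).symm (t, m)) j =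
      (Fin.cons t m : Fin (n + 2) → ℝ) (Equiv.swap 0 x.succ j) := by
    intro j
    have := MeasurableEquiv.piCongrLeft_apply_apply (Equiv.swap 0 x.succ)
      (β := fun _ : Fin (n + 2) => ℝ)
      ((MeasurableEquiv.piFinSuccAbove (fun _ : Fin (n + 2) => ℝ) 0).symm (t, m))
      (Equiv.swap 0 x.succ j)
    rw [Equiv.swap_apply_self] at this
    rw [this]
    simp [MeasurableEquiv.piFinSuccAbove, Fin.insertNthEquiv]
  refine Prod.ext ?_ ?_
  · funext w
    simp only [swapCoord, Function.comp_apply, Prod.swap]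
    change _ = (MeasurableEquiv.piCongrLeft (fun _ : Fin (n + 2) => ℝ) (Equiv.swap 0 x.succ))
      ((MeasurableEquiv.piFinSuccAbove (fun _ : Fin (n + 2) => ℝ) 0).symm (t, m))
      (Fin.succAbove 0 w)
    rw [key, Fin.succAbove_zero]
    rcases eq_or_ne w x with rfl | hw
    · simp
    · rw [Equiv.swap_apply_of_ne_of_ne (Fin.succ_ne_zero w) (by simpa using hw),
        Function.update_of_ne hw, Fin.cons_succ]
  · change m x = (MeasurableEquiv.piCongrLeft (fun _ : Fin (n + 2) => ℝ) (Equiv.swap 0 x.succ))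
      ((MeasurableEquiv.piFinSuccAbove (fun _ : Fin (n + 2) => ℝ) 0).symm (t, m)) 0
    rw [key, Equiv.swap_apply_left, Fin.cons_succ]

lemma swapCoord_swapCoord (x : Fin (n + 1)) (p : (Fin (n + 1) → ℝ) × ℝ) :
    swapCoord x (swapCoord x p) = p := by
  simp [swapCoord]

/-- The swap is a measure-preserving involution, so the integral equals its own negative. -/
lemma integral_eq_zero_of_swapCoord {x : Fin (n + 1)} {G : (Fin (n + 1) → ℝ) × ℝ → ℝ}
    (hG : ∀ p, G (swapCoord x p) = -G p) :
    ∫ p, G p ∂((volume : Measure (Fin (n + 1) → ℝ)).prod volume) = 0 := by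
  have hmp := measurePreserving_swapCoord x
  have he : MeasurableEmbedding (swapCoord x) :=
    (MeasurableEquiv.mk ⟨swapCoord x, swapCoord x, swapCoord_swapCoord x, swapCoord_swapCoord x⟩
      hmp.measurable hmp.measurable).measurableEmbedding
  have := hmp.integral_comp he G
  simp_rw [hG] at this
  rw [integral_neg] at this
  linarith

end Swap

/-! ### Reversibility of the uniform law on the ordered simplex. -/

section Simplex

variable {n : ℕ} {TA TB : ℝ} {m z : Fin (n + 1) → ℝ}

lemma orderedSimplex_bounds (hm : m ∈ orderedSimplex n TA TB) (x : Fin (n + 1)) :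
    TA ≤ m x ∧ m x ≤ TB :=
  ⟨hm.1.trans (hm.2.1 (Fin.zero_le x)), (hm.2.1 (Fin.le_last x)).trans hm.2.2⟩

lemma isClosed_orderedSimplex : IsClosed (orderedSimplex n TA TB) := by
  have h : orderedSimplex n TA TB = {m | TA ≤ m 0} ∩
      ((⋂ (x) (y) (_ : x ≤ y), {m | m x ≤ m y}) ∩ {m | m (Fin.last n) ≤ TB}) := by
    ext m
    simp only [orderedSimplex, mem_ofPred_eq, mem_inter_iff, mem_iInter]
    rfl
  rw [h]
  refine (isClosed_le continuous_const (continuous_apply _)).inter (IsClosed.inter ?_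
    (isClosed_le (continuous_apply _) continuous_const))
  exact isClosed_iInter fun x => isClosed_iInter fun y => isClosed_iInter fun _ =>
    isClosed_le (continuous_apply _) (continuous_apply _)

lemma measurableSet_orderedSimplex : MeasurableSet (orderedSimplex n TA TB) :=
  isClosed_orderedSimplex.measurableSet

lemma orderedSimplex_subset_Icc :
    orderedSimplex n TA TB ⊆ Icc (fun _ => TA) (fun _ => TB) := fun _ hm =>
  ⟨fun x => (orderedSimplex_bounds hm x).1, fun x => (orderedSimplex_bounds hm x).2⟩

lemma volume_orderedSimplex_lt_top : volume (orderedSimplex n TA TB) < ⊤ :=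
  (measure_mono orderedSimplex_subset_Icc).trans_lt isCompact_Icc.measure_lt_top

lemma volume_orderedSimplex_pos (hAB : TA < TB) : 0 < volume (orderedSimplex n TA TB) := by
  set U : Set (Fin (n + 1) → ℝ) := {m | TA < m 0} ∩
    ((⋂ i : Fin n, {m | m i.castSucc < m i.succ}) ∩ {m | m (Fin.last n) < TB}) with hU
  have hUo : IsOpen U := by
    refine (isOpen_lt continuous_const (continuous_apply _)).inter (IsOpen.inter ?_
      (isOpen_lt (continuous_apply _) continuous_const))
    exact isOpen_iInter_of_finite fun i => isOpen_lt (continuous_apply _) (continuous_apply _)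
  have hUne : U.Nonempty := by
    have hn : (0 : ℝ) < n + 2 := by positivity
    have hd : 0 < (TB - TA) / (n + 2) := div_pos (sub_pos.2 hAB) hn
    -- Equally spaced means: the `n + 1` interior points of a division into `n + 2` intervals.
    refine ⟨fun i => TA + ((i : ℕ) + 1) * ((TB - TA) / (n + 2)), ?_, mem_iInter.2 fun i => ?_, ?_⟩
    · simpa using hd
    · simp only [mem_ofPred_eq, Fin.val_castSucc, Fin.val_succ, Nat.cast_add, Nat.cast_one]
      nlinarith
    · simp only [mem_ofPred_eq, Fin.val_last]
      have : (TB - TA) = (n + 2) * ((TB - TA) / (n + 2)) := by field_simp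
      nlinarith
  refine (hUo.measure_pos volume hUne).trans_le (measure_mono fun m hm => ?_)
  rw [hU, mem_inter_iff, mem_inter_iff, mem_iInter] at hm
  exact ⟨le_of_lt hm.1, Fin.monotone_iff_le_succ.2 fun i => le_of_lt (hm.2.1 i), le_of_lt hm.2.2⟩

lemma le_rightMean (hm : m ∈ orderedSimplex n TA TB) (x : Fin (n + 1)) :
    m x ≤ rightMean TB m x := by
  rcases Fin.eq_castSucc_or_eq_last x with ⟨i, rfl⟩ | rfl
  · rw [rightMean, Fin.snoc_castSucc]; exact hm.2.1 i.castSucc_lt_succ.le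
  · rw [rightMean, Fin.snoc_last]; exact hm.2.2

lemma leftMean_le (hm : m ∈ orderedSimplex n TA TB) (x : Fin (n + 1)) :
    leftMean TA m x ≤ m x := by
  rcases Fin.eq_zero_or_eq_succ x with rfl | ⟨i, rfl⟩
  · rw [leftMean, Fin.cons_zero]; exact hm.1
  · rw [leftMean, Fin.cons_succ]; exact hm.2.1 i.castSucc_lt_succ.le

lemma rightMean_mem (hAB : TA ≤ TB) (hm : m ∈ orderedSimplex n TA TB) (x : Fin (n + 1)) :
    TA ≤ rightMean TB m x ∧ rightMean TB m x ≤ TB := by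
  rcases Fin.eq_castSucc_or_eq_last x with ⟨i, rfl⟩ | rfl
  · rw [rightMean, Fin.snoc_castSucc]; exact orderedSimplex_bounds hm _
  · rw [rightMean, Fin.snoc_last]; exact ⟨hAB, le_rfl⟩

lemma leftMean_mem (hAB : TA ≤ TB) (hm : m ∈ orderedSimplex n TA TB) (x : Fin (n + 1)) :
    TA ≤ leftMean TA m x ∧ leftMean TA m x ≤ TB := by
  rcases Fin.eq_zero_or_eq_succ x with rfl | ⟨i, rfl⟩
  · rw [leftMean, Fin.cons_zero]; exact ⟨le_rfl, hAB⟩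
  · rw [leftMean, Fin.cons_succ]; exact orderedSimplex_bounds hm _

/-- The range of the jumps of `m x` is exactly the fibre of the simplex through `m`; hence the
domain of the pairs `(m, t)` is invariant under the swap. -/
lemma update_mem_orderedSimplex_iff (hm : m ∈ orderedSimplex n TA TB) (x : Fin (n + 1)) (t : ℝ) :
    Function.update m x t ∈ orderedSimplex n TA TB ↔
      t ∈ Icc (leftMean TA m x) (rightMean TB m x) := by
  have hl : leftMean TA (Function.update m x t) x = leftMean TA m x := by
    rcases Fin.eq_zero_or_eq_succ x with rfl | ⟨i, rfl⟩
    · simp [leftMean]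
    · simp only [leftMean, Fin.cons_succ]
      rw [Function.update_of_ne i.castSucc_lt_succ.ne]
  have hr : rightMean TB (Function.update m x t) x = rightMean TB m x := by
    rcases Fin.eq_castSucc_or_eq_last x with ⟨i, rfl⟩ | rfl
    · simp only [rightMean, Fin.snoc_castSucc]
      rw [Function.update_of_ne i.castSucc_lt_succ.ne']
    · simp [rightMean]
  constructor
  · intro h
    have h1 := leftMean_le h x
    have h2 := le_rightMean h x
    rw [hl, Function.update_self] at h1
    rw [hr, Function.update_self] at h2
    exact ⟨h1, h2⟩
  · rintro ⟨h1, h2⟩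
    refine ⟨?_, Fin.monotone_iff_le_succ.2 fun i => ?_, ?_⟩
    · rcases eq_or_ne 0 x with rfl | hx
      · rw [Function.update_self]; simpa [leftMean] using h1
      · rw [Function.update_of_ne hx]; exact hm.1
    · rcases eq_or_ne i.castSucc x with rfl | hx
      · rw [Function.update_self, Function.update_of_ne i.castSucc_lt_succ.ne']
        simpa [rightMean] using h2
      · rw [Function.update_of_ne hx]
        rcases eq_or_ne i.succ x with rfl | hx'
        · rw [Function.update_self]; simpa [leftMean] using h1
        · rw [Function.update_of_ne hx']; exact hm.2.1 i.castSucc_lt_succ.le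
    · rcases eq_or_ne (Fin.last n) x with rfl | hx
      · rw [Function.update_self]; simpa [rightMean] using h2
      · rw [Function.update_of_ne hx]; exact hm.2.2

/-- Antisymmetric kernel of the jumps of the means. -/
noncomputable def meanKernel (z : Fin (n + 1) → ℝ) (x : Fin (n + 1))
    (p : (Fin (n + 1) → ℝ) × ℝ) : ℝ :=
  (prodExpDensity (Function.update p.1 x p.2) z - prodExpDensity p.1 z) / |p.2 - p.1 x|

lemma meanKernel_swapCoord (z : Fin (n + 1) → ℝ) (x : Fin (n + 1))
    (p : (Fin (n + 1) → ℝ) × ℝ) : meanKernel z x (swapCoord x p) = -meanKernel z x p := by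
  simp only [meanKernel, swapCoord, Function.update_idem, Function.update_eq_self,
    Function.update_self]
  rw [abs_sub_comm, ← neg_div, neg_sub]

/-- The two exchange intervals abut at `m x`. The reversed orientation of the left one changes `t -
m x` into `|t - m x|`, which makes the kernel antisymmetric under the swap. -/
lemma exchange_add_exchange (hA : 0 < TA) (hAB : TA ≤ TB) (hm : m ∈ orderedSimplex n TA TB)
    (hz : 0 ≤ z) (x : Fin (n + 1)) :
    exchange m z x (rightMean TB m x) + exchange m z x (leftMean TA m x) =
      ∫ t in Icc (leftMean TA m x) (rightMean TB m x), meanKernel z x (m, t) := by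
  have hm0 : 0 < m x := hA.trans_le (orderedSimplex_bounds hm x).1
  have hl := leftMean_le hm x
  have hr := le_rightMean hm x
  have h1 := (exchange_eq hm0 (hA.trans_le (rightMean_mem hAB hm x).1) hz).1
  have h2 := ((exchange_eq hm0 (hA.trans_le (leftMean_mem hAB hm x).1) hz).1.symm).neg
  have e1 : exchange m z x (rightMean TB m x) =
      ∫ t in m x..rightMean TB m x, meanKernel z x (m, t) := by
    refine intervalIntegral.integral_congr fun t ht => ?_
    rw [uIcc_of_le hr] at ht
    simp only [meanKernel]
    rw [abs_of_nonneg (sub_nonneg.2 ht.1)]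
  have e2 : exchange m z x (leftMean TA m x) =
      ∫ t in leftMean TA m x..m x, meanKernel z x (m, t) := by
    rw [exchange, intervalIntegral.integral_symm, ← intervalIntegral.integral_neg]
    refine intervalIntegral.integral_congr fun t ht => ?_
    rw [uIcc_of_le hl] at ht
    simp only [meanKernel]
    rw [abs_of_nonpos (sub_nonpos.2 ht.2), div_neg]
  have i1 : IntervalIntegrable (fun t => meanKernel z x (m, t)) volume (m x)
      (rightMean TB m x) := by
    refine h1.congr fun t ht => ?_
    rw [uIoc_of_le hr] at ht
    simp only [meanKernel]
    rw [abs_of_nonneg (sub_nonneg.2 ht.1.le)]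
  have i2 : IntervalIntegrable (fun t => meanKernel z x (m, t)) volume (leftMean TA m x)
      (m x) := by
    refine h2.congr fun t ht => ?_
    rw [uIoc_of_le hl] at ht
    simp only [meanKernel, Pi.neg_apply]
    rw [abs_of_nonpos (sub_nonpos.2 ht.2), div_neg]
  rw [e1, e2, add_comm, intervalIntegral.integral_add_adjacent_intervals i2 i1,
    intervalIntegral.integral_of_le (hl.trans hr), integral_Icc_eq_integral_Ioc]

/-- For means at least `TA` the density is Lipschitz in each mean, so the singularity on the
diagonal is removable and the kernel is integrable on the bounded domain of the means. -/
lemma abs_meanKernel_le (hA : 0 < TA) (hz : 0 ≤ z) (hm : ∀ x, TA ≤ m x) (x : Fin (n + 1)) {t : ℝ}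
    (ht : TA ≤ t) :
    |meanKernel z x (m, t)| ≤ (1 / TA) ^ n * ((1 + 1 / TA * z x * 2) * (1 / TA ^ 2)) := by
  have hm0 : ∀ x, 0 < m x := fun x => hA.trans_le (hm x)
  have ht0 : 0 < t := hA.trans_le ht
  have hA1 : 0 < 1 / TA := one_div_pos.2 hA
  have hzx : 0 ≤ z x := hz x
  set P := ∏ w ∈ Finset.univ.erase x, expDensity (m w) (z w) with hP
  have hexp : ∀ a b : ℝ, 0 < a → 0 ≤ b → Real.exp (-b / a) ≤ 1 := fun a b ha hb =>
    Real.exp_le_one_iff.2 (by rw [neg_div]; exact neg_nonpos.2 (div_nonneg hb ha.le))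
  have hP1 : |P| ≤ (1 / TA) ^ n := by
    rw [hP, Finset.abs_prod]
    calc _ ≤ ∏ _w ∈ Finset.univ.erase x, 1 / TA := by
          refine Finset.prod_le_prod (fun _ _ => abs_nonneg _) fun w _ => ?_
          have hzw : 0 ≤ z w := hz w
          have hmw := hm0 w
          rw [expDensity, if_pos hzw, abs_of_nonneg (by positivity)]
          exact (mul_le_of_le_one_right (by positivity) (hexp _ _ hmw hzw)).trans
            (one_div_le_one_div_of_le hA (hm w))
      _ = _ := by simp
  have h0 : prodExpDensity m z = P * (1 / m x * Real.exp (-z x / m x)) := by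
    rw [hP, ← prodExpDensity_update hz, Function.update_eq_self]
  have hmx := hm0 x
  have hd : |1 / t - 1 / m x| ≤ 1 / TA ^ 2 * |t - m x| := by
    have : 1 / t - 1 / m x = -(t - m x) * (1 / (t * m x)) := by field_simp; ring
    rw [this, abs_mul, abs_neg, mul_comm, abs_of_pos (by positivity)]
    refine mul_le_mul_of_nonneg_right (one_div_le_one_div_of_le (by positivity) ?_) (abs_nonneg _)
    rw [sq]
    exact mul_le_mul ht (hm x) hA.le ht0.le
  have h1 : |1 / t * Real.exp (-z x / t) - 1 / m x * Real.exp (-z x / m x)| ≤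
      (1 + 1 / TA * z x * 2) * (1 / TA ^ 2 * |t - m x|) := by
    have h2 := abs_exp_neg_sub_exp_neg_le (z x / t) (z x / m x)
    rw [← neg_div, ← neg_div] at h2
    have h3 : |z x / t - z x / m x| = z x * |1 / t - 1 / m x| := by
      rw [div_eq_mul_one_div, div_eq_mul_one_div (z x) (m x), ← mul_sub, abs_mul,
        abs_of_nonneg hzx]
    have e1 := hexp _ _ ht0 hzx
    have e2 := hexp _ _ hmx hzx
    have e3 := Real.exp_pos (-z x / t)
    have e4 := Real.exp_pos (-z x / m x)
    have h4 : 1 / m x ≤ 1 / TA := one_div_le_one_div_of_le hA (hm x)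
    have h5 : 1 / t * Real.exp (-z x / t) - 1 / m x * Real.exp (-z x / m x) =
        (1 / t - 1 / m x) * Real.exp (-z x / t) +
          1 / m x * (Real.exp (-z x / t) - Real.exp (-z x / m x)) := by ring
    rw [h5]
    refine (abs_add_le _ _).trans ?_
    rw [abs_mul, abs_mul, abs_of_pos e3, abs_of_pos (one_div_pos.2 hmx)]
    calc _ ≤ |1 / t - 1 / m x| * 1 + 1 / TA * (z x * |1 / t - 1 / m x| * 2) := by
          refine add_le_add (mul_le_mul_of_nonneg_left e1 (abs_nonneg _)) ?_
          refine mul_le_mul h4 (h2.trans ?_) (abs_nonneg _) hA1.le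
          rw [h3]
          exact mul_le_mul_of_nonneg_left (by linarith) (mul_nonneg hzx (abs_nonneg _))
      _ = (1 + 1 / TA * z x * 2) * |1 / t - 1 / m x| := by ring
      _ ≤ _ := by gcongr
  rw [meanKernel]
  simp only
  rw [prodExpDensity_update hz, h0, ← mul_sub, abs_div, abs_abs, abs_mul]
  rcases eq_or_ne t (m x) with h | h
  · rw [h]; simp; positivity
  · have h6 : 0 < |t - m x| := abs_pos.2 (sub_ne_zero.2 h)
    rw [div_le_iff₀ h6]
    calc _ ≤ (1 / TA) ^ n * ((1 + 1 / TA * z x * 2) * (1 / TA ^ 2 * |t - m x|)) :=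
          mul_le_mul hP1 h1 (abs_nonneg _) (by positivity)
      _ = _ := by ring

lemma measurable_meanKernel (z : Fin (n + 1) → ℝ) (x : Fin (n + 1)) :
    Measurable (meanKernel z x) := by
  have h1 : Measurable fun m : Fin (n + 1) → ℝ => prodExpDensity m z :=
    measurable_prodExpDensity.comp measurable_prodMk_right
  have h2 : Measurable fun p : (Fin (n + 1) → ℝ) × ℝ => Function.update p.1 x p.2 :=
    measurable_update'
  refine ((h1.comp h2).sub (h1.comp measurable_fst)).div ?_
  exact (measurable_snd.sub ((measurable_pi_apply x).comp measurable_fst)).abs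

/-- The uniform distribution on the ordered simplex is reversible for the jumps of the means. -/
theorem integral_exchange_eq_zero (hA : 0 < TA) (hAB : TA ≤ TB) (hz : 0 ≤ z) :
    ∫ m in orderedSimplex n TA TB,
      ∑ x, (exchange m z x (rightMean TB m x) + exchange m z x (leftMean TA m x)) = 0 := by
  set O := orderedSimplex n TA TB
  -- Pairs for which the old and the new means both lie in the simplex, a condition symmetric under
  -- the swap.
  set D : Fin (n + 1) → Set ((Fin (n + 1) → ℝ) × ℝ) := fun x =>
    {p | p.1 ∈ O ∧ Function.update p.1 x p.2 ∈ O} with hD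
  have hDm : ∀ x, MeasurableSet (D x) := fun x =>
    (measurable_fst measurableSet_orderedSimplex).inter
      (measurable_update' measurableSet_orderedSimplex)
  have hDs : ∀ x, D x ⊆ Icc (fun _ => TA) (fun _ => TB) ×ˢ Icc TA TB := by
    rintro x ⟨m, t⟩ ⟨h1, h2⟩
    have := orderedSimplex_bounds h2 x
    simp only [Function.update_self] at this
    exact ⟨orderedSimplex_subset_Icc h1, this⟩
  have hi : ∀ x, Integrable ((D x).indicator (meanKernel z x))
      ((volume : Measure (Fin (n + 1) → ℝ)).prod volume) := by
    intro x
    rw [integrable_indicator_iff (hDm x)]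
    have hfin : (volume : Measure (Fin (n + 1) → ℝ)).prod volume (D x) < ⊤ := by
      refine (measure_mono (hDs x)).trans_lt ?_
      rw [Measure.prod_prod]
      exact ENNReal.mul_lt_top isCompact_Icc.measure_lt_top isCompact_Icc.measure_lt_top
    refine Measure.integrableOn_of_bounded hfin.ne (measurable_meanKernel z x).aestronglyMeasurable
      (M := (1 / TA) ^ n * ((1 + 1 / TA * z x * 2) * (1 / TA ^ 2))) ?_
    filter_upwards [self_mem_ae_restrict (hDm x)] with p hp
    exact abs_meanKernel_le hA hz (fun w => (orderedSimplex_bounds hp.1 w).1) x (hDs x hp).2.1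
  have hz0 : ∀ x, ∫ p, (D x).indicator (meanKernel z x) p
      ∂((volume : Measure (Fin (n + 1) → ℝ)).prod volume) = 0 := by
    intro x
    refine integral_eq_zero_of_swapCoord (x := x) fun p => ?_
    have hiff : swapCoord x p ∈ D x ↔ p ∈ D x := by
      simp only [hD, swapCoord, mem_ofPred_eq, Function.update_idem, Function.update_eq_self]
      exact and_comm
    by_cases hp : p ∈ D x
    · rw [indicator_of_mem hp, indicator_of_mem (hiff.2 hp), meanKernel_swapCoord]
    · rw [indicator_of_notMem hp, indicator_of_notMem (mt hiff.1 hp), neg_zero]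
  have hslice : ∀ m x, ∫ t, (D x).indicator (meanKernel z x) (m, t) =
      O.indicator (fun m => exchange m z x (rightMean TB m x) +
        exchange m z x (leftMean TA m x)) m := by
    intro m x
    by_cases hm : m ∈ O
    · rw [indicator_of_mem hm, exchange_add_exchange hA hAB hm hz, ← integral_indicator
        measurableSet_Icc]
      congr 1
      funext t
      have : (m, t) ∈ D x ↔ t ∈ Icc (leftMean TA m x) (rightMean TB m x) := by
        rw [← update_mem_orderedSimplex_iff hm]
        exact ⟨fun h => h.2, fun h => ⟨hm, h⟩⟩
      by_cases ht : t ∈ Icc (leftMean TA m x) (rightMean TB m x)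
      · rw [indicator_of_mem ht, indicator_of_mem (this.2 ht)]
      · rw [indicator_of_notMem ht, indicator_of_notMem (mt this.1 ht)]
    · rw [indicator_of_notMem hm]
      have : ∀ t, (D x).indicator (meanKernel z x) (m, t) = 0 := fun t =>
        indicator_of_notMem (fun h => hm h.1) _
      simp [this]
  have hint : ∀ x, IntegrableOn (fun m => exchange m z x (rightMean TB m x) +
      exchange m z x (leftMean TA m x)) O := by
    intro x
    rw [← integrable_indicator_iff measurableSet_orderedSimplex]
    exact (hi x).integral_prod_left.congr (.of_forall fun m => hslice m x)
  rw [integral_finsetSum _ fun x _ => hint x]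
  refine Finset.sum_eq_zero fun x _ => ?_
  rw [← hz0 x, integral_prod _ (hi x), ← integral_indicator measurableSet_orderedSimplex]
  exact integral_congr_ae (.of_forall fun m => (hslice m x).symm)

end Simplex

/-! ### Normalization and balance of the mixture. -/

section Mixture

variable {n : ℕ} {TA TB : ℝ} {m z : Fin (n + 1) → ℝ}

lemma prodExpDensity_nonneg (hm : ∀ x, 0 < m x) (z : Fin (n + 1) → ℝ) :
    0 ≤ prodExpDensity m z := by
  refine Finset.prod_nonneg fun x _ => ?_
  have := hm x
  rw [expDensity]; split_ifs <;> positivity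

lemma integral_prodExpDensity (hm : ∀ x, 0 < m x) :
    ∫ z, prodExpDensity m z = 1 := by
  unfold prodExpDensity
  rw [integral_fintype_prod_volume_eq_prod (fun x t => expDensity (m x) t)]
  refine Finset.prod_eq_one fun x _ => ?_
  have h : (fun t => expDensity (m x) t) =
      (Ici 0).indicator fun t => 1 / m x * Real.exp (-(1 / m x) * t) := by
    funext t
    rw [expDensity, indicator_apply]
    simp only [mem_Ici]
    congr 3; ring
  rw [h, integral_indicator measurableSet_Ici, integral_Ici_eq_integral_Ioi, integral_const_mul,
    integral_exp_mul_Ioi (by have := one_div_pos.2 (hm x); linarith)]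
  have := (hm x).ne'
  simp [this]

lemma measurable_prodExpDensity_left (z : Fin (n + 1) → ℝ) :
    Measurable fun m : Fin (n + 1) → ℝ => prodExpDensity m z :=
  measurable_prodExpDensity.comp measurable_prodMk_right

lemma norm_prodExpDensity_le (hA : 0 < TA) (hm : m ∈ orderedSimplex n TA TB)
    (z : Fin (n + 1) → ℝ) :
    ‖prodExpDensity m z‖ ≤
      tameConst n TA * (Ici (0 : Fin (n + 1) → ℝ)).indicator (decay (1 / TB)) z :=
  (isTame_prodExpDensity hA (orderedSimplex_bounds hm)).norm_le_indicator z

lemma integrableOn_prodExpDensity (hA : 0 < TA) (z : Fin (n + 1) → ℝ) :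
    IntegrableOn (fun m => prodExpDensity m z) (orderedSimplex n TA TB) := by
  refine Measure.integrableOn_of_bounded volume_orderedSimplex_lt_top.ne
    (measurable_prodExpDensity_left z).aestronglyMeasurable
    (M := tameConst n TA * (Ici (0 : Fin (n + 1) → ℝ)).indicator (decay (1 / TB)) z) ?_
  filter_upwards [self_mem_ae_restrict measurableSet_orderedSimplex] with m hm
  exact norm_prodExpDensity_le hA hm z

lemma abs_average_le {F : (Fin (n + 1) → ℝ) → ℝ} (hAB : TA < TB) {c : ℝ}
    (h : ∀ m ∈ orderedSimplex n TA TB, |F m| ≤ c) :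
    |1 / (volume (orderedSimplex n TA TB)).toReal * ∫ m in orderedSimplex n TA TB, F m| ≤ c := by
  have hV : 0 < (volume (orderedSimplex n TA TB)).toReal :=
    ENNReal.toReal_pos (volume_orderedSimplex_pos hAB).ne' volume_orderedSimplex_lt_top.ne
  have := norm_setIntegral_le_of_norm_le_const (f := F) (C := c)
    (volume_orderedSimplex_lt_top (TA := TA) (TB := TB) (n := n)) h
  rw [abs_mul, abs_of_pos (one_div_pos.2 hV), one_div, inv_mul_le_iff₀ hV, mul_comm]
  exact this

lemma isTame_mixtureDensity (hA : 0 < TA) (hAB : TA < TB) :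
    IsTame (1 / TB) (tameConst n TA) (mixtureDensity n TA TB) := by
  refine ⟨?_, fun z hz => ?_, fun z hz => ?_, fun z z' hz hz' => ?_⟩
  · refine Measurable.const_mul ?_ _
    exact (StronglyMeasurable.integral_prod_right' (f := fun p : (Fin (n + 1) → ℝ) × _ =>
      prodExpDensity p.2 p.1) (measurable_prodExpDensity.comp
        measurable_swap).stronglyMeasurable).measurable
  · simp [mixtureDensity, prodExpDensity_eq_zero _ hz]
  · exact abs_average_le hAB fun m hm =>
      (isTame_prodExpDensity hA (orderedSimplex_bounds hm)).abs_le z hz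
  · rw [mixtureDensity, mixtureDensity, ← mul_sub,
      ← integral_sub (integrableOn_prodExpDensity hA z) (integrableOn_prodExpDensity hA z')]
    exact abs_average_le hAB fun m hm =>
      (isTame_prodExpDensity hA (orderedSimplex_bounds hm)).abs_sub_le z z' hz hz'

lemma balanceKernel_mixtureDensity (hA : 0 < TA) (τ : ℝ) (v z : Fin (n + 1) → ℝ) (α : ℝ) :
    balanceKernel τ v (mixtureDensity n TA TB) z α =
      1 / (volume (orderedSimplex n TA TB)).toReal *
        ∫ m in orderedSimplex n TA TB, balanceKernel τ v (prodExpDensity m) z α := by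
  classical
  have h1 := integrableOn_prodExpDensity (TB := TB) hA (z + α • v)
  have h2 := integrableOn_prodExpDensity (TB := TB) hA z
  unfold balanceKernel mixtureDensity
  split_ifs
  · rw [integral_const_mul, integral_sub h1 h2]; ring
  · simp only [sub_zero]
    rw [integral_const_mul]; ring

lemma integrable_balanceKernel_prodExpDensity (hA : 0 < TA) (hAB : TA ≤ TB) (hz : ∀ x, 0 < z x)
    {τ : ℝ} {v : Fin (n + 1) → ℝ} (hv : IsJump (1 / TB) τ v) :
    Integrable (fun p : (Fin (n + 1) → ℝ) × ℝ => balanceKernel τ v (prodExpDensity p.1) z p.2)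
      ((volume.restrict (orderedSimplex n TA TB)).prod (volume.restrict (Ioi 0))) := by
  classical
  have hβ : 0 < 1 / TB := one_div_pos.2 (hA.trans_le hAB)
  obtain ⟨i, hi⟩ := Finite.exists_min z
  have hfin : IsFiniteMeasure ((volume : Measure (Fin (n + 1) → ℝ)).restrict
      (orderedSimplex n TA TB)) := ⟨by simpa using volume_orderedSimplex_lt_top⟩
  have hm : Measurable fun p : (Fin (n + 1) → ℝ) × ℝ =>
      balanceKernel τ v (prodExpDensity p.1) z p.2 := by
    unfold balanceKernel
    refine Measurable.mul (by fun_prop) (Measurable.sub ?_ ?_)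
    · exact measurable_prodExpDensity.comp (f := fun p : (Fin (n + 1) → ℝ) × ℝ =>
        (p.1, z + p.2 • v)) (by fun_prop)
    · exact Measurable.ite (measurableSet_le measurable_const (by fun_prop))
        ((measurable_prodExpDensity_left z).comp measurable_fst) measurable_const
  refine (((integrableOn_balanceBound hβ (z i) z).const_mul
    (tameConst n TA)).comp_snd _).mono' hm.aestronglyMeasurable ?_
  have h1 : ∀ᵐ p ∂(volume.restrict (orderedSimplex n TA TB)).prod (volume.restrict (Ioi (0 : ℝ))),
      p.1 ∈ orderedSimplex n TA TB :=
    Measure.quasiMeasurePreserving_fst.ae (self_mem_ae_restrict measurableSet_orderedSimplex)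
  filter_upwards [h1, ae_snd_pos] with p hp hα
  exact (isTame_prodExpDensity hA (orderedSimplex_bounds hp)).abs_balanceKernel_le_balanceBound hv
    (hz i) hi hα

/-- The balance is linear in the density, so Fubini moves the average over the means outside and
reversibility applies. For `TA = TB` the simplex is null, the mixture is `0` and the identity
carries no information; that case needs the next theorem. -/
theorem sum_balance_mixtureDensity (hA : 0 < TA) (hAB : TA ≤ TB) (hz : ∀ x, 0 < z x) :
    ∑ j : JumpIndex n, ∫ α in Ioi 0,
      balanceKernel (jumpRate TA TB j) (jumpDir j) (mixtureDensity n TA TB) z α = 0 := by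
  have hi := fun j : JumpIndex n =>
    integrable_balanceKernel_prodExpDensity hA hAB hz (isJump_jumpDir hA hAB j)
  have h1 : ∀ j : JumpIndex n, ∫ α in Ioi 0,
      balanceKernel (jumpRate TA TB j) (jumpDir j) (mixtureDensity n TA TB) z α =
      1 / (volume (orderedSimplex n TA TB)).toReal * ∫ m in orderedSimplex n TA TB,
        ∫ α in Ioi 0, balanceKernel (jumpRate TA TB j) (jumpDir j) (prodExpDensity m) z α := by
    intro j
    simp_rw [balanceKernel_mixtureDensity hA]
    rw [integral_const_mul, ← integral_integral_swap (hi j)]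
  simp_rw [h1]
  rw [← Finset.mul_sum, ← integral_finsetSum _ fun j _ => (hi j).integral_prod_left,
    setIntegral_congr_fun measurableSet_orderedSimplex fun m hm =>
      sum_balance_prodExpDensity hA hAB (orderedSimplex_bounds hm) hz,
    integral_exchange_eq_zero hA hAB fun x => (hz x).le, mul_zero]

/-- At equal temperatures every neighbouring mean equals the mean itself, so each exchange is an
integral over a degenerate interval. -/
theorem sum_balance_prodExpDensity_const (hA : 0 < TA) (hz : ∀ x, 0 < z x) :
    ∑ j : JumpIndex n, ∫ α in Ioi 0,
      balanceKernel (jumpRate TA TA j) (jumpDir j) (prodExpDensity fun _ => TA) z α = 0 := by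
  have hO : (fun _ => TA) ∈ orderedSimplex n TA TA := ⟨le_rfl, monotone_const, le_rfl⟩
  rw [sum_balance_prodExpDensity hA le_rfl (orderedSimplex_bounds hO) hz]
  refine Finset.sum_eq_zero fun x _ => ?_
  have h1 := rightMean_mem le_rfl hO x
  have h2 := leftMean_mem le_rfl hO x
  rw [le_antisymm h1.2 h1.1, le_antisymm h2.2 h2.1]
  simp [exchange]

lemma integral_mixtureDensity (hA : 0 < TA) (hAB : TA < TB) :
    ∫ z, mixtureDensity n TA TB z = 1 := by
  have hV : 0 < (volume (orderedSimplex n TA TB)).toReal :=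
    ENNReal.toReal_pos (volume_orderedSimplex_pos hAB).ne' volume_orderedSimplex_lt_top.ne
  have hfin : IsFiniteMeasure ((volume : Measure (Fin (n + 1) → ℝ)).restrict
      (orderedSimplex n TA TB)) := ⟨by simpa using volume_orderedSimplex_lt_top⟩
  have hβ : 0 < 1 / TB := one_div_pos.2 (hA.trans hAB)
  have hi : Integrable (fun p : (Fin (n + 1) → ℝ) × (Fin (n + 1) → ℝ) => prodExpDensity p.1 p.2)
      ((volume.restrict (orderedSimplex n TA TB)).prod volume) := by
    refine (((integrable_decay hβ).const_mul (tameConst n TA)).comp_snd _).mono'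
      measurable_prodExpDensity.aestronglyMeasurable ?_
    have h1 : ∀ᵐ p ∂(volume.restrict (orderedSimplex n TA TB)).prod
        (volume : Measure (Fin (n + 1) → ℝ)), p.1 ∈ orderedSimplex n TA TB :=
      Measure.quasiMeasurePreserving_fst.ae (self_mem_ae_restrict measurableSet_orderedSimplex)
    filter_upwards [h1] with p hp
    exact norm_prodExpDensity_le hA hp p.2
  unfold mixtureDensity
  rw [integral_const_mul, ← integral_integral_swap hi,
    setIntegral_congr_fun (g := fun _ => (1 : ℝ)) measurableSet_orderedSimplex fun m hm =>
      integral_prodExpDensity fun x => hA.trans_le (orderedSimplex_bounds hm x).1]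
  rw [setIntegral_const, smul_eq_mul, mul_one, Measure.real, one_div_mul_cancel hV.ne']

lemma mixtureDensity_nonneg (hA : 0 < TA) (z : Fin (n + 1) → ℝ) :
    0 ≤ mixtureDensity n TA TB z :=
  mul_nonneg (by positivity) (setIntegral_nonneg measurableSet_orderedSimplex fun _ hm =>
    prodExpDensity_nonneg (fun x => hA.trans_le (orderedSimplex_bounds hm x).1) z)

end Mixture

/-! ### Cutoffs for test functions without compact support. -/

section Cutoff

variable {ι : Type*} [Fintype ι]

/-- Piecewise linear cutoff: `1` where `∑ z_i ≤ R`, `0` where `∑ z_i ≥ 2 R`. -/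
noncomputable def cutoff (R : ℝ) (z : ι → ℝ) : ℝ := max 0 (min 1 (2 - (∑ i, z i) / R))

lemma cutoff_nonneg (R : ℝ) (z : ι → ℝ) : 0 ≤ cutoff R z := le_max_left _ _

lemma cutoff_le_one (R : ℝ) (z : ι → ℝ) : cutoff R z ≤ 1 :=
  max_le zero_le_one (min_le_left _ _)

lemma abs_cutoff_sub_le {R : ℝ} (hR : 0 < R) (z z' : ι → ℝ) :
    |cutoff R z - cutoff R z'| ≤ 1 / R * ∑ i, |z i - z' i| := by
  unfold cutoff
  refine (abs_max_sub_max_le_max _ _ _ _).trans ?_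
  rw [sub_self, abs_zero, max_eq_right (abs_nonneg _)]
  refine (abs_min_sub_min_le_max _ _ _ _).trans ?_
  rw [sub_self, abs_zero, max_eq_right (abs_nonneg _)]
  have : 2 - (∑ i, z i) / R - (2 - (∑ i, z' i) / R) = -(1 / R * ∑ i, (z i - z' i)) := by
    rw [Finset.sum_sub_distrib]; ring
  rw [this, abs_neg, abs_mul, abs_of_pos (one_div_pos.2 hR)]
  exact mul_le_mul_of_nonneg_left (Finset.abs_sum_le_sum_abs _ _) (one_div_pos.2 hR).le

lemma cutoff_eq_one {R : ℝ} (hR : 0 < R) {z : ι → ℝ} (hz : ∑ i, z i ≤ R) : cutoff R z = 1 := by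
  have : (∑ i, z i) / R ≤ 1 := (div_le_one hR).2 hz
  rw [cutoff, min_eq_left (by linarith), max_eq_right zero_le_one]

lemma cutoff_eq_zero {R : ℝ} (hR : 0 < R) {z : ι → ℝ} (hz : 2 * R ≤ ∑ i, z i) :
    cutoff R z = 0 := by
  have : 2 ≤ (∑ i, z i) / R := (le_div_iff₀ hR).2 hz
  exact max_eq_left ((min_le_right _ _).trans (by linarith))

lemma measurable_cutoff (R : ℝ) : Measurable (cutoff R : (ι → ℝ) → ℝ) := by
  unfold cutoff; fun_prop

/-- Measurable bounded functions, supported by the orthant and Lipschitz on its bounded subsets. -/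
structure IsLocallyLipschitz (M : ℝ) (f : (ι → ℝ) → ℝ) : Prop where
  measurable : Measurable f
  eq_zero : ∀ z, ¬ 0 ≤ z → f z = 0
  abs_le : ∀ z, |f z| ≤ M
  lipschitz : ∀ R : ℝ, ∃ K : ℝ, 0 ≤ K ∧ ∀ z z', 0 ≤ z → 0 ≤ z' → ∑ i, z i ≤ R → ∑ i, z' i ≤ R →
    |f z - f z'| ≤ K * ∑ i, |z i - z' i|

variable {M β τ C : ℝ} {f μ : (ι → ℝ) → ℝ} {v : ι → ℝ}

lemma IsLocallyLipschitz.bound_nonneg (hf : IsLocallyLipschitz M f) : 0 ≤ M :=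
  (abs_nonneg _).trans (hf.abs_le 0)

lemma IsLocallyLipschitz.mul_cutoff (hf : IsLocallyLipschitz M f) {R : ℝ} (hR : 0 < R) :
    ∃ K : ℝ, 0 ≤ K ∧ ∀ z z', 0 ≤ z → 0 ≤ z' →
      |f z * cutoff R z - f z' * cutoff R z'| ≤ K * ∑ i, |z i - z' i| := by
  obtain ⟨K, hK, h⟩ := hf.lipschitz (2 * R)
  have hM := hf.bound_nonneg
  have hR' : 0 ≤ M * (1 / R) := by positivity
  refine ⟨K + M * (1 / R), by positivity, fun z z' hz hz' => ?_⟩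
  have hc := abs_cutoff_sub_le hR z z'
  have hs : 0 ≤ ∑ i, |z i - z' i| := Finset.sum_nonneg fun _ _ => abs_nonneg _
  -- If one of the two points lies beyond `2 * R`, its cutoff vanishes and this term alone is the
  -- whole difference, so no Lipschitz bound for `f` out there is needed.
  have hfc : ∀ w : ι → ℝ, |f w| * |cutoff R z - cutoff R z'| ≤
      (K + M * (1 / R)) * ∑ i, |z i - z' i| := fun w => by
    calc _ ≤ M * (1 / R * ∑ i, |z i - z' i|) :=
          mul_le_mul (hf.abs_le w) hc (abs_nonneg _) hM
      _ = M * (1 / R) * ∑ i, |z i - z' i| := by ring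
      _ ≤ _ := mul_le_mul_of_nonneg_right (by linarith) hs
  by_cases h1 : ∑ i, z i ≤ 2 * R
  · by_cases h2 : ∑ i, z' i ≤ 2 * R
    · have e : f z * cutoff R z - f z' * cutoff R z' =
          (f z - f z') * cutoff R z + f z' * (cutoff R z - cutoff R z') := by ring
      rw [e]
      refine (abs_add_le _ _).trans ?_
      rw [abs_mul, abs_mul, abs_of_nonneg (cutoff_nonneg R z), add_mul]
      refine add_le_add ((mul_le_of_le_one_right (abs_nonneg _) (cutoff_le_one R z)).trans
        (h z z' hz hz' h1 h2)) ?_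
      rw [mul_assoc]
      exact mul_le_mul (hf.abs_le _) hc (abs_nonneg _) hM
    · have := hfc z
      rw [cutoff_eq_zero hR (le_of_not_ge h2), sub_zero] at this
      rwa [cutoff_eq_zero hR (le_of_not_ge h2), mul_zero, sub_zero, abs_mul]
  · have := hfc z'
    rw [cutoff_eq_zero hR (le_of_not_ge h1), zero_sub, abs_neg] at this
    rwa [cutoff_eq_zero hR (le_of_not_ge h1), mul_zero, zero_sub, abs_neg, abs_mul]

/-- Nearby points are covered by the local constant; points with total energy larger by more than
`1` are at distance at least `1`, where the bound `2 * M` suffices. -/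
lemma IsLocallyLipschitz.exists_lipschitz_at (hf : IsLocallyLipschitz M f) {z : ι → ℝ}
    (hz : 0 ≤ z) :
    ∃ K : ℝ, 0 ≤ K ∧ ∀ z', 0 ≤ z' → |f z' - f z| ≤ K * ∑ i, |z' i - z i| := by
  obtain ⟨K, hK, h⟩ := hf.lipschitz (∑ i, z i + 1)
  have hM := hf.bound_nonneg
  refine ⟨K + 2 * M, by positivity, fun z' hz' => ?_⟩
  have hs : 0 ≤ ∑ i, |z' i - z i| := Finset.sum_nonneg fun _ _ => abs_nonneg _
  by_cases h1 : ∑ i, z' i ≤ ∑ i, z i + 1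
  · refine (h z' z hz' hz h1 (by linarith)).trans (mul_le_mul_of_nonneg_right (by linarith) hs)
  · have h2 : 1 ≤ ∑ i, |z' i - z i| := by
      have h3 := Finset.sum_le_sum fun i (_ : i ∈ Finset.univ) => le_abs_self (z' i - z i)
      rw [Finset.sum_sub_distrib] at h3
      linarith
    have h4 := abs_sub (f z') (f z)
    have h5 := hf.abs_le z'
    have h6 := hf.abs_le z
    nlinarith [mul_nonneg hK hs]

lemma integrableOn_exp_add_indicator (hβ : 0 < β) (S : ℝ) :
    IntegrableOn (fun α => Real.exp (-(β * α)) + (Ioc 0 S).indicator 1 α) (Ioi 0) := by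
  have h1 : IntegrableOn ((Ioc 0 S).indicator (1 : ℝ → ℝ)) (Ioi 0) := by
    refine Integrable.integrableOn ?_
    rw [integrable_indicator_iff measurableSet_Ioc]
    exact integrableOn_const (by simp)
  have h2 : IntegrableOn (fun α => Real.exp (-(β * α))) (Ioi 0) := by
    simpa using integrableOn_exp_mul_Ioi (neg_lt_zero.2 hβ) 0
  exact h2.add h1

lemma integral_exp_add_indicator (hβ : 0 < β) {S : ℝ} (hS : 0 ≤ S) :
    ∫ α in Ioi 0, (Real.exp (-(β * α)) + (Ioc 0 S).indicator 1 α) = 1 / β + S := by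
  have h1 : IntegrableOn ((Ioc 0 S).indicator (1 : ℝ → ℝ)) (Ioi 0) := by
    refine Integrable.integrableOn ?_
    rw [integrable_indicator_iff measurableSet_Ioc]
    exact integrableOn_const (by simp)
  have h2 : IntegrableOn (fun α => Real.exp (-(β * α))) (Ioi 0) := by
    simpa using integrableOn_exp_mul_Ioi (neg_lt_zero.2 hβ) 0
  rw [integral_add h2 h1, setIntegral_indicator measurableSet_Ioc,
    inter_eq_right.2 Ioc_subset_Ioi_self]
  congr 1
  · have := integral_exp_mul_Ioi (neg_lt_zero.2 hβ) 0
    simpa using this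
  · simp [hS]

lemma IsJump.integrableOn_jumpKernel (hv : IsJump β τ v) (hβ : 0 < β) {F : (ι → ℝ) → ℝ}
    (hF : Measurable F) {z : ι → ℝ} (hz : 0 ≤ z) {K : ℝ} (hK : 0 ≤ K)
    (h : ∀ z', 0 ≤ z' → |F z' - F z| ≤ K * ∑ i, |z' i - z i|) :
    IntegrableOn (jumpKernel τ v F z) (Ioi 0) := by
  refine ((integrableOn_exp_add_indicator hβ (∑ i, z i)).const_mul
    (K * Fintype.card ι)).mono'
    ((measurable_jumpKernel hF).comp measurable_prodMk_left).aestronglyMeasurable ?_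
  filter_upwards [self_mem_ae_restrict measurableSet_Ioi] with α hα
  exact hv.abs_jumpKernel_le hz hα hK fun hm => h _ hm

/-- The generator of a jump almost commutes with the cutoff. -/
lemma IsLocallyLipschitz.abs_integral_jumpKernel_cutoff_le (hf : IsLocallyLipschitz M f)
    (hβ : 0 < β) (hv : IsJump β τ v) {R : ℝ} (hR : 0 < R) {z : ι → ℝ} (hz : 0 ≤ z) :
    |cutoff R z * (∫ α in Ioi 0, jumpKernel τ v f z α) -
      ∫ α in Ioi 0, jumpKernel τ v (f * cutoff R) z α| ≤
      M * (1 / R * Fintype.card ι) * (1 / β + ∑ i, z i) := by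
  have hM := hf.bound_nonneg
  obtain ⟨K, hK, h1⟩ := hf.exists_lipschitz_at hz
  obtain ⟨K', hK', h2⟩ := hf.mul_cutoff hR
  have i1 := hv.integrableOn_jumpKernel hβ hf.measurable hz hK h1
  have i2 := hv.integrableOn_jumpKernel hβ (hf.measurable.mul (measurable_cutoff R)) hz hK'
    fun z' hz' => h2 z' z hz' hz
  have hS : 0 ≤ ∑ i, z i := Finset.sum_nonneg fun i _ => hz i
  rw [← integral_const_mul, ← integral_sub (i1.const_mul _) i2,
    ← integral_exp_add_indicator hβ hS, ← integral_const_mul]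
  rw [← Real.norm_eq_abs]
  refine norm_integral_le_of_norm_le ((integrableOn_exp_add_indicator hβ _).const_mul _) ?_
  filter_upwards [self_mem_ae_restrict measurableSet_Ioi] with α hα
  -- Product rule: the commutator only sees the increment of the cutoff, which is Lipschitz with
  -- constant `1 / R`.
  have key : cutoff R z * jumpKernel τ v f z α -
      jumpKernel τ v (f * cutoff R) z α =
      -(f (z - α • v) * jumpKernel τ v (cutoff R) z α) := by
    simp only [jumpKernel, Pi.mul_apply]
    split_ifs <;> ring
  rw [key, norm_neg, norm_mul, mul_assoc]
  refine mul_le_mul (hf.abs_le _) ?_ (norm_nonneg _) hM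
  exact hv.abs_jumpKernel_le hz hα (one_div_pos.2 hR).le fun _ => abs_cutoff_sub_le hR _ _

end Cutoff

/-! ### Invariance of tame stationary densities. -/

section Invariance

variable {n : ℕ} {TA TB C M : ℝ} {μ f : (Fin (n + 1) → ℝ) → ℝ}

lemma ae_ne_zero : ∀ᵐ z : Fin (n + 1) → ℝ, ∀ x, z x ≠ 0 := by
  rw [ae_all_iff]
  intro x
  have h : ∀ᵐ t : ℝ, t ≠ 0 := by simp [ae_iff]
  exact (Measure.quasiMeasurePreserving_eval (fun _ : Fin (n + 1) => (volume : Measure ℝ)) x).ae h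

/-- Adjointness moves the generator onto `μ`. The balance vanishes at positive configurations, `f`
vanishes off the orthant, and the faces are Lebesgue-null. -/
lemma IsTame.integral_mul_sum_jumpKernel_of_lipschitz (hA : 0 < TA) (hAB : TA ≤ TB)
    (hμ : IsTame (1 / TB) C μ)
    (h : ∀ z : Fin (n + 1) → ℝ, (∀ x, 0 < z x) →
      ∑ j : JumpIndex n, ∫ α in Ioi 0, balanceKernel (jumpRate TA TB j) (jumpDir j) μ z α = 0)
    {K : ℝ} (hF : Measurable f) (hF0 : ∀ z, ¬ 0 ≤ z → f z = 0) (hFM : ∀ z, |f z| ≤ M)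
    (hK : 0 ≤ K) (hFK : ∀ z z', 0 ≤ z → 0 ≤ z' → |f z - f z'| ≤ K * ∑ i, |z i - z' i|) :
    Integrable (fun z => μ z *
      ∑ j : JumpIndex n, ∫ α in Ioi 0, jumpKernel (jumpRate TA TB j) (jumpDir j) f z α) ∧
    ∫ z, μ z * ∑ j : JumpIndex n, ∫ α in Ioi 0,
      jumpKernel (jumpRate TA TB j) (jumpDir j) f z α = 0 := by
  have hβ : 0 < 1 / TB := one_div_pos.2 (hA.trans_le hAB)
  have hj := fun j : JumpIndex n => hμ.integral_mul_integral_jumpKernel hβ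
    (isJump_jumpDir hA hAB j) hF hF0 hFM hK hFK
  simp_rw [Finset.mul_sum]
  refine ⟨integrable_finsetSum _ fun j _ => (hj j).1, ?_⟩
  rw [integral_finsetSum _ fun j _ => (hj j).1, Finset.sum_congr rfl fun j _ => (hj j).2.2,
    ← integral_finsetSum _ fun j _ => (hj j).2.1]
  simp_rw [← Finset.mul_sum]
  refine integral_eq_zero_of_ae ?_
  filter_upwards [ae_ne_zero] with z hz
  by_cases hz0 : 0 ≤ z
  · rw [h z fun x => lt_of_le_of_ne (hz0 x) (hz x).symm]; simp
  · simp [hF0 z hz0]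

/-- A tame function with vanishing jump balances annihilates the range of the generator. -/
theorem IsTame.integral_mul_sum_jumpKernel (hA : 0 < TA) (hAB : TA ≤ TB)
    (hμ : IsTame (1 / TB) C μ)
    (h : ∀ z : Fin (n + 1) → ℝ, (∀ x, 0 < z x) →
      ∑ j : JumpIndex n, ∫ α in Ioi 0, balanceKernel (jumpRate TA TB j) (jumpDir j) μ z α = 0)
    (hf : IsLocallyLipschitz M f)
    (hi : Integrable (fun z => μ z *
      ∑ j : JumpIndex n, ∫ α in Ioi 0, jumpKernel (jumpRate TA TB j) (jumpDir j) f z α)) :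
    ∫ z, μ z * ∑ j : JumpIndex n, ∫ α in Ioi 0,
      jumpKernel (jumpRate TA TB j) (jumpDir j) f z α = 0 := by
  have hβ : 0 < 1 / TB := one_div_pos.2 (hA.trans_le hAB)
  have hM := hf.bound_nonneg
  set L : ((Fin (n + 1) → ℝ) → ℝ) → (Fin (n + 1) → ℝ) → ℝ := fun f z =>
    ∑ j : JumpIndex n, ∫ α in Ioi 0, jumpKernel (jumpRate TA TB j) (jumpDir j) f z α with hL
  -- Dominates `μ` times the linear growth `1 / β + ∑ z i` of the commutator, with `β = 1 / TB`.
  set B : (Fin (n + 1) → ℝ) → ℝ := fun z => C *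
    ((1 / (1 / TB)) * (Ici (0 : Fin (n + 1) → ℝ)).indicator (decay (1 / TB)) z +
      (Ici (0 : Fin (n + 1) → ℝ)).indicator (decay (1 / TB)) z * max (∑ i, z i) 0) with hB
  have hBi : Integrable B :=
    (((integrable_decay hβ).const_mul _).add (integrable_decay_mul_sum hβ)).const_mul _
  set c : ℝ := Fintype.card (JumpIndex n) * (M * Fintype.card (Fin (n + 1))) with hc
  have hest : ∀ R : ℝ, 0 < R →
      |∫ z, μ z * L f z * cutoff R z| ≤ c / R * ∫ z, B z := by
    intro R hR
    obtain ⟨K, hK, hFK⟩ := hf.mul_cutoff hR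
    have hFM : ∀ z, |f z * cutoff R z| ≤ M := fun z => by
      rw [abs_mul, abs_of_nonneg (cutoff_nonneg R z)]
      exact (mul_le_of_le_one_right (abs_nonneg _) (cutoff_le_one R z)).trans (hf.abs_le z)
    obtain ⟨h1, h2⟩ := hμ.integral_mul_sum_jumpKernel_of_lipschitz hA hAB h
      (hf.measurable.mul (measurable_cutoff R))
      (fun z hz => by rw [Pi.mul_apply, hf.eq_zero z hz, zero_mul]) hFM hK hFK
    have h3 : Integrable fun z => μ z * L f z * cutoff R z :=
      hi.mul_bdd (c := 1) (measurable_cutoff R).aestronglyMeasurable (.of_forall fun z => by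
        rw [Real.norm_of_nonneg (cutoff_nonneg R z)]; exact cutoff_le_one R z)
    -- The integral subtracted here vanishes by the Lipschitz case, leaving a commutator of order `1
    -- / R`.
    have h4 : ∫ z, μ z * L f z * cutoff R z =
        ∫ z, (μ z * L f z * cutoff R z - μ z * L (f * cutoff R) z) := by
      rw [integral_sub h3 h1, h2, sub_zero]
    rw [h4, ← integral_const_mul, ← Real.norm_eq_abs]
    refine norm_integral_le_of_norm_le (hBi.const_mul _) (.of_forall fun z => ?_)
    by_cases hz : 0 ≤ z
    · have hS : 0 ≤ ∑ i, z i := Finset.sum_nonneg fun i _ => hz i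
      have h5 : |cutoff R z * L f z - L (f * cutoff R) z| ≤
          c / R * (1 / (1 / TB) + ∑ i, z i) := by
        rw [hL]
        simp only
        rw [Finset.mul_sum, ← Finset.sum_sub_distrib]
        refine (Finset.abs_sum_le_sum_abs _ _).trans ((Finset.sum_le_sum fun j _ =>
          hf.abs_integral_jumpKernel_cutoff_le hβ (isJump_jumpDir hA hAB j) hR hz).trans
            (le_of_eq ?_))
        rw [Finset.sum_const, nsmul_eq_mul, Finset.card_univ, hc]
        ring
      have h6 : μ z * L f z * cutoff R z - μ z * L (f * cutoff R) z =
          μ z * (cutoff R z * L f z - L (f * cutoff R) z) := by ring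
      rw [h6, norm_mul]
      calc _ ≤ C * decay (1 / TB) z * (c / R * (1 / (1 / TB) + ∑ i, z i)) :=
            mul_le_mul (hμ.abs_le z hz) h5 (abs_nonneg _)
              (mul_nonneg hμ.const_nonneg (decay_pos _ _).le)
        _ = _ := by
            rw [hB]
            simp only
            rw [indicator_of_mem (show z ∈ Ici 0 from hz), max_eq_left hS]
            ring
    · rw [hμ.eq_zero z hz, hB]
      simp only
      rw [indicator_of_notMem (show z ∉ Ici 0 from hz)]
      simp
  have hlim1 : Filter.Tendsto (fun k : ℕ => ∫ z, μ z * L f z * cutoff ((k : ℝ) + 1) z)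
      Filter.atTop (nhds (∫ z, μ z * L f z)) := by
    refine tendsto_integral_of_dominated_convergence (fun z => ‖μ z * L f z‖) (fun k => ?_)
      hi.norm (fun k => .of_forall fun z => ?_) (.of_forall fun z => ?_)
    · exact hi.aestronglyMeasurable.mul (measurable_cutoff _).aestronglyMeasurable
    · rw [norm_mul, Real.norm_of_nonneg (cutoff_nonneg _ z)]
      exact mul_le_of_le_one_right (norm_nonneg _) (cutoff_le_one _ z)
    · refine tendsto_const_nhds.congr' ?_
      filter_upwards [Filter.eventually_ge_atTop ⌈∑ i, z i⌉₊] with k hk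
      rw [cutoff_eq_one (by positivity) ?_, mul_one]
      exact (Nat.le_ceil _).trans ((Nat.cast_le.2 hk).trans (by linarith))
  have hlim2 : Filter.Tendsto (fun k : ℕ => ∫ z, μ z * L f z * cutoff ((k : ℝ) + 1) z)
      Filter.atTop (nhds 0) := by
    refine squeeze_zero_norm (a := fun k : ℕ => (c * ∫ z, B z) * (1 / ((k : ℝ) + 1)))
      (fun k => ?_) ?_
    · refine (hest _ (by positivity)).trans (le_of_eq (by ring))
    · simpa using tendsto_one_div_add_atTop_nhds_zero_nat.const_mul (c * ∫ z, B z)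
  exact tendsto_nhds_unique hlim1 hlim2

/-- A `C¹` function is Lipschitz on each compact convex truncation of the orthant. The indicator
removes the arbitrary values of `f` outside, which the generator never sees from the orthant. -/
lemma IsTestFunction.isLocallyLipschitz (hf : IsTestFunction f) :
    ∃ M, IsLocallyLipschitz M ((Ici 0).indicator f) := by
  obtain ⟨M, hM⟩ := hf.bounded
  have hcont : ContinuousOn f (Ici 0) := hf.contDiffOn.continuousOn
  refine ⟨M, ?_, fun z hz => indicator_of_notMem (by exact hz) _, fun z => ?_, fun R => ?_⟩
  · classical
    rw [← piecewise_eq_indicator]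
    exact hcont.measurable_piecewise continuousOn_const measurableSet_Ici
  · by_cases hz : z ∈ Ici 0
    · rw [indicator_of_mem hz]; exact hM z hz
    · rw [indicator_of_notMem hz, abs_zero]
      exact (abs_nonneg _).trans (hM 0 le_rfl)
  · set S : Set (Fin (n + 1) → ℝ) := Ici 0 ∩ {z | ∑ i, z i ≤ R} with hS
    have hconv : Convex ℝ S := by
      refine (convex_Ici 0).inter ?_
      have : IsLinearMap ℝ fun z : Fin (n + 1) → ℝ => ∑ i, z i :=
        ⟨fun x y => by simp [Finset.sum_add_distrib], fun c x => by simp [Finset.mul_sum]⟩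
      exact convex_halfSpace_le this R
    have hclosed : IsClosed S := isClosed_Ici.inter
      (isClosed_le (continuous_finsetSum _ fun i _ => continuous_apply i) continuous_const)
    have hcomp : IsCompact S := by
      refine (isCompact_Icc (a := (0 : Fin (n + 1) → ℝ)) (b := fun _ => R)).of_isClosed_subset
        hclosed ?_
      rintro z ⟨hz, hzR⟩
      exact ⟨hz, fun i => (le_sum_of_nonneg hz i).trans hzR⟩
    obtain ⟨K, hK⟩ := (hf.contDiffOn.mono (s := {z | 0 ≤ z}) (t := S)
      (fun z hz => hz.1)).exists_lipschitzOnWith one_ne_zero hconv hcomp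
    refine ⟨K, K.2, fun z z' hz hz' h1 h2 => ?_⟩
    rw [indicator_of_mem (show z ∈ Ici 0 from hz), indicator_of_mem (show z' ∈ Ici 0 from hz')]
    have h3 := hK.dist_le_mul z ⟨hz, h1⟩ z' ⟨hz', h2⟩
    rw [Real.dist_eq] at h3
    refine h3.trans (mul_le_mul_of_nonneg_left ?_ K.2)
    refine (dist_pi_le_iff (Finset.sum_nonneg fun _ _ => abs_nonneg _)).2 fun i => ?_
    rw [Real.dist_eq]
    exact Finset.single_le_sum (f := fun i => |z i - z' i|) (fun _ _ => abs_nonneg _)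
      (Finset.mem_univ i)

lemma jumpKernel_indicator {τ : ℝ} {v z : Fin (n + 1) → ℝ} (hz : 0 ≤ z) (α : ℝ) :
    jumpKernel τ v ((Ici 0).indicator f) z α = jumpKernel τ v f z α := by
  unfold jumpKernel
  split_ifs with h
  · rw [indicator_of_mem (show z ∈ Ici 0 from hz),
      indicator_of_mem (show z - α • v ∈ Ici 0 from h)]
  · rfl

/-- A tame probability density with vanishing jump balances defines an invariant measure. -/
theorem IsTame.isInvariantMeasure (hA : 0 < TA) (hAB : TA ≤ TB)
    (hμ : IsTame (1 / TB) C μ) (hμ0 : ∀ z, 0 ≤ μ z) (hμ1 : ∫ z, μ z = 1)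
    (h : ∀ z : Fin (n + 1) → ℝ, (∀ x, 0 < z x) →
      ∑ j : JumpIndex n, ∫ α in Ioi 0, balanceKernel (jumpRate TA TB j) (jumpDir j) μ z α = 0) :
    IsInvariantMeasure n TA TB (volume.withDensity fun z => ENNReal.ofReal (μ z)) := by
  have hβ : 0 < 1 / TB := one_div_pos.2 (hA.trans_le hAB)
  have hm : Measurable fun z => ENNReal.ofReal (μ z) := hμ.measurable.ennreal_ofReal
  have hlt : ∀ᵐ z, ENNReal.ofReal (μ z) < ⊤ := .of_forall fun _ => ENNReal.ofReal_lt_top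
  refine ⟨⟨?_⟩, ?_, fun f hf hi => ?_⟩
  · rw [withDensity_apply _ MeasurableSet.univ, Measure.restrict_univ,
      ← ofReal_integral_eq_lintegral_ofReal (hμ.integrable hβ) (.of_forall hμ0), hμ1,
      ENNReal.ofReal_one]
  · rw [ae_withDensity_iff hm]
    refine .of_forall fun z hz => ?_
    by_contra hz0
    exact hz (by rw [hμ.eq_zero z hz0, ENNReal.ofReal_zero])
  · obtain ⟨M, hM⟩ := hf.isLocallyLipschitz
    rw [integrable_withDensity_iff_integrable_smul' hm hlt] at hi
    rw [integral_withDensity_eq_integral_toReal_smul hm hlt]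
    have key : ∀ z, (ENNReal.ofReal (μ z)).toReal • generator n TA TB f z = μ z *
        ∑ j : JumpIndex n, ∫ α in Ioi 0,
          jumpKernel (jumpRate TA TB j) (jumpDir j) ((Ici 0).indicator f) z α := by
      intro z
      rw [ENNReal.toReal_ofReal (hμ0 z), smul_eq_mul]
      by_cases hz : 0 ≤ z
      · simp_rw [generator_eq_sum hz, jumpKernel_indicator hz]
      · rw [hμ.eq_zero z hz, zero_mul, zero_mul]
    simp_rw [key] at hi ⊢
    exact hμ.integral_mul_sum_jumpKernel hA hAB h hM hi

end Invariance

/-! ### Laplace transforms of probability measures on the orthant. -/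

section LaplaceTransform

variable {ι : Type*} [Fintype ι]

/-- Exponential test functions. -/
noncomputable def laplaceKernel (l z : ι → ℝ) : ℝ := Real.exp (-∑ i, l i * z i)

lemma laplaceKernel_pos (l z : ι → ℝ) : 0 < laplaceKernel l z := Real.exp_pos _

lemma laplaceKernel_le_one {l z : ι → ℝ} (hl : 0 ≤ l) (hz : 0 ≤ z) : laplaceKernel l z ≤ 1 :=
  Real.exp_le_one_iff.2 (neg_nonpos.2 (Finset.sum_nonneg fun i _ => mul_nonneg (hl i) (hz i)))

lemma continuous_laplaceKernel :
    Continuous fun p : (ι → ℝ) × (ι → ℝ) => laplaceKernel p.1 p.2 := by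
  unfold laplaceKernel; fun_prop

lemma laplaceKernel_add_right (l z w : ι → ℝ) :
    laplaceKernel l (z + w) = laplaceKernel l z * laplaceKernel l w := by
  simp only [laplaceKernel, ← Real.exp_add, Pi.add_apply, mul_add, Finset.sum_add_distrib, neg_add]

lemma laplaceKernel_add_left (l k z : ι → ℝ) :
    laplaceKernel (l + k) z = laplaceKernel l z * laplaceKernel k z := by
  simp only [laplaceKernel, ← Real.exp_add, Pi.add_apply, add_mul, Finset.sum_add_distrib, neg_add]

variable {ν : Measure (ι → ℝ)} [IsProbabilityMeasure ν]

lemma integrable_laplaceKernel (hν : ∀ᵐ z ∂ν, 0 ≤ z) {l : ι → ℝ} (hl : 0 ≤ l) :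
    Integrable (laplaceKernel l) ν := by
  refine (integrable_const (1 : ℝ)).mono'
    (continuous_laplaceKernel.comp (Continuous.prodMk_right l)).aestronglyMeasurable ?_
  filter_upwards [hν] with z hz
  rw [Real.norm_of_nonneg (laplaceKernel_pos l z).le]
  exact laplaceKernel_le_one hl hz

lemma continuousOn_integral_laplaceKernel (hν : ∀ᵐ z ∂ν, 0 ≤ z) :
    ContinuousOn (fun l => ∫ z, laplaceKernel l z ∂ν) (Ici 0) := by
  intro l _
  refine continuousWithinAt_of_dominated (bound := fun _ => 1) ?_ ?_ (integrable_const 1) ?_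
  · filter_upwards with l'
    exact (continuous_laplaceKernel.comp (Continuous.prodMk_right l')).aestronglyMeasurable
  · filter_upwards [self_mem_nhdsWithin] with l' hl'
    filter_upwards [hν] with z hz
    rw [Real.norm_of_nonneg (laplaceKernel_pos l' z).le]
    exact laplaceKernel_le_one hl' hz
  · filter_upwards with z
    exact (continuous_laplaceKernel.comp (Continuous.prodMk_left z)).continuousWithinAt

lemma integral_laplaceKernel_mem_Icc (hν : ∀ᵐ z ∂ν, 0 ≤ z) {l : ι → ℝ} (hl : 0 ≤ l) :
    ∫ z, laplaceKernel l z ∂ν ∈ Icc (0 : ℝ) 1 := by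
  refine ⟨integral_nonneg fun z => (laplaceKernel_pos l z).le, ?_⟩
  calc _ ≤ ∫ _z, (1 : ℝ) ∂ν := by
        refine integral_mono_ae (integrable_laplaceKernel hν hl) (integrable_const 1) ?_
        filter_upwards [hν] with z hz
        exact laplaceKernel_le_one hl hz
    _ = 1 := by simp

/-- A probability measure on the orthant is determined by its Laplace transform. -/
theorem ext_of_laplaceTransform {ν' : Measure (ι → ℝ)} [IsProbabilityMeasure ν']
    (hν : ∀ᵐ z ∂ν, 0 ≤ z) (hν' : ∀ᵐ z ∂ν', 0 ≤ z)
    (h : ∀ l : ι → ℝ, 0 ≤ l → ∫ z, laplaceKernel l z ∂ν = ∫ z, laplaceKernel l z ∂ν') :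
    ν = ν' := by
  classical
  -- The exponentials are bounded only on the orthant, so the point-separating algebra lives on this
  -- Polish subspace.
  let X : Type _ := ↥(Ici (0 : ι → ℝ))
  have hpol : PolishSpace X := isClosed_Ici.polishSpace
  have hmap : ∀ ρ : Measure (ι → ℝ), (∀ᵐ z ∂ρ, 0 ≤ z) →
      (ρ.comap (Subtype.val : X → ι → ℝ)).map Subtype.val = ρ := fun ρ hρ => by
    rw [map_comap_subtype_coe measurableSet_Ici, Measure.restrict_eq_self_of_ae_mem (s := Ici 0) hρ]
  have hemb : MeasurableEmbedding (Subtype.val : X → ι → ℝ) :=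
    MeasurableEmbedding.subtype_coe measurableSet_Ici
  have hfin : ∀ ρ : Measure (ι → ℝ), IsProbabilityMeasure ρ →
      IsFiniteMeasure (ρ.comap (Subtype.val : X → ι → ℝ)) := fun ρ _ =>
    ⟨by rw [hemb.comap_apply]; exact measure_lt_top ρ _⟩
  have := hfin ν inferInstance
  have := hfin ν' inferInstance
  let e : (l : {l : ι → ℝ // 0 ≤ l}) → BoundedContinuousFunction X ℝ := fun l =>
    BoundedContinuousFunction.ofNormedAddCommGroup (fun z : X => laplaceKernel l.1 z.1)
      (continuous_laplaceKernel.comp (continuous_const.prodMk continuous_subtype_val)) 1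
      fun z => by
        rw [Real.norm_of_nonneg (laplaceKernel_pos _ _).le]
        exact laplaceKernel_le_one l.2 z.2
  let S : Submonoid (BoundedContinuousFunction X ℝ) :=
    { carrier := range e
      one_mem' := ⟨⟨0, le_rfl⟩, by ext z; simp [e, laplaceKernel]⟩
      mul_mem' := by
        rintro _ _ ⟨l, rfl⟩ ⟨k, rfl⟩
        exact ⟨⟨l.1 + k.1, add_nonneg l.2 k.2⟩, by
          ext z; simp [e, laplaceKernel_add_left]⟩ }
  let A : StarSubalgebra ℝ (BoundedContinuousFunction X ℝ) :=
    { Algebra.adjoin ℝ (S : Set (BoundedContinuousFunction X ℝ)) with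
      star_mem' := fun {a} ha => by
        have : star a = a := by ext z; simp
        rw [this]; exact ha }
  have heq : ∀ g ∈ A, ∫ z, g z ∂(ν.comap (Subtype.val : X → ι → ℝ)) =
      ∫ z, g z ∂(ν'.comap (Subtype.val : X → ι → ℝ)) := by
    intro g hg
    -- Products of exponentials are exponentials, so the algebra they generate is their linear span
    -- and linearity of the integral suffices.
    have hg' : g ∈ Submodule.span ℝ (S : Set (BoundedContinuousFunction X ℝ)) := by
      have h1 : g ∈ Subalgebra.toSubmodule
        (Algebra.adjoin ℝ (S : Set (BoundedContinuousFunction X ℝ))) := hg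
      rwa [Algebra.adjoin_eq_span, Submonoid.closure_eq] at h1
    clear hg
    induction hg' using Submodule.span_induction with
    | mem g hgS =>
      obtain ⟨l, rfl⟩ := hgS
      have hl : ∀ ρ : Measure (ι → ℝ), (∀ᵐ z ∂ρ, 0 ≤ z) →
          ∫ z, e l z ∂(ρ.comap (Subtype.val : X → ι → ℝ)) = ∫ z, laplaceKernel l.1 z ∂ρ := by
        intro ρ hρ
        conv_rhs => rw [← hmap ρ hρ]
        rw [hemb.integral_map]
        rfl
      rw [hl ν hν, hl ν' hν', h l.1 l.2]
    | zero => simp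
    | add f g hf hg hf' hg' =>
      simp only [BoundedContinuousFunction.coe_add, Pi.add_apply]
      rw [integral_add (f.integrable _) (g.integrable _),
        integral_add (f.integrable _) (g.integrable _), hf', hg']
    | smul c f hf hf' =>
      simp only [BoundedContinuousFunction.coe_smul, smul_eq_mul]
      rw [integral_const_mul, integral_const_mul, hf']
  have hsep : (A.map (BoundedContinuousFunction.toContinuousMapStarₐ ℝ)).SeparatesPoints := by
    intro z w hzw
    have : ∃ i, z.1 i ≠ w.1 i := by
      by_contra hcon
      push Not at hcon
      exact hzw (Subtype.ext (funext hcon))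
    obtain ⟨i, hi⟩ := this
    have hl : 0 ≤ (Pi.single i 1 : ι → ℝ) := Pi.single_nonneg.2 zero_le_one
    refine ⟨e ⟨Pi.single i 1, hl⟩, ⟨_, ⟨e ⟨Pi.single i 1, hl⟩, ?_, rfl⟩, rfl⟩, ?_⟩
    · exact Algebra.subset_adjoin ⟨_, rfl⟩
    · have hk : ∀ z : ι → ℝ, laplaceKernel (Pi.single i 1) z = Real.exp (-z i) := fun z => by
        rw [laplaceKernel, Finset.sum_eq_single i] <;> simp +contextual
      change laplaceKernel (Pi.single i 1) z.1 ≠ laplaceKernel (Pi.single i 1) w.1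
      rw [hk, hk]
      intro hcon
      exact hi (neg_injective (Real.exp_injective hcon))
  rw [← hmap ν hν, ← hmap ν' hν',
    ext_of_forall_mem_subalgebra_integral_eq_of_polish (𝕜 := ℝ) hsep heq]

end LaplaceTransform

/-! ### Duality between energy jumps and moves of the Laplace variable. -/

section Duality

variable {n : ℕ} {TA TB : ℝ} {l z : Fin (n + 1) → ℝ} {x y : Fin (n + 1)} {s u : ℝ}

/-- The coordinate `x` of `l` is moved to the fraction `u` of its way to `s`. -/
noncomputable def moveTo (l : Fin (n + 1) → ℝ) (x : Fin (n + 1)) (s u : ℝ) : Fin (n + 1) → ℝ :=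
  Function.update l x ((1 - u) * l x + u * s)

/-- Generator of the moves of the coordinate `x` towards `s`, with intensity `du / u`. -/
noncomputable def moveGenerator (h : (Fin (n + 1) → ℝ) → ℝ) (l : Fin (n + 1) → ℝ)
    (x : Fin (n + 1)) (s : ℝ) : ℝ :=
  ∫ u in (0 : ℝ)..1, (h (moveTo l x s u) - h l) / u

/-- Killing rate due to the entrance of energy. -/
noncomputable def killingRate (T a : ℝ) : ℝ :=
  ∫ α in Ioi (0 : ℝ), Real.exp (-α / T) / α * (1 - Real.exp (-(a * α)))

lemma killingRate_nonneg {a : ℝ} (T : ℝ) (ha : 0 ≤ a) : 0 ≤ killingRate T a := by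
  refine setIntegral_nonneg measurableSet_Ioi fun α hα => ?_
  have hα' : 0 < α := hα
  refine mul_nonneg (div_nonneg (Real.exp_pos _).le hα'.le) (sub_nonneg.2 ?_)
  exact Real.exp_le_one_iff.2 (neg_nonpos.2 (mul_nonneg ha hα'.le))

lemma laplaceKernel_single (l : Fin (n + 1) → ℝ) (x : Fin (n + 1)) (α : ℝ) :
    laplaceKernel l (Pi.single x α) = Real.exp (-(l x * α)) := by
  rw [laplaceKernel, Finset.sum_eq_single x] <;> simp +contextual

lemma laplaceKernel_sub_single (l z : Fin (n + 1) → ℝ) (x : Fin (n + 1)) (α : ℝ) :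
    laplaceKernel l (z - Pi.single x α) = laplaceKernel l z * Real.exp (l x * α) := by
  rw [sub_eq_add_neg, ← Pi.single_neg, laplaceKernel_add_right, laplaceKernel_single]
  congr 2; ring

lemma laplaceKernel_moveTo (l z : Fin (n + 1) → ℝ) (x : Fin (n + 1)) (s u : ℝ) :
    laplaceKernel (moveTo l x s u) z =
      laplaceKernel l z * Real.exp (u * ((l x - s) * z x)) := by
  rw [laplaceKernel, laplaceKernel, ← Real.exp_add, ← Finset.add_sum_erase _ _ (Finset.mem_univ x),
    ← Finset.add_sum_erase _ (fun i => l i * z i) (Finset.mem_univ x)]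
  have : ∑ i ∈ Finset.univ.erase x, moveTo l x s u i * z i =
      ∑ i ∈ Finset.univ.erase x, l i * z i := Finset.sum_congr rfl fun i hi => by
    rw [moveTo, Function.update_of_ne (Finset.ne_of_mem_erase hi)]
  rw [this, moveTo, Function.update_self]
  congr 1; ring

/-- The substitution `α = u * a` is compatible with the scale-invariant intensity `dα / α`; it makes
the range of integration independent of the energy. -/
lemma integral_exp_mul_sub_div (L c a : ℝ) :
    ∫ α in (0 : ℝ)..a, (L * Real.exp (c * α) - L) / α =
      ∫ u in (0 : ℝ)..1, (L * Real.exp (u * (c * a)) - L) / u := by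
  rcases eq_or_ne a 0 with rfl | ha
  · simp
  · have := intervalIntegral.mul_integral_comp_mul_left
      (f := fun α => (L * Real.exp (c * α) - L) / α) (a := 0) (b := 1) a
    rw [mul_zero, mul_one] at this
    rw [← this, ← intervalIntegral.integral_const_mul]
    refine intervalIntegral.integral_congr fun u _ => ?_
    rw [show c * (a * u) = u * (c * a) by ring]
    field_simp

/-- Sending the energy `u * z x` from `x` to `y` changes `exp (-l · z)` exactly as moving `l x` the
fraction `u` of the way to `l y`; an exit has target `0`. An entrance multiplies by `exp (-l x *
α)`, whatever `z` is, hence the killing term. -/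
lemma generator_laplaceKernel (TA TB : ℝ) (l z : Fin (n + 1) → ℝ) :
    generator n TA TB (laplaceKernel l) z =
      ∑ p : Fin (n + 1) × Fin (n + 1) with Adjacent p.1 p.2,
        moveGenerator (fun l => laplaceKernel l z) l p.1 (l p.2) +
      ((moveGenerator (fun l => laplaceKernel l z) l 0 0 -
          killingRate TA (l 0) * laplaceKernel l z) +
        (moveGenerator (fun l => laplaceKernel l z) l (Fin.last n) 0 -
          killingRate TB (l (Fin.last n)) * laplaceKernel l z)) := by
  have hbath : ∀ T x, bathGenerator T x (laplaceKernel l) z =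
      moveGenerator (fun l => laplaceKernel l z) l x 0 -
        killingRate T (l x) * laplaceKernel l z := by
    intro T x
    rw [bathGenerator, moveGenerator, sub_eq_add_neg, killingRate, ← integral_mul_const,
      ← integral_neg]
    simp_rw [laplaceKernel_sub_single, laplaceKernel_moveTo, laplaceKernel_add_right,
      laplaceKernel_single, sub_zero]
    rw [integral_exp_mul_sub_div]
    congr 1
    refine setIntegral_congr_fun measurableSet_Ioi fun α _ => ?_
    ring
  rw [generator, bulkGenerator, hbath, hbath]
  congr 1
  refine Finset.sum_congr rfl fun p _ => ?_
  rw [moveGenerator]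
  simp_rw [laplaceKernel_moveTo, laplaceKernel_add_right, laplaceKernel_sub_single,
    laplaceKernel_single]
  rw [← integral_exp_mul_sub_div]
  refine intervalIntegral.integral_congr fun α _ => ?_
  rw [mul_assoc, ← Real.exp_add]
  congr 4; ring

lemma moveTo_nonneg (hl : 0 ≤ l) (hs : 0 ≤ s) (hu : 0 ≤ u) (hu1 : u ≤ 1) :
    0 ≤ moveTo l x s u := by
  intro i
  rcases eq_or_ne i x with rfl | hi
  · rw [moveTo, Function.update_self]
    exact add_nonneg (mul_nonneg (sub_nonneg.2 hu1) (hl i)) (mul_nonneg hu hs)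
  · rw [moveTo, Function.update_of_ne hi]; exact hl i

/-- The bound is uniform in `z`, so no moment of the invariant measure is needed. For `u ≤ 1 / 2`
the moved coordinate is still at least `l x / 2`, and `t * exp (-t) ≤ 1` absorbs the factor `z x`;
for larger `u` boundedness suffices. The constant degenerates as `l x → 0`, so the argument is
confined to positive `l`. -/
lemma abs_laplaceKernel_moveTo_le (hl : ∀ i, 0 < l i) (hs : 0 ≤ s) (hz : 0 ≤ z) (hu : 0 < u)
    (hu1 : u ≤ 1) :
    |(laplaceKernel (moveTo l x s u) z - laplaceKernel l z) / u| ≤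
      4 * |l x - s| / l x + 2 := by
  have hl0 : 0 ≤ l := fun i => (hl i).le
  have hlx := hl x
  have hzx : 0 ≤ z x := hz x
  have h0 : 0 ≤ 4 * |l x - s| / l x := by positivity
  rw [abs_div, abs_of_pos hu, div_le_iff₀ hu]
  rcases le_or_gt u (1 / 2) with h | h
  · have hle : ∀ a : ℝ, l x / 2 ≤ a → ∀ w : Fin (n + 1) → ℝ, (∀ i ≠ x, w i = l i) → w x = a →
        laplaceKernel w z ≤ Real.exp (-(l x / 2 * z x)) := by
      intro a ha w hw hwx
      refine Real.exp_le_exp.2 (neg_le_neg ?_)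
      have hw0 : 0 ≤ w := fun i => by
        rcases eq_or_ne i x with rfl | hi
        · change 0 ≤ w i
          rw [hwx]; linarith
        · rw [hw i hi]; exact hl0 i
      calc l x / 2 * z x ≤ w x * z x := by rw [hwx]; gcongr
        _ ≤ _ := le_sum_of_nonneg (z := fun i => w i * z i)
          (fun i => mul_nonneg (hw0 i) (hz i)) x
    have h1 : laplaceKernel l z ≤ Real.exp (-(l x / 2 * z x)) :=
      hle (l x) (by linarith) l (fun _ _ => rfl) rfl
    have h2 : laplaceKernel (moveTo l x s u) z ≤ Real.exp (-(l x / 2 * z x)) := by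
      refine hle ((1 - u) * l x + u * s) ?_ _ (fun i hi => Function.update_of_ne hi _ _)
        (Function.update_self _ _ _)
      nlinarith [mul_nonneg hu.le hs]
    have h3 := abs_exp_neg_sub_exp_neg_le (∑ i, moveTo l x s u i * z i) (∑ i, l i * z i)
    have h4 : ∑ i, moveTo l x s u i * z i - ∑ i, l i * z i = -(u * ((l x - s) * z x)) := by
      have := laplaceKernel_moveTo l z x s u
      rw [laplaceKernel, laplaceKernel, ← Real.exp_add] at this
      have := Real.exp_injective this
      linarith
    rw [h4, abs_neg, abs_mul, abs_mul, abs_of_pos hu, abs_of_nonneg hzx] at h3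
    have h5 : l x / 2 * z x * Real.exp (-(l x / 2 * z x)) ≤ 1 := by
      rw [Real.exp_neg, ← div_eq_mul_inv, div_le_one (Real.exp_pos _)]
      linarith [Real.add_one_le_exp (l x / 2 * z x)]
    calc _ ≤ u * (|l x - s| * z x) * (laplaceKernel (moveTo l x s u) z + laplaceKernel l z) := h3
      _ ≤ u * (|l x - s| * z x) * (Real.exp (-(l x / 2 * z x)) + Real.exp (-(l x / 2 * z x))) := by
          gcongr
      _ = 4 * |l x - s| / l x * (l x / 2 * z x * Real.exp (-(l x / 2 * z x))) * u := by
          field_simp; ring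
      _ ≤ 4 * |l x - s| / l x * 1 * u := by gcongr
      _ ≤ _ := by rw [mul_one]; nlinarith
  · have h1 := laplaceKernel_le_one hl0 hz
    have h2 := laplaceKernel_le_one (moveTo_nonneg (x := x) hl0 hs hu.le hu1) hz
    have h3 := laplaceKernel_pos l z
    have h4 := laplaceKernel_pos (moveTo l x s u) z
    have h5 : |laplaceKernel (moveTo l x s u) z - laplaceKernel l z| ≤ 1 :=
      abs_le.2 ⟨by linarith, by linarith⟩
    nlinarith

variable {ν : Measure (Fin (n + 1) → ℝ)} [IsProbabilityMeasure ν]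

lemma measurable_laplaceKernel_moveTo (l : Fin (n + 1) → ℝ) (x : Fin (n + 1)) (s : ℝ) :
    Measurable fun p : (Fin (n + 1) → ℝ) × ℝ =>
      (laplaceKernel (moveTo l x s p.2) p.1 - laplaceKernel l p.1) / p.2 := by
  simp_rw [laplaceKernel_moveTo]
  unfold laplaceKernel
  fun_prop

lemma integrable_laplaceKernel_moveTo (hν : ∀ᵐ z ∂ν, 0 ≤ z) (hl : ∀ i, 0 < l i) (hs : 0 ≤ s)
    (x : Fin (n + 1)) :
    Integrable (fun p : (Fin (n + 1) → ℝ) × ℝ =>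
      (laplaceKernel (moveTo l x s p.2) p.1 - laplaceKernel l p.1) / p.2)
      (ν.prod (volume.restrict (Ioc 0 1))) := by
  refine (integrable_const (4 * |l x - s| / l x + 2)).mono'
    (measurable_laplaceKernel_moveTo l x s).aestronglyMeasurable ?_
  have h1 : ∀ᵐ p ∂ν.prod (volume.restrict (Ioc (0 : ℝ) 1)), p.2 ∈ Ioc (0 : ℝ) 1 :=
    Measure.quasiMeasurePreserving_snd.ae (self_mem_ae_restrict measurableSet_Ioc)
  have h2 : ∀ᵐ p ∂ν.prod (volume.restrict (Ioc (0 : ℝ) 1)), 0 ≤ p.1 :=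
    Measure.quasiMeasurePreserving_fst.ae hν
  filter_upwards [h1, h2] with p hp hz
  exact abs_laplaceKernel_moveTo_le hl hs hz hp.1 hp.2

lemma integral_moveGenerator (hν : ∀ᵐ z ∂ν, 0 ≤ z) (hl : ∀ i, 0 < l i) (hs : 0 ≤ s)
    (x : Fin (n + 1)) :
    Integrable (fun z => moveGenerator (fun l => laplaceKernel l z) l x s) ν ∧
    IntervalIntegrable (fun u => ((∫ z, laplaceKernel (moveTo l x s u) z ∂ν) -
      ∫ z, laplaceKernel l z ∂ν) / u) volume 0 1 ∧
    ∫ z, moveGenerator (fun l => laplaceKernel l z) l x s ∂ν =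
      moveGenerator (fun l => ∫ z, laplaceKernel l z ∂ν) l x s := by
  have hi := integrable_laplaceKernel_moveTo hν hl hs x
  have hl0 : 0 ≤ l := fun i => (hl i).le
  have hin : ∀ u ∈ Ioc (0 : ℝ) 1,
      ∫ z, (laplaceKernel (moveTo l x s u) z - laplaceKernel l z) / u ∂ν =
        ((∫ z, laplaceKernel (moveTo l x s u) z ∂ν) - ∫ z, laplaceKernel l z ∂ν) / u := by
    intro u hu
    rw [integral_div, integral_sub
      (integrable_laplaceKernel hν (moveTo_nonneg hl0 hs hu.1.le hu.2))
      (integrable_laplaceKernel hν hl0)]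
  unfold moveGenerator
  simp_rw [intervalIntegral.integral_of_le (zero_le_one' ℝ)]
  refine ⟨hi.integral_prod_left, ?_, ?_⟩
  · rw [intervalIntegrable_iff_integrableOn_Ioc_of_le zero_le_one]
    exact IntegrableOn.congr_fun (hi.integral_prod_right) hin measurableSet_Ioc
  · rw [integral_integral_swap hi]
    exact setIntegral_congr_fun measurableSet_Ioc hin

/-- The equation for the Laplace transform of an invariant measure. -/
theorem IsInvariantMeasure.laplace_equation {ν : Measure (Fin (n + 1) → ℝ)}
    (h : IsInvariantMeasure n TA TB ν) (hl : ∀ i, 0 < l i) :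
    ∑ p : Fin (n + 1) × Fin (n + 1) with Adjacent p.1 p.2,
        moveGenerator (fun l => ∫ z, laplaceKernel l z ∂ν) l p.1 (l p.2) +
      (moveGenerator (fun l => ∫ z, laplaceKernel l z ∂ν) l 0 0 +
        moveGenerator (fun l => ∫ z, laplaceKernel l z ∂ν) l (Fin.last n) 0) =
      (killingRate TA (l 0) + killingRate TB (l (Fin.last n))) *
        ∫ z, laplaceKernel l z ∂ν := by
  have := h.isProbabilityMeasure
  have hν := h.ae_nonneg
  have hl0 : 0 ≤ l := fun i => (hl i).le
  have ht : IsTestFunction (laplaceKernel l) := by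
    refine ⟨ContDiff.contDiffOn (by unfold laplaceKernel; fun_prop), 1, fun z hz => ?_⟩
    rw [abs_of_pos (laplaceKernel_pos l z)]
    exact laplaceKernel_le_one hl0 hz
  have h1 := integral_moveGenerator hν hl le_rfl 0
  have h2 := integral_moveGenerator hν hl le_rfl (Fin.last n)
  have h3 := fun p : Fin (n + 1) × Fin (n + 1) => integral_moveGenerator hν hl (hl0 p.2) p.1
  have hL := integrable_laplaceKernel hν hl0
  have i1 := h1.1.sub (hL.const_mul (killingRate TA (l 0)))
  have i2 := h2.1.sub (hL.const_mul (killingRate TB (l (Fin.last n))))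
  have i3 := integrable_finsetSum (Finset.univ.filter
    fun p : Fin (n + 1) × Fin (n + 1) => Adjacent p.1 p.2) fun p _ => (h3 p).1
  have hgen := funext (generator_laplaceKernel TA TB l)
  have h0 := h.integral_generator_eq_zero _ ht (by rw [hgen]; exact i3.add (i1.add i2))
  have h4 := integral_add i3 (i1.add i2)
  have h5 := integral_add i1 i2
  have h6 := integral_sub h1.1 (hL.const_mul (killingRate TA (l 0)))
  have h7 := integral_sub h2.1 (hL.const_mul (killingRate TB (l (Fin.last n))))
  have h8 := integral_finsetSum (Finset.univ.filter
    fun p : Fin (n + 1) × Fin (n + 1) => Adjacent p.1 p.2) fun p _ => (h3 p).1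
  rw [integral_const_mul, h1.2.2] at h6
  rw [integral_const_mul, h2.2.2] at h7
  rw [Finset.sum_congr rfl fun p _ => (h3 p).2.2] at h8
  simp only [Pi.add_apply, Pi.sub_apply] at h4 h5
  rw [hgen] at h0
  rw [h4, h5, h6, h7, h8] at h0
  linarith

end Duality

/-! ### Maximum principle with a linear penalty and a logarithmic barrier. -/

section MaximumPrinciple

variable {n : ℕ}

/-- Coefficients of a linear function with discrete Laplacian `-2`. -/
def concaveWeight (x : Fin (n + 1)) : ℝ := ((x : ℕ) + 1) * (n + 1 - (x : ℕ))

lemma concaveWeight_nonneg (x : Fin (n + 1)) : 0 ≤ concaveWeight x := by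
  have : ((x : ℕ) : ℝ) ≤ n := Nat.cast_le.2 (Nat.lt_succ_iff.1 x.2)
  exact mul_nonneg (by positivity) (by linarith)

/-- Summation by parts: the coefficient of `l x` is the second difference of the weights, which
vanish at the virtual sites `-1` and `n + 1` where the baths sit. -/
lemma sum_concaveWeight (l : Fin (n + 1) → ℝ) :
    ∑ p : Fin (n + 1) × Fin (n + 1) with Adjacent p.1 p.2,
        concaveWeight p.1 * (l p.2 - l p.1) +
      (concaveWeight (0 : Fin (n + 1)) * (0 - l 0) +
        concaveWeight (Fin.last n) * (0 - l (Fin.last n))) =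
      -2 * ∑ x, l x := by
  have h1 := Fin.sum_univ_succ (fun x : Fin (n + 1) => (2 * ((x : ℕ) : ℝ) - 1 - n) * l x)
  have h2 := Fin.sum_univ_castSucc (fun x : Fin (n + 1) => ((n : ℝ) - 1 - 2 * ((x : ℕ) : ℝ)) * l x)
  have h3 : ∑ x : Fin (n + 1), (2 * ((x : ℕ) : ℝ) - 1 - n) * l x +
      ∑ x : Fin (n + 1), ((n : ℝ) - 1 - 2 * ((x : ℕ) : ℝ)) * l x = -2 * ∑ x, l x := by
    rw [← Finset.sum_add_distrib, Finset.mul_sum]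
    exact Finset.sum_congr rfl fun x _ => by ring
  have h4 : ∑ i : Fin n, (concaveWeight i.castSucc * (l i.succ - l i.castSucc) +
      concaveWeight i.succ * (l i.castSucc - l i.succ)) =
      ∑ i : Fin n, (2 * ((i.succ : ℕ) : ℝ) - 1 - n) * l i.succ +
      ∑ i : Fin n, ((n : ℝ) - 1 - 2 * ((i.castSucc : ℕ) : ℝ)) * l i.castSucc := by
    rw [← Finset.sum_add_distrib]
    refine Finset.sum_congr rfl fun i _ => ?_
    simp only [concaveWeight, Fin.val_succ, Fin.val_castSucc]
    push_cast
    ring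
  rw [sum_adjacent (fun x y => concaveWeight x * (l y - l x)), h4]
  simp only [concaveWeight, Fin.val_zero, Fin.val_last, Nat.cast_zero] at h1 h2 ⊢
  linarith

lemma intervalIntegrable_one_sub_rpow :
    IntervalIntegrable (fun u : ℝ => 2 * (1 - u) ^ (-(1 / 2) : ℝ)) volume 0 1 := by
  have h := (intervalIntegral.intervalIntegrable_rpow' (a := 0) (b := 1)
    (r := -(1 / 2)) (by norm_num)).comp_sub_left 1
  simp only [sub_zero, sub_self] at h
  exact h.symm.const_mul 2

/-- With `r = (1 - u) ^ (-1 / 2)`, the left side is `2 * log r ≤ 2 * (r - 1)` and the right side is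
`2 * (r - 1 / r)`. After division by `u` the barrier increment thus has an integrable bound on `(0,
1)`. -/
lemma neg_log_one_sub_le {u : ℝ} (hu : 0 ≤ u) (hu1 : u < 1) :
    -Real.log (1 - u) ≤ u * (2 * (1 - u) ^ (-(1 / 2) : ℝ)) := by
  have ht : 0 < 1 - u := by linarith
  set r := (1 - u) ^ (-(1 / 2) : ℝ) with hr
  have hr0 : 0 < r := Real.rpow_pos_of_pos ht _
  have h1 : Real.log r = -(1 / 2) * Real.log (1 - u) := Real.log_rpow ht _
  have h2 := Real.log_le_sub_one_of_pos hr0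
  have h3 : r * r * (1 - u) = 1 := by
    rw [hr, ← Real.rpow_add ht]
    norm_num
    rw [Real.rpow_neg_one, inv_mul_cancel₀ ht.ne']
  have h4 : 1 ≤ r := by
    by_contra hcon
    push Not at hcon
    nlinarith
  nlinarith

/-- Barrier that is infinite where a coordinate vanishes. -/
noncomputable def logBarrier (Λ : ℝ) (l : Fin (n + 1) → ℝ) : ℝ := ∑ x, Real.log (Λ / l x)

/-- A move multiplies the coordinate by at least `1 - u`, so the barrier grows by an amount
independent of `l` and `s`, and its cost stays finite however close to a face the maximum lies. -/
lemma logBarrier_moveTo_le {Λ : ℝ} (hΛ : 0 < Λ) {l : Fin (n + 1) → ℝ} (hl : ∀ x, 0 < l x)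
    (x : Fin (n + 1)) {s u : ℝ} (hs : 0 ≤ s) (hu : 0 ≤ u) (hu1 : u < 1) :
    logBarrier Λ (moveTo l x s u) - logBarrier Λ l ≤ -Real.log (1 - u) := by
  have hu' : 0 < 1 - u := by linarith
  have hlx := hl x
  have h1 : 0 < (1 - u) * l x + u * s := by positivity
  rw [logBarrier, logBarrier, ← Finset.add_sum_erase _ _ (Finset.mem_univ x),
    ← Finset.add_sum_erase _ (fun i => Real.log (Λ / l i)) (Finset.mem_univ x)]
  have h2 : ∑ i ∈ Finset.univ.erase x, Real.log (Λ / moveTo l x s u i) =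
      ∑ i ∈ Finset.univ.erase x, Real.log (Λ / l i) := Finset.sum_congr rfl fun i hi => by
    rw [moveTo, Function.update_of_ne (Finset.ne_of_mem_erase hi)]
  rw [h2, moveTo, Function.update_self, add_sub_add_right_eq_sub, Real.log_div hΛ.ne' h1.ne',
    Real.log_div hΛ.ne' hlx.ne']
  have h3 : Real.log ((1 - u) * l x) ≤ Real.log ((1 - u) * l x + u * s) :=
    Real.log_le_log (by positivity) (by nlinarith [mul_nonneg hu hs])
  rw [Real.log_mul hu'.ne' hlx.ne'] at h3
  linarith

lemma sum_mul_moveTo (c l : Fin (n + 1) → ℝ) (x : Fin (n + 1)) (s u : ℝ) :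
    ∑ i, c i * moveTo l x s u i - ∑ i, c i * l i = u * (c x * (s - l x)) := by
  rw [← Finset.add_sum_erase _ _ (Finset.mem_univ x),
    ← Finset.add_sum_erase _ (fun i => c i * l i) (Finset.mem_univ x)]
  have h2 : ∑ i ∈ Finset.univ.erase x, c i * moveTo l x s u i =
      ∑ i ∈ Finset.univ.erase x, c i * l i := Finset.sum_congr rfl fun i hi => by
    rw [moveTo, Function.update_of_ne (Finset.ne_of_mem_erase hi)]
  rw [h2, moveTo, Function.update_self]
  ring

lemma logBarrier_nonneg {Λ : ℝ} {l : Fin (n + 1) → ℝ} (hl : ∀ x, 0 < l x) (hlΛ : ∀ x, l x ≤ Λ) :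
    0 ≤ logBarrier Λ l :=
  Finset.sum_nonneg fun x _ => Real.log_nonneg ((one_le_div (hl x)).2 (hlΛ x))

lemma log_le_logBarrier {Λ : ℝ} {l : Fin (n + 1) → ℝ} (hl : ∀ x, 0 < l x) (hlΛ : ∀ x, l x ≤ Λ)
    (x : Fin (n + 1)) : Real.log (Λ / l x) ≤ logBarrier Λ l :=
  Finset.single_le_sum (f := fun x => Real.log (Λ / l x))
    (fun x _ => Real.log_nonneg ((one_le_div (hl x)).2 (hlΛ x))) (Finset.mem_univ x)

variable {h : (Fin (n + 1) → ℝ) → ℝ} {H : ℝ}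

/-- The function penalized by a linear function and by the barrier attains its maximum. -/
lemma exists_isMax_penalized {Λ ε ε' : ℝ} (hε : 0 ≤ ε) (hε' : 0 < ε')
    (hc : ContinuousOn h (Ici 0)) (hH : ∀ l, 0 ≤ l → |h l| ≤ H)
    {l₀ : Fin (n + 1) → ℝ} (h₀ : ∀ x, 0 < l₀ x) (h₀Λ : ∀ x, l₀ x ≤ Λ)
    (hpos : 0 < h l₀ - ε * (∑ x, concaveWeight x * l₀ x) - ε' * logBarrier Λ l₀) :
    ∃ m : Fin (n + 1) → ℝ, (∀ x, 0 < m x) ∧ (∀ x, m x ≤ Λ) ∧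
      ∀ l : Fin (n + 1) → ℝ, (∀ x, 0 < l x) → (∀ x, l x ≤ Λ) →
        h l - ε * (∑ x, concaveWeight x * l x) - ε' * logBarrier Λ l ≤
          h m - ε * (∑ x, concaveWeight x * m x) - ε' * logBarrier Λ m := by
  set F : (Fin (n + 1) → ℝ) → ℝ := fun l =>
    h l - ε * (∑ x, concaveWeight x * l x) - ε' * logBarrier Λ l with hF
  have hΛ : 0 < Λ := (h₀ 0).trans_le (h₀Λ 0)
  obtain ⟨i, hi⟩ := Finite.exists_min l₀
  -- Below the second threshold the barrier alone exceeds the bound `H` of `h`, so the penalized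
  -- function is nonpositive there; the first keeps `l₀` in the compact box.
  set δ := min (l₀ i) (Λ * Real.exp (-(H / ε'))) with hδ
  have hδ0 : 0 < δ := lt_min (h₀ i) (by positivity)
  set K : Set (Fin (n + 1) → ℝ) := Icc (fun _ => δ) (fun _ => Λ) with hK
  have hK0 : l₀ ∈ K := ⟨fun x => (min_le_left _ _).trans (hi x), h₀Λ⟩
  have hcF : ContinuousOn F K := by
    refine ((hc.mono fun l hl x => hδ0.le.trans (hl.1 x)).sub ?_).sub ?_
    · exact Continuous.continuousOn (by fun_prop)
    · refine continuousOn_const.mul (continuousOn_finsetSum _ fun x _ => ?_)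
      refine ContinuousOn.log (continuousOn_const.div (continuous_apply x).continuousOn ?_) ?_
      · exact fun l hl => (hδ0.trans_le (hl.1 x)).ne'
      · exact fun l hl => (div_pos hΛ (hδ0.trans_le (hl.1 x))).ne'
  obtain ⟨m, hm, hmax⟩ := isCompact_Icc.exists_isMaxOn ⟨l₀, hK0⟩ hcF
  refine ⟨m, fun x => hδ0.trans_le (hm.1 x), hm.2, fun l hl hlΛ => ?_⟩
  by_cases hlK : l ∈ K
  · exact hmax hlK
  · have : ∃ x, l x < δ := by
      by_contra hcon
      push Not at hcon
      exact hlK ⟨hcon, hlΛ⟩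
    obtain ⟨x, hx⟩ := this
    have h1 : F l₀ ≤ F m := hmax hK0
    have h2 : H / ε' ≤ Real.log (Λ / l x) := by
      rw [Real.le_log_iff_exp_le (div_pos hΛ (hl x)), le_div_iff₀ (hl x)]
      have h3 : l x ≤ Λ * Real.exp (-(H / ε')) := hx.le.trans (min_le_right _ _)
      calc Real.exp (H / ε') * l x ≤ Real.exp (H / ε') * (Λ * Real.exp (-(H / ε'))) := by gcongr
        _ = Λ * (Real.exp (H / ε') * Real.exp (-(H / ε'))) := by ring
        _ = Λ := by rw [← Real.exp_add]; simp
    have h3 := log_le_logBarrier hl hlΛ x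
    have h4 : H ≤ ε' * logBarrier Λ l := by
      have := mul_le_mul_of_nonneg_left (h2.trans h3) hε'.le
      rwa [mul_div_cancel₀ _ hε'.ne'] at this
    have h5 : 0 ≤ ∑ x, concaveWeight x * l x :=
      Finset.sum_nonneg fun x _ => mul_nonneg (concaveWeight_nonneg x) (hl x).le
    have h6 := (le_abs_self _).trans (hH l fun x => (hl x).le)
    have h7 := mul_nonneg hε h5
    change F l ≤ F m
    refine le_trans ?_ h1
    refine le_trans ?_ hpos.le
    simp only [hF]
    linarith

/-- At the maximum every increment of `h` is at most the increment of the penalties. Moves towards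
`s ∈ [0, Λ]` with `u < 1` stay in the box where maximality holds. -/
lemma moveGenerator_le_of_isMax {Λ ε ε' : ℝ} (hε' : 0 ≤ ε')
    {m : Fin (n + 1) → ℝ} (hm : ∀ x, 0 < m x) (hmΛ : ∀ x, m x ≤ Λ)
    (hmax : ∀ l : Fin (n + 1) → ℝ, (∀ x, 0 < l x) → (∀ x, l x ≤ Λ) →
        h l - ε * (∑ x, concaveWeight x * l x) - ε' * logBarrier Λ l ≤
          h m - ε * (∑ x, concaveWeight x * m x) - ε' * logBarrier Λ m)
    (x : Fin (n + 1)) {s : ℝ} (hs : 0 ≤ s) (hsΛ : s ≤ Λ)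
    (hi : IntervalIntegrable (fun u => (h (moveTo m x s u) - h m) / u) volume 0 1) :
    moveGenerator h m x s ≤ ε * (concaveWeight x * (s - m x)) +
      ε' * ∫ u in (0 : ℝ)..1, 2 * (1 - u) ^ (-(1 / 2) : ℝ) := by
  have hΛ : 0 < Λ := (hm 0).trans_le (hmΛ 0)
  have hb := intervalIntegrable_one_sub_rpow.const_mul ε'
  have hconst : IntervalIntegrable (fun _ : ℝ => ε * (concaveWeight x * (s - m x))) volume 0 1 :=
    intervalIntegrable_const
  have e : ε * (concaveWeight x * (s - m x)) +
      ε' * ∫ u in (0 : ℝ)..1, 2 * (1 - u) ^ (-(1 / 2) : ℝ) =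
      ∫ u in (0 : ℝ)..1, (ε * (concaveWeight x * (s - m x)) +
        ε' * (2 * (1 - u) ^ (-(1 / 2) : ℝ))) := by
    rw [intervalIntegral.integral_add hconst hb, intervalIntegral.integral_const_mul]
    simp
  rw [e, moveGenerator]
  refine intervalIntegral.integral_mono_on_of_le_Ioo zero_le_one hi (hconst.add hb) fun u hu => ?_
  have hu0 := hu.1
  have hu1 := hu.2
  have hmv : ∀ i, 0 < moveTo m x s u i := fun i => by
    rcases eq_or_ne i x with rfl | hi
    · rw [moveTo, Function.update_self]
      have := mul_pos (sub_pos.2 hu1) (hm i)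
      have := mul_nonneg hu0.le hs
      linarith
    · rw [moveTo, Function.update_of_ne hi]; exact hm i
  have hmvΛ : ∀ i, moveTo m x s u i ≤ Λ := fun i => by
    rcases eq_or_ne i x with rfl | hi
    · rw [moveTo, Function.update_self]
      have h1 := mul_le_mul_of_nonneg_left (hmΛ i) (sub_pos.2 hu1).le
      have h2 := mul_le_mul_of_nonneg_left hsΛ hu0.le
      linarith
    · rw [moveTo, Function.update_of_ne hi]; exact hmΛ i
  have h1 := hmax _ hmv hmvΛ
  have h2 := logBarrier_moveTo_le hΛ hm x hs hu0.le hu1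
  have h3 := sum_mul_moveTo concaveWeight m x s u
  have h4 := neg_log_one_sub_le hu0.le hu1
  have h5 := mul_le_mul_of_nonneg_left (h2.trans h4) hε'
  rw [div_le_iff₀ hu0]
  have h6 : ε * (∑ i, concaveWeight i * moveTo m x s u i) - ε * ∑ i, concaveWeight i * m i =
      ε * (u * (concaveWeight x * (s - m x))) := by rw [← mul_sub, h3]
  linarith

/-- Maximum principle for the moves with killing. -/
theorem nonpos_of_moveGenerator {V : (Fin (n + 1) → ℝ) → ℝ} (hc : ContinuousOn h (Ici 0))
    (h0 : h 0 = 0) (hH : ∀ l, 0 ≤ l → |h l| ≤ H)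
    (hi : ∀ l : Fin (n + 1) → ℝ, (∀ x, 0 < l x) → ∀ x s, 0 ≤ s →
      IntervalIntegrable (fun u => (h (moveTo l x s u) - h l) / u) volume 0 1)
    (hV : ∀ l : Fin (n + 1) → ℝ, (∀ x, 0 < l x) → 0 ≤ V l)
    (heq : ∀ l : Fin (n + 1) → ℝ, (∀ x, 0 < l x) →
      ∑ p : Fin (n + 1) × Fin (n + 1) with Adjacent p.1 p.2, moveGenerator h l p.1 (l p.2) +
        (moveGenerator h l 0 0 + moveGenerator h l (Fin.last n) 0) = V l * h l)
    {l₀ : Fin (n + 1) → ℝ} (hl₀ : ∀ x, 0 < l₀ x) : h l₀ ≤ 0 := by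
  by_contra hcon
  push Not at hcon
  obtain ⟨i, hiΛ⟩ := Finite.exists_max l₀
  set Λ := l₀ i
  set W := ∑ x, concaveWeight x * l₀ x with hW
  have hW0 : 0 ≤ W := Finset.sum_nonneg fun x _ => mul_nonneg (concaveWeight_nonneg x) (hl₀ x).le
  -- The linear penalty costs at most half of `h l₀` and the barrier at most a quarter, so the
  -- maximum keeps `h ≥ h l₀ / 4`.
  set ε := h l₀ / (2 * (W + 1)) with hε
  have hε0 : 0 < ε := by positivity
  have hεW : ε * W ≤ h l₀ / 2 := by
    rw [hε, div_mul_eq_mul_div, div_le_div_iff₀ (by positivity) two_pos]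
    nlinarith
  set K := ∫ u in (0 : ℝ)..1, 2 * (1 - u) ^ (-(1 / 2) : ℝ) with hK
  have hK0 : 0 ≤ K := intervalIntegral.integral_nonneg zero_le_one fun u hu =>
    mul_nonneg zero_le_two (Real.rpow_nonneg (sub_nonneg.2 hu.2) _)
  -- Total number of kinds of moves: the ordered neighbour pairs and the two exits.
  set P : ℝ := ((Finset.univ.filter
    fun p : Fin (n + 1) × Fin (n + 1) => Adjacent p.1 p.2).card : ℝ) + 2 with hP
  have hP0 : 0 < P := by positivity
  have hg0 := logBarrier_nonneg hl₀ hiΛ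
  have hnear : ∃ δ > 0, ∀ l : Fin (n + 1) → ℝ, 0 ≤ l → ∑ x, l x < δ → h l < h l₀ / 4 := by
    have := Metric.continuousWithinAt_iff.1 (hc 0 self_mem_Ici) (h l₀ / 4) (by positivity)
    obtain ⟨δ, hδ, hd⟩ := this
    refine ⟨δ, hδ, fun l hl hls => ?_⟩
    have h1 : dist l 0 < δ := by
      rw [dist_pi_lt_iff hδ]
      intro x
      rw [Real.dist_eq, Pi.zero_apply, sub_zero, abs_of_nonneg (hl x)]
      exact (le_sum_of_nonneg hl x).trans_lt hls
    have h2 := hd hl h1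
    rw [h0, Real.dist_eq, sub_zero] at h2
    exact (le_abs_self _).trans_lt h2
  obtain ⟨δ, hδ, hd⟩ := hnear
  set g := logBarrier Λ l₀
  -- The second bound makes the barrier cost of all the moves at most `ε * δ`, to be beaten by the
  -- gain `2 * ε * ∑ m x` of the linear penalty.
  set ε' := min (h l₀ / (4 * (g + 1))) (ε * δ / (P * (K + 1))) with hε'
  have hε'0 : 0 < ε' := lt_min (by positivity) (by positivity)
  have hεg : ε' * g ≤ h l₀ / 4 := by
    calc ε' * g ≤ h l₀ / (4 * (g + 1)) * g := mul_le_mul_of_nonneg_right (min_le_left _ _) hg0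
      _ ≤ h l₀ / 4 := by
        rw [div_mul_eq_mul_div, div_le_div_iff₀ (by positivity) (by norm_num)]
        nlinarith
  have hεK : P * (ε' * K) ≤ ε * δ := by
    calc P * (ε' * K) ≤ P * (ε * δ / (P * (K + 1)) * K) := by
          gcongr; exact min_le_right _ _
      _ = ε * δ * (K / (K + 1)) := by field_simp
      _ ≤ ε * δ * 1 := by
          gcongr
          rw [div_le_one (by positivity)]; linarith
      _ = ε * δ := mul_one _
  obtain ⟨m, hm, hmΛ, hmax⟩ := exists_isMax_penalized hε0.le hε'0 hc hH hl₀ hiΛ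
    (by linarith)
  have hm0 : 0 ≤ m := fun x => (hm x).le
  have hhm : h l₀ / 4 ≤ h m := by
    have h1 := hmax l₀ hl₀ hiΛ
    have h2 : 0 ≤ ∑ x, concaveWeight x * m x :=
      Finset.sum_nonneg fun x _ => mul_nonneg (concaveWeight_nonneg x) (hm x).le
    have h3 := mul_nonneg hε0.le h2
    have h4 := mul_nonneg hε'0.le (logBarrier_nonneg hm hmΛ)
    linarith
  have hΛ0 : 0 ≤ Λ := (hl₀ i).le
  have hle := fun x s (hs : 0 ≤ s) (hsΛ : s ≤ Λ) =>
    moveGenerator_le_of_isMax hε'0.le hm hmΛ hmax x hs hsΛ (hi m hm x s hs)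
  have hsum : ∑ p : Fin (n + 1) × Fin (n + 1) with Adjacent p.1 p.2,
      moveGenerator h m p.1 (m p.2) ≤
      ∑ p : Fin (n + 1) × Fin (n + 1) with Adjacent p.1 p.2,
        (ε * (concaveWeight p.1 * (m p.2 - m p.1)) + ε' * K) :=
    Finset.sum_le_sum fun p _ => hle p.1 (m p.2) (hm0 p.2) (hmΛ p.2)
  rw [Finset.sum_add_distrib, Finset.sum_const, nsmul_eq_mul, ← Finset.mul_sum] at hsum
  have hl := hle 0 0 le_rfl hΛ0
  have hr := hle (Fin.last n) 0 le_rfl hΛ0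
  have hident := sum_concaveWeight m
  -- Killing has the favourable sign where `h` is positive, so the sum of the move generators at `m`
  -- is nonnegative.
  have hVh : 0 ≤ V m * h m := mul_nonneg (hV m hm) (le_trans (by positivity) hhm)
  rw [← heq m hm] at hVh
  have hfin : 2 * (ε * ∑ x, m x) ≤ P * (ε' * K) := by
    have h1 : ∀ a b c : ℝ, a + (b + c) = -2 * ∑ x, m x →
        ε * a + ε * b + ε * c = -2 * (ε * ∑ x, m x) := fun a b c e => by
      linear_combination ε * e
    have h2 := h1 _ _ _ hident
    rw [hP, add_mul]
    linarith
  -- The maximum is forced so close to the origin that continuity and `h 0 = 0` contradict `h m ≥ h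
  -- l₀ / 4`.
  have hS : ∑ x, m x < δ := by
    have h1 : 2 * (∑ x, m x) ≤ δ := by
      have : ε * (2 * ∑ x, m x) ≤ ε * δ := by linarith
      exact le_of_mul_le_mul_left this hε0
    linarith
  exact absurd (hd m hm0 hS) (not_lt.2 hhm)

end MaximumPrinciple

/-! ### Uniqueness and conclusion. -/

section Uniqueness

variable {n : ℕ} {TA TB : ℝ}

lemma IsInvariantMeasure.integral_laplaceKernel_le {ν ν' : Measure (Fin (n + 1) → ℝ)}
    (h : IsInvariantMeasure n TA TB ν) (h' : IsInvariantMeasure n TA TB ν')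
    {l : Fin (n + 1) → ℝ} (hl : ∀ x, 0 < l x) :
    ∫ z, laplaceKernel l z ∂ν ≤ ∫ z, laplaceKernel l z ∂ν' := by
  have := h.isProbabilityMeasure
  have := h'.isProbabilityMeasure
  have hν := h.ae_nonneg
  have hν' := h'.ae_nonneg
  set ψ : (Fin (n + 1) → ℝ) → ℝ := fun l => ∫ z, laplaceKernel l z ∂ν with hψ
  set ψ' : (Fin (n + 1) → ℝ) → ℝ := fun l => ∫ z, laplaceKernel l z ∂ν' with hψ'
  have hint : ∀ l : Fin (n + 1) → ℝ, (∀ x, 0 < l x) → ∀ x s, 0 ≤ s →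
      IntervalIntegrable (fun u => ((ψ - ψ') (moveTo l x s u) - (ψ - ψ') l) / u) volume 0 1 ∧
      moveGenerator (ψ - ψ') l x s = moveGenerator ψ l x s - moveGenerator ψ' l x s := by
    intro l hl x s hs
    have h1 := (integral_moveGenerator hν hl hs x).2.1
    have h2 := (integral_moveGenerator hν' hl hs x).2.1
    have e : ∀ u, ((ψ - ψ') (moveTo l x s u) - (ψ - ψ') l) / u =
        (ψ (moveTo l x s u) - ψ l) / u - (ψ' (moveTo l x s u) - ψ' l) / u := fun u => by
      simp only [Pi.sub_apply]; ring
    unfold moveGenerator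
    simp_rw [e]
    exact ⟨h1.sub h2, intervalIntegral.integral_sub h1 h2⟩
  -- Both transforms equal `1` at the origin and take values in `[0, 1]`, and the equation is
  -- linear, so the maximum principle applies to the difference. Exchanging the two measures gives
  -- the opposite inequality.
  have key : (ψ - ψ') l ≤ 0 := by
    refine nonpos_of_moveGenerator (H := 1)
      (V := fun l => killingRate TA (l 0) + killingRate TB (l (Fin.last n)))
      ((continuousOn_integral_laplaceKernel hν).sub (continuousOn_integral_laplaceKernel hν'))
      ?_ (fun l hl => ?_) (fun l hl x s hs => (hint l hl x s hs).1) (fun l hl => ?_)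
      (fun l hl => ?_) hl
    · simp [laplaceKernel]
    · have h1 := integral_laplaceKernel_mem_Icc hν hl
      have h2 := integral_laplaceKernel_mem_Icc hν' hl
      exact abs_le.2 ⟨by simp only [Pi.sub_apply]; linarith [h1.1, h2.2],
        by simp only [Pi.sub_apply]; linarith [h1.2, h2.1]⟩
    · exact add_nonneg (killingRate_nonneg _ (hl 0).le) (killingRate_nonneg _ (hl _).le)
    · rw [Finset.sum_congr rfl fun p _ => (hint l hl p.1 (l p.2) (hl p.2).le).2,
        (hint l hl 0 0 le_rfl).2, (hint l hl (Fin.last n) 0 le_rfl).2, Finset.sum_sub_distrib]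
      have h1 := h.laplace_equation hl
      have h2 := h'.laplace_equation hl
      simp only [Pi.sub_apply]
      linarith
  simpa using key

/-- There is at most one invariant probability measure. -/
theorem IsInvariantMeasure.eq {ν ν' : Measure (Fin (n + 1) → ℝ)}
    (h : IsInvariantMeasure n TA TB ν) (h' : IsInvariantMeasure n TA TB ν') : ν = ν' := by
  have := h.isProbabilityMeasure
  have := h'.isProbabilityMeasure
  have hν := h.ae_nonneg
  have hν' := h'.ae_nonneg
  refine ext_of_laplaceTransform hν hν' fun l hl => ?_
  -- The comparison is available only for positive `l`; boundary points are reached by continuity of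
  -- the transforms on the closed orthant.
  have hpath : Filter.Tendsto (fun k : ℕ => fun x => l x + 1 / ((k : ℝ) + 1)) Filter.atTop
      (nhdsWithin l (Ici 0)) := by
    refine tendsto_nhdsWithin_iff.2 ⟨tendsto_pi_nhds.2 fun x => ?_, .of_forall fun k x => ?_⟩
    · simpa using tendsto_one_div_add_atTop_nhds_zero_nat.const_add (l x)
    · exact add_nonneg (hl x) (by positivity)
  have h1 := (continuousOn_integral_laplaceKernel hν l hl).tendsto.comp hpath
  have h2 := (continuousOn_integral_laplaceKernel hν' l hl).tendsto.comp hpath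
  refine tendsto_nhds_unique h1 (h2.congr fun k => ?_)
  have hk : ∀ x, 0 < l x + 1 / ((k : ℝ) + 1) := fun x =>
    add_pos_of_nonneg_of_pos (hl x) (by positivity)
  exact le_antisymm (h'.integral_laplaceKernel_le h hk) (h.integral_laplaceKernel_le h' hk)

lemma isDensityOfTheInvariantMeasure_of_isTame {C : ℝ} {μ : (Fin (n + 1) → ℝ) → ℝ} (hA : 0 < TA)
    (hAB : TA ≤ TB) (hμ : IsTame (1 / TB) C μ) (hμ0 : ∀ z, 0 ≤ μ z) (hμ1 : ∫ z, μ z = 1)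
    (h : ∀ z : Fin (n + 1) → ℝ, (∀ x, 0 < z x) →
      ∑ j : JumpIndex n, ∫ α in Ioi 0, balanceKernel (jumpRate TA TB j) (jumpDir j) μ z α = 0) :
    IsDensityOfTheInvariantMeasure n TA TB μ := by
  have hinv := hμ.isInvariantMeasure hA hAB hμ0 hμ1 h
  exact ⟨hμ.isStationaryDensity hA hAB h, fun ν => ⟨fun hν => hν.eq hinv, fun hν => hν ▸ hinv⟩⟩

end Uniqueness

end HeatConduction

theorem theorem2 (n : ℕ) (TA TB : ℝ) (hA : 0 < TA) (hAB : TA ≤ TB) :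
    (TA < TB →
      HeatConduction.IsDensityOfTheInvariantMeasure n TA TB
        (HeatConduction.mixtureDensity n TA TB)) ∧
    (TA = TB →
      HeatConduction.IsDensityOfTheInvariantMeasure n TA TB
        (HeatConduction.prodExpDensity (fun _ => TA))) := by
  refine ⟨fun hlt => ?_, fun heq => ?_⟩
  · exact HeatConduction.isDensityOfTheInvariantMeasure_of_isTame hA hAB
      (HeatConduction.isTame_mixtureDensity hA hlt) (HeatConduction.mixtureDensity_nonneg hA)
      (HeatConduction.integral_mixtureDensity hA hlt)
      fun z hz => HeatConduction.sum_balance_mixtureDensity hA hAB hz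
  · subst heq
    exact HeatConduction.isDensityOfTheInvariantMeasure_of_isTame hA le_rfl
      (HeatConduction.isTame_prodExpDensity hA fun _ => ⟨le_rfl, le_rfl⟩)
      (HeatConduction.prodExpDensity_nonneg fun _ => hA)
      (HeatConduction.integral_prodExpDensity fun _ => hA)
      fun z hz => HeatConduction.sum_balance_prodExpDensity_const hA hz
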